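/- Let $\mathcal U=\mathcal U_q(\mathfrak{sl}_2)$ be the $\mathbb C(q)$-algebra generated by $K^{\pm1},E,F$ with $KE=q^2EK$, $KF=q^{-2}FK$, $[E,F]=\frac{K-K^{-1}}{q-q^{-1}}$, with the Hopf structure $\Delta(K)=K\otimes K$, $\Delta(E)=E\otimes K+1\otimes E$, $\Delta(F)=F\otimes 1+K^{-1}\otimes F$, $S(K)=K^{-1}$, $S(E)=-EK^{-1}$, $S(F)=-KF$, graded by $|E|=1$, $|F|=-1$, $|K|=0$. Let $\Lambda=(q-q^{-1})^2FE+qK+q^{-1}K^{-1}$ be the quantum Casimir, let $h\rhd x=\sum h_{(1)}xS(h_{(2)})$ be the left adjoint action, and let $\mathcal U^{\mathrm{lf}}=\{x : \dim(\mathcal U\rhd x)<\infty\}$; this is the subalgebra generated by $E,FK,K,\Lambda$, and $\Delta(\mathcal U^{\mathrm{lf}})\subseteq\mathcal U\otimes\mathcal U^{\mathrm{lf}}$. Put $u_i\otimes v_i=q^{i(i-1)/2}\frac{(q-q^{-1})^i}{[i]!}E^i\otimes F^i$ for $i\ge 0$. The braided tensor power $(\mathcal U^{\mathrm{lf}})^{\tilde\otimes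 n}$ is the vector space $(\mathcal U^{\mathrm{lf}})^{\otimes n}$ with the product defined inductively, for $g,x\in\mathcal U^{\mathrm{lf}}$ and $h,y\in(\mathcal U^{\mathrm{lf}})^{\tilde\otimes (n-1)}$ homogeneous, by $$(g\otimes h)\cdot(x\otimes y)=\sum_{i\ge0}q^{2(|h|+i)(|x|-i)}\,g(v_i\rhd x)\otimes(u_i\rhd h)\cdot y ,$$ where $\mathcal U$ acts on tensor powers through $\Delta$. The braided coproduct is $\underline\Delta(x)=\sum_{i\ge0}x_{(1)}S(K^{i+|x_{(2)}|}v_i)\otimes u_i\rhd x_{(2)}$, with $\underline\Delta^{(0)}=\mathrm{id}$ and $\underline\Delta^{(m+1)}=(\mathrm{id}\otimes\underline\Delta^{(m)})\circ\underline\Delta$. For $\underline i=(i_1<\dots<i_k)$ in $\{1,\dots,n\}$ and $z\in(\mathcal U^{\mathrm{lf}})^{\otimes k}$, let $z_{\underline i}\in(\mathcal U^{\mathrm{lf}})^{\otimes n}$ be obtained by placing the $j$-th tensor factor of $z$ in position $i_j$ and $1$ in all other positions. The unbraiding maps $\gamma_n\colon(\mathcal U^{\mathrm{lf}})^{\tilde\otimes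 n}\to\mathcal U^{\otimes n}$ are defined by letting $\gamma_1$ be the inclusion and $\gamma_{n+1}=(\mathrm{id}\otimes\gamma_n)\circ\varphi_{n+1}$, where $\varphi_{n+1}(a\otimes b)=\sum_{i\ge0}aK^{i+|b|}v_i\otimes u_i\rhd b$. Let $\tau_L\colon\mathcal U^{\mathrm{lf}}\to\mathcal U\otimes\mathcal U^{\mathrm{lf}}$ be the algebra morphism with $$E\mapsto K\otimes E,\qquad K\mapsto 1\otimes K-q^{-1}(q-q^{-1})^2FK\otimes E,\qquad \Lambda\mapsto1\otimes\Lambda,$$ $$FK\mapsto K^{-1}\otimes FK-qF\otimes\Lambda+q(q+q^{-1})F\otimes K-q^{-1}(q-q^{-1})^2F^2K\otimes E .$$ For a non-empty $A=\{i_1<\dots<i_k\}\subseteq\{1,\dots,n\}$ and $x\in\mathcal U^{\mathrm{lf}}$ put $$C_A(x)=\bigl((\mathrm{id}^{\otimes(i_k-2)}\otimes\alpha_{i_k-1})\circ\cdots\circ(\mathrm{id}\otimes\alpha_2)\circ\alpha_1(x)\bigr)\otimes1^{\otimes(n-i_k)},$$ with $\alpha_i=\Delta$ if $i\in A$ and $\alpha_i=\tau_L$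 otherwise; set $\Lambda_A=C_A(\Lambda)$, and let $\mathrm{AW}(n)\subseteq\mathcal U^{\otimes n}$ be the subalgebra generated by the $\Lambda_A$ with $A\ne\emptyset$. Then $\tau_L$ is well defined, $\underline\Delta$ takes values in $\mathcal U^{\mathrm{lf}}\otimes\mathcal U^{\mathrm{lf}}$, and for every $n$ the map $\gamma_n$ is an injective unital algebra morphism whose image contains $\mathrm{AW}(n)$, so that $\mathrm{AW}(n)$ may be viewed inside $(\mathcal U^{\mathrm{lf}})^{\tilde\otimes n}$. For every non-empty $A=\{i_1<\dots<i_k\}\subseteq\{1,\dots,n\}$ and every $x\in\mathcal U^{\mathrm{lf}}$, $$\gamma_n\bigl(\underline\Delta^{(k-1)}(x)_{\underline i}\bigr)=C_A(x).$$ In particular $\underline\Delta^{(k-1)}(\Lambda)_{\underline i}$ is the unique element of $(\mathcal U^{\mathrm{lf}})^{\tilde\otimes n}$ that $\gamma_n$ sends to $\Lambda_A$. -/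

import Mathlib

open scoped TensorProduct

noncomputable section

set_option linter.unusedSimpArgs false
set_option linter.unreachableTactic false
set_option linter.unusedTactic false
set_option linter.unnecessarySeqFocus false
set_option linter.style.longLine false

namespace AskeyWilson

/-! ### The base field `ℂ(q)` -/

/-- The field `ℂ(q)` of rational functions in one variable. -/
def Cq : Type := RatFunc ℂ

instance : Field Cq := inferInstanceAs (Field (RatFunc ℂ))

/-- The variable `q`. -/
def q : Cq := (RatFunc.X : RatFunc ℂ)

theorem q_ne_zero : q ≠ 0 := RatFunc.X_ne_zero

theorem q_pow_ne_one {n : ℕ} (hn : n ≠ 0) : q ^ n ≠ 1 := by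
  intro h
  have h' : (algebraMap (Polynomial ℂ) (RatFunc ℂ)) (Polynomial.X ^ n)
      = algebraMap (Polynomial ℂ) (RatFunc ℂ) 1 := by
    rw [map_pow, RatFunc.algebraMap_X, map_one]; exact h
  have h2 := congrArg Polynomial.natDegree (RatFunc.algebraMap_injective ℂ h')
  simp at h2
  exact hn h2

theorem q_zpow_ne_one {n : ℤ} (hn : n ≠ 0) : q ^ n ≠ 1 := by
  obtain ⟨m, rfl | rfl⟩ := n.eq_nat_or_neg
  · rw [zpow_natCast]; exact q_pow_ne_one (by simpa using hn)
  · rw [zpow_neg, zpow_natCast, ne_eq, inv_eq_one]; exact q_pow_ne_one (by simpa using hn)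

theorem q_sub_ne_zero : q - q⁻¹ ≠ 0 := by
  intro h
  have h0 := q_ne_zero
  apply q_pow_ne_one (n := 2) (by norm_num)
  field_simp at h
  linear_combination h

/-! ### The quantum group `U_q(sl₂)` -/

/-- Names for the generators `E`, `F`, `K`, `K⁻¹`. -/
inductive Gen
  | E | F | K | Kinv

/-- The defining relations of `U_q(sl₂)`. -/
inductive Rel : FreeAlgebra Cq Gen → FreeAlgebra Cq Gen → Prop
  | K_Kinv : Rel (.ι Cq .K * .ι Cq .Kinv) 1
  | Kinv_K : Rel (.ι Cq .Kinv * .ι Cq .K) 1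
  | K_E : Rel (.ι Cq .K * .ι Cq .E) (q ^ 2 • (.ι Cq .E * .ι Cq .K))
  | K_F : Rel (.ι Cq .K * .ι Cq .F) (q⁻¹ ^ 2 • (.ι Cq .F * .ι Cq .K))
  | E_F : Rel (.ι Cq .E * .ι Cq .F - .ι Cq .F * .ι Cq .E)
      ((q - q⁻¹)⁻¹ • (.ι Cq .K - .ι Cq .Kinv))

/-- The quantum group `U_q(sl₂)` over `ℂ(q)`. -/
def U : Type := RingQuot Rel

instance : Ring U := inferInstanceAs (Ring (RingQuot Rel))
instance : Algebra Cq U := inferInstanceAs (Algebra Cq (RingQuot Rel))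

/-- The quotient map. -/
def mkU : FreeAlgebra Cq Gen →ₐ[Cq] U := RingQuot.mkAlgHom Cq Rel

theorem mkU_rel {x y : FreeAlgebra Cq Gen} (h : Rel x y) : mkU x = mkU y :=
  RingQuot.mkAlgHom_rel Cq h

/-- The class of a generator in `U_q(sl₂)`. -/
def gen (g : Gen) : U := mkU (.ι Cq g)

/-- The generator `E`. -/
def E : U := gen .E
/-- The generator `F`. -/
def F : U := gen .F
/-- The generator `K`. -/
def K : U := gen .K
/-- The generator `K⁻¹`. -/
def Kinv : U := gen .Kinv

theorem K_mul_Kinv : K * Kinv = 1 := by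
  simpa only [K, Kinv, gen, map_mul, map_one] using mkU_rel Rel.K_Kinv

theorem Kinv_mul_K : Kinv * K = 1 := by
  simpa only [K, Kinv, gen, map_mul, map_one] using mkU_rel Rel.Kinv_K

theorem K_mul_E : K * E = q ^ 2 • (E * K) := by
  simpa only [K, E, gen, map_mul, map_smul] using mkU_rel Rel.K_E

theorem K_mul_F : K * F = q⁻¹ ^ 2 • (F * K) := by
  simpa only [K, F, gen, map_mul, map_smul] using mkU_rel Rel.K_F

theorem E_mul_F_sub : E * F - F * E = (q - q⁻¹)⁻¹ • (K - Kinv) := by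
  simpa only [K, F, E, Kinv, gen, map_mul, map_smul, map_sub] using mkU_rel Rel.E_F

/-- `K` as a unit, so that `K ^ d` makes sense for every integer `d`. -/
def Ku : Uˣ := ⟨K, Kinv, K_mul_Kinv, Kinv_mul_K⟩

/-- The integer power `K ^ d`. -/
def Kpow (d : ℤ) : U := ((Ku ^ d : Uˣ) : U)

/-- The universal property of `U_q(sl₂)`. -/
def liftU {A : Type*} [Ring A] [Algebra Cq A] (e f k k' : A)
    (h₁ : k * k' = 1) (h₂ : k' * k = 1) (h₃ : k * e = q ^ 2 • (e * k))
    (h₄ : k * f = q⁻¹ ^ 2 • (f * k)) (h₅ : e * f - f * e = (q - q⁻¹)⁻¹ • (k - k')) :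
    U →ₐ[Cq] A :=
  RingQuot.liftAlgHom Cq ⟨FreeAlgebra.lift Cq (fun g => match g with
    | .E => e | .F => f | .K => k | .Kinv => k'), by
      intro x y h
      cases h <;> simp only [map_mul, map_smul, map_sub, map_one, FreeAlgebra.lift_ι_apply] <;>
        assumption⟩

section liftU
variable {A : Type*} [Ring A] [Algebra Cq A] {e f k k' : A}
    {h₁ : k * k' = 1} {h₂ : k' * k = 1} {h₃ : k * e = q ^ 2 • (e * k)}
    {h₄ : k * f = q⁻¹ ^ 2 • (f * k)} {h₅ : e * f - f * e = (q - q⁻¹)⁻¹ • (k - k')}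

@[simp] theorem liftU_E : liftU e f k k' h₁ h₂ h₃ h₄ h₅ E = e := by
  erw [RingQuot.liftAlgHom_mkAlgHom_apply]; exact FreeAlgebra.lift_ι_apply _ _

@[simp] theorem liftU_F : liftU e f k k' h₁ h₂ h₃ h₄ h₅ F = f := by
  erw [RingQuot.liftAlgHom_mkAlgHom_apply]; exact FreeAlgebra.lift_ι_apply _ _

@[simp] theorem liftU_K : liftU e f k k' h₁ h₂ h₃ h₄ h₅ K = k := by
  erw [RingQuot.liftAlgHom_mkAlgHom_apply]; exact FreeAlgebra.lift_ι_apply _ _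

@[simp] theorem liftU_Kinv : liftU e f k k' h₁ h₂ h₃ h₄ h₅ Kinv = k' := by
  erw [RingQuot.liftAlgHom_mkAlgHom_apply]; exact FreeAlgebra.lift_ι_apply _ _
end liftU

/-- `U_q(sl₂)` is generated by `E`, `F`, `K`, `K⁻¹`. -/
theorem mem_of_gens (S : Subalgebra Cq U) (hE : E ∈ S) (hF : F ∈ S) (hK : K ∈ S)
    (hK' : Kinv ∈ S) (x : U) : x ∈ S := by
  obtain ⟨y, rfl⟩ : ∃ y, mkU y = x := RingQuot.mkAlgHom_surjective Cq Rel x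
  induction y using FreeAlgebra.induction with
  | grade0 r => rw [AlgHom.commutes]; exact S.algebraMap_mem r
  | grade1 g => cases g <;> assumption
  | mul a b ha hb => rw [map_mul]; exact S.mul_mem ha hb
  | add a b ha hb => rw [map_add]; exact S.add_mem ha hb

/-! Rewriting rules towards the order `F`, `K`, `E`. -/

theorem E_mul_K : E * K = q⁻¹ ^ 2 • (K * E) := by
  rw [K_mul_E, smul_smul, ← mul_pow, inv_mul_cancel₀ q_ne_zero, one_pow, one_smul]

theorem E_mul_Kinv : E * Kinv = q ^ 2 • (Kinv * E) := by
  have h := congrArg (fun z => Kinv * z * Kinv) K_mul_E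
  simp only [mul_smul_comm, smul_mul_assoc] at h
  rw [← mul_assoc Kinv K, Kinv_mul_K, one_mul, mul_assoc Kinv (E * K), mul_assoc E, K_mul_Kinv,
    mul_one] at h
  exact h

theorem Kinv_mul_F : Kinv * F = q ^ 2 • (F * Kinv) := by
  have h := congrArg (fun z => q ^ 2 • (Kinv * z * Kinv)) K_mul_F
  simp only [mul_smul_comm, smul_mul_assoc, smul_smul] at h
  rw [← mul_assoc Kinv K, Kinv_mul_K, one_mul, mul_assoc Kinv (F * K), mul_assoc F, K_mul_Kinv,
    mul_one, ← mul_pow, mul_inv_cancel₀ q_ne_zero, one_pow, one_smul] at h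
  exact h.symm

theorem E_mul_F : E * F = F * E + (q - q⁻¹)⁻¹ • (K - Kinv) := by
  rw [← E_mul_F_sub]; abel

theorem E_mul_K' (z : U) : E * (K * z) = q⁻¹ ^ 2 • (K * (E * z)) := by
  rw [← mul_assoc, E_mul_K, smul_mul_assoc, mul_assoc]

theorem E_mul_Kinv' (z : U) : E * (Kinv * z) = q ^ 2 • (Kinv * (E * z)) := by
  rw [← mul_assoc, E_mul_Kinv, smul_mul_assoc, mul_assoc]

theorem K_mul_F' (z : U) : K * (F * z) = q⁻¹ ^ 2 • (F * (K * z)) := by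
  rw [← mul_assoc, K_mul_F, smul_mul_assoc, mul_assoc]

theorem Kinv_mul_F' (z : U) : Kinv * (F * z) = q ^ 2 • (F * (Kinv * z)) := by
  rw [← mul_assoc, Kinv_mul_F, smul_mul_assoc, mul_assoc]

theorem E_mul_F' (z : U) : E * (F * z) = F * (E * z) + (q - q⁻¹)⁻¹ • (K * z - Kinv * z) := by
  rw [← mul_assoc, E_mul_F, add_mul, smul_mul_assoc, sub_mul, mul_assoc]

theorem K_mul_Kinv' (z : U) : K * (Kinv * z) = z := by rw [← mul_assoc, K_mul_Kinv, one_mul]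

theorem Kinv_mul_K' (z : U) : Kinv * (K * z) = z := by rw [← mul_assoc, Kinv_mul_K, one_mul]

/-! ### The Hopf algebra structure maps -/

/-- The comultiplication: `Δ(K) = K ⊗ K`, `Δ(E) = E ⊗ K + 1 ⊗ E`, `Δ(F) = F ⊗ 1 + K⁻¹ ⊗ F`. -/
def comul : U →ₐ[Cq] U ⊗[Cq] U :=
  liftU (E ⊗ₜ K + 1 ⊗ₜ E) (F ⊗ₜ 1 + Kinv ⊗ₜ F) (K ⊗ₜ K) (Kinv ⊗ₜ Kinv)
    (by simp [K_mul_Kinv, Algebra.TensorProduct.one_def])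
    (by simp [Kinv_mul_K, Algebra.TensorProduct.one_def])
    (by
      simp only [mul_add, add_mul, Algebra.TensorProduct.tmul_mul_tmul, K_mul_E, mul_one, one_mul,
        smul_add, TensorProduct.smul_tmul', TensorProduct.tmul_smul])
    (by
      simp only [mul_add, add_mul, Algebra.TensorProduct.tmul_mul_tmul, K_mul_F, mul_one, one_mul,
        smul_add, TensorProduct.smul_tmul', TensorProduct.tmul_smul, K_mul_Kinv, Kinv_mul_K])
    (by
      have hq := q_ne_zero
      have hc := q_sub_ne_zero
      simp only [mul_add, add_mul, Algebra.TensorProduct.tmul_mul_tmul, E_mul_F, K_mul_F,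
        E_mul_Kinv, mul_one, one_mul, TensorProduct.add_tmul, TensorProduct.tmul_add,
        TensorProduct.tmul_sub, TensorProduct.sub_tmul, ← TensorProduct.smul_tmul',
        TensorProduct.tmul_smul, smul_sub, smul_smul]
      match_scalars <;> field_simp <;> ring)

/-- The counit: `ε(K) = 1`, `ε(E) = ε(F) = 0`. -/
def counit : U →ₐ[Cq] Cq :=
  liftU 0 0 1 1 (by simp) (by simp) (by simp) (by simp) (by simp)

/-- The antipode `S(K) = K⁻¹`, `S(E) = -EK⁻¹`, `S(F) = -KF`, as an algebra morphism to the
opposite algebra. -/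
def antipode : U →ₐ[Cq] Uᵐᵒᵖ :=
  liftU (.op (-(E * Kinv))) (.op (-(K * F))) (.op Kinv) (.op K)
    (by rw [← MulOpposite.op_mul, K_mul_Kinv]; rfl)
    (by rw [← MulOpposite.op_mul, Kinv_mul_K]; rfl)
    (by
      rw [← MulOpposite.op_mul, ← MulOpposite.op_mul, ← MulOpposite.op_smul]
      congr 1
      have hq := q_ne_zero
      simp only [mul_neg, neg_mul, mul_assoc, E_mul_Kinv, E_mul_Kinv', mul_smul_comm, smul_mul_assoc, smul_neg])
    (by
      rw [← MulOpposite.op_mul, ← MulOpposite.op_mul, ← MulOpposite.op_smul]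
      congr 1
      have hq := q_ne_zero
      simp only [mul_neg, neg_mul, mul_assoc, K_mul_F, K_mul_F', Kinv_mul_F, Kinv_mul_F',
        mul_smul_comm, smul_mul_assoc, smul_neg, Kinv_mul_K, K_mul_Kinv, Kinv_mul_K', K_mul_Kinv', smul_smul,
        mul_one]
      match_scalars
      field_simp)
    (by
      rw [← MulOpposite.op_mul, ← MulOpposite.op_mul, ← MulOpposite.op_sub, ← MulOpposite.op_sub,
        ← MulOpposite.op_smul]
      congr 1
      have hq := q_ne_zero
      have hc := q_sub_ne_zero
      simp only [mul_neg, neg_mul, neg_neg, mul_assoc, K_mul_F, K_mul_F', Kinv_mul_F, Kinv_mul_F',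
        E_mul_F, E_mul_F', E_mul_K, E_mul_K', E_mul_Kinv, E_mul_Kinv',
        mul_smul_comm, smul_mul_assoc, smul_neg, Kinv_mul_K, K_mul_Kinv, Kinv_mul_K', K_mul_Kinv', smul_smul,
        mul_one, mul_add, mul_sub, smul_add, smul_sub]
      match_scalars <;> field_simp <;> ring)

/-- The antipode as a linear map. -/
def S : U →ₗ[Cq] U := (MulOpposite.opLinearEquiv Cq).symm.toLinearMap ∘ₗ antipode.toLinearMap

theorem q_sq_sub_one_ne_zero : q ^ 2 - 1 ≠ 0 := sub_ne_zero.2 (q_pow_ne_one two_ne_zero)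

/-! ### The left adjoint action and the locally finite part -/

/-- The left adjoint action `h ▷ x = ∑ h₍₁₎ x S(h₍₂₎)` of `U_q(sl₂)` on itself. -/
def ad : U →ₐ[Cq] Module.End Cq U :=
  (AlgHom.mulLeftRight Cq U).comp
    ((Algebra.TensorProduct.map (AlgHom.id Cq U) antipode).comp comul)

theorem ad_E (x : U) : ad E x = (E * x - x * E) * Kinv := by
  have h1 : comul E = E ⊗ₜ K + 1 ⊗ₜ E := liftU_E
  have h2 : antipode K = .op Kinv := liftU_K
  have h3 : antipode E = .op (-(E * Kinv)) := liftU_E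
  simp [ad, h1, h2, h3, AlgHom.mulLeftRight_apply]
  noncomm_ring

theorem ad_F (x : U) : ad F x = F * x - Kinv * x * K * F := by
  have h1 : comul F = F ⊗ₜ 1 + Kinv ⊗ₜ F := liftU_F
  have h3 : antipode F = .op (-(K * F)) := liftU_F
  simp [ad, h1, h3, AlgHom.mulLeftRight_apply]
  noncomm_ring

theorem ad_K (x : U) : ad K x = K * x * Kinv := by
  have h1 : comul K = K ⊗ₜ K := liftU_K
  have h2 : antipode K = .op Kinv := liftU_K
  simp [ad, h1, h2, AlgHom.mulLeftRight_apply]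

theorem ad_Kinv (x : U) : ad Kinv x = Kinv * x * K := by
  have h1 : comul Kinv = Kinv ⊗ₜ Kinv := liftU_Kinv
  have h2 : antipode Kinv = .op K := liftU_Kinv
  simp [ad, h1, h2, AlgHom.mulLeftRight_apply]

theorem ad_K_mul (x y : U) : ad K (x * y) = ad K x * ad K y := by
  simp only [ad_K, mul_assoc, Kinv_mul_K']

theorem ad_Kinv_mul (x y : U) : ad Kinv (x * y) = ad Kinv x * ad Kinv y := by
  simp only [ad_Kinv, mul_assoc, K_mul_Kinv']

theorem ad_E_mul (x y : U) : ad E (x * y) = ad E x * ad K y + x * ad E y := by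
  simp only [ad_K, ad_E, mul_assoc, Kinv_mul_K', sub_mul, mul_sub]
  abel

theorem ad_F_mul (x y : U) : ad F (x * y) = ad F x * y + ad Kinv x * ad F y := by
  simp only [ad_Kinv, ad_F, mul_assoc, K_mul_Kinv', sub_mul, mul_sub]
  abel

/-- The orbit `U_q(sl₂) ▷ x`. -/
def orbit (x : U) : Submodule Cq U := LinearMap.range (ad.toLinearMap.flip x)

theorem mem_orbit {x y : U} : y ∈ orbit x ↔ ∃ h, ad h x = y := Iff.rfl

theorem self_mem_orbit (x : U) : x ∈ orbit x := ⟨1, by simp⟩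

theorem ad_mem_orbit {x y : U} (h : U) (hy : y ∈ orbit x) : ad h y ∈ orbit x := by
  obtain ⟨g, rfl⟩ := mem_orbit.1 hy
  exact mem_orbit.2 ⟨h * g, by simp⟩

theorem ad_mem_of_gens (V : Submodule Cq U) (hE : ∀ x ∈ V, ad E x ∈ V) (hF : ∀ x ∈ V, ad F x ∈ V)
    (hK : ∀ x ∈ V, ad K x ∈ V) (hK' : ∀ x ∈ V, ad Kinv x ∈ V) (h : U) :
    ∀ x ∈ V, ad h x ∈ V := by
  let T : Subalgebra Cq U :=
    { carrier := {h | ∀ x ∈ V, ad h x ∈ V}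
      mul_mem' := fun {a b} ha hb x hx => by
        rw [map_mul]; exact ha _ (hb _ hx)
      add_mem' := fun {a b} ha hb x hx => by
        rw [map_add]; exact V.add_mem (ha _ hx) (hb _ hx)
      algebraMap_mem' := fun r x hx => by
        rw [AlgHom.commutes]; exact V.smul_mem r hx }
  exact mem_of_gens T hE hF hK hK' h

theorem orbit_fg_of_gens (V : Submodule Cq U) (hV : V.FG) (hE : ∀ x ∈ V, ad E x ∈ V)
    (hF : ∀ x ∈ V, ad F x ∈ V) (hK : ∀ x ∈ V, ad K x ∈ V) (hK' : ∀ x ∈ V, ad Kinv x ∈ V)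
    {x : U} (hx : x ∈ V) : (orbit x).FG := by
  refine hV.of_le ?_
  rintro _ ⟨h, rfl⟩
  exact ad_mem_of_gens V hE hF hK hK' h x hx

/-- The locally finite part `U_q(sl₂)^lf`: the elements `x` for which `U_q(sl₂) ▷ x` is finite
dimensional. -/
def lf : Subalgebra Cq U where
  carrier := {x | (orbit x).FG}
  mul_mem' := fun {x y} hx hy => by
    have key : ∀ (h : U), (∀ a ∈ orbit x, ∀ b ∈ orbit y, ad h (a * b) ∈ orbit x * orbit y) →
        ∀ z ∈ orbit x * orbit y, ad h z ∈ orbit x * orbit y := by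
      intro h hh z hz
      induction hz using Submodule.mul_induction_on' with
      | mem_mul_mem a ha b hb => exact hh a ha b hb
      | add a _ b _ ha hb => rw [map_add]; exact Submodule.add_mem _ ha hb
    refine orbit_fg_of_gens (orbit x * orbit y) (Submodule.FG.mul hx hy) (key _ ?_) (key _ ?_)
      (key _ ?_) (key _ ?_) (Submodule.mul_mem_mul (self_mem_orbit x) (self_mem_orbit y))
    · intro a ha b hb
      rw [ad_E_mul]
      exact add_mem (Submodule.mul_mem_mul (ad_mem_orbit _ ha) (ad_mem_orbit _ hb))
        (Submodule.mul_mem_mul ha (ad_mem_orbit _ hb))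
    · intro a ha b hb
      rw [ad_F_mul]
      exact add_mem (Submodule.mul_mem_mul (ad_mem_orbit _ ha) hb)
        (Submodule.mul_mem_mul (ad_mem_orbit _ ha) (ad_mem_orbit _ hb))
    · intro a ha b hb
      rw [ad_K_mul]
      exact Submodule.mul_mem_mul (ad_mem_orbit _ ha) (ad_mem_orbit _ hb)
    · intro a ha b hb
      rw [ad_Kinv_mul]
      exact Submodule.mul_mem_mul (ad_mem_orbit _ ha) (ad_mem_orbit _ hb)
  add_mem' := fun {x y} hx hy => by
    refine Submodule.FG.of_le (Submodule.FG.sup hx hy) ?_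
    rintro _ ⟨h, rfl⟩
    rw [map_add]
    exact Submodule.add_mem_sup ⟨h, rfl⟩ ⟨h, rfl⟩
  algebraMap_mem' := fun r => by
    refine orbit_fg_of_gens (Submodule.span Cq {1}) (Submodule.fg_span_singleton _)
      ?_ ?_ ?_ ?_ (x := algebraMap Cq U r)
      (Submodule.mem_span_singleton.2 ⟨r, (Algebra.algebraMap_eq_smul_one r).symm⟩)
    all_goals
      intro x hx
      obtain ⟨s, rfl⟩ := Submodule.mem_span_singleton.1 hx
      rw [map_smul]
      refine Submodule.smul_mem _ _ (Submodule.mem_span_singleton.2 ?_)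
    · exact ⟨0, by simp [ad_E]⟩
    · exact ⟨0, by simp [ad_F, Kinv_mul_K]⟩
    · exact ⟨1, by simp [ad_K, K_mul_Kinv]⟩
    · exact ⟨1, by simp [ad_Kinv, Kinv_mul_K]⟩

theorem mem_lf {x : U} : x ∈ lf ↔ (orbit x).FG := Iff.rfl

theorem ad_mem_lf (h : U) {x : U} (hx : x ∈ lf) : ad h x ∈ lf := by
  refine Submodule.FG.of_le (mem_lf.1 hx) ?_
  rintro _ ⟨g, rfl⟩
  exact ad_mem_orbit g (ad_mem_orbit h (self_mem_orbit x))

/-- The left adjoint action of `U_q(sl₂)` on its locally finite part. -/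
def adlf : U →ₐ[Cq] Module.End Cq lf where
  toFun h := (ad h).restrict (p := lf.toSubmodule) (q := lf.toSubmodule)
    (fun _ hx => ad_mem_lf h hx)
  map_one' := by ext; simp
  map_mul' a b := by ext; simp
  map_zero' := by ext; simp
  map_add' a b := by ext; simp
  commutes' r := by
    ext x
    exact congrArg (fun f : Module.End Cq U => f x) (ad.commutes r)

@[simp] theorem coe_adlf (h : U) (x : lf) : (adlf h x : U) = ad h x := rfl

/-! ### The quantum Casimir and the subalgebra `I_L` -/

/-- The quantum Casimir `Λ = (q - q⁻¹)² FE + qK + q⁻¹K⁻¹`. -/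
def casimir : U := (q - q⁻¹) ^ 2 • (F * E) + q • K + q⁻¹ • Kinv

theorem casimir_mul_E : casimir * E = E * casimir := by
  have hq := q_ne_zero
  have hc := q_sub_ne_zero
  simp only [casimir, add_mul, mul_add, mul_neg, neg_mul, neg_neg, mul_assoc, K_mul_F, K_mul_F', Kinv_mul_F, Kinv_mul_F',
        E_mul_F, E_mul_F', E_mul_K, E_mul_K', E_mul_Kinv, E_mul_Kinv',
        mul_smul_comm, smul_mul_assoc, smul_neg, Kinv_mul_K, K_mul_Kinv, Kinv_mul_K', K_mul_Kinv', smul_smul,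
        mul_one, one_mul, mul_add, mul_sub, smul_add, smul_sub]
  match_scalars <;> field_simp <;> ring

theorem casimir_mul_F : casimir * F = F * casimir := by
  have hq := q_ne_zero
  have hc := q_sub_ne_zero
  simp only [casimir, add_mul, mul_add, mul_neg, neg_mul, neg_neg, mul_assoc, K_mul_F, K_mul_F', Kinv_mul_F, Kinv_mul_F',
        E_mul_F, E_mul_F', E_mul_K, E_mul_K', E_mul_Kinv, E_mul_Kinv',
        mul_smul_comm, smul_mul_assoc, smul_neg, Kinv_mul_K, K_mul_Kinv, Kinv_mul_K', K_mul_Kinv', smul_smul,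
        mul_one, one_mul, mul_add, mul_sub, smul_add, smul_sub]
  match_scalars <;> field_simp <;> ring

theorem casimir_mul_K : casimir * K = K * casimir := by
  have hq := q_ne_zero
  have hc := q_sub_ne_zero
  simp only [casimir, add_mul, mul_add, mul_neg, neg_mul, neg_neg, mul_assoc, K_mul_F, K_mul_F', Kinv_mul_F, Kinv_mul_F',
        E_mul_F, E_mul_F', E_mul_K, E_mul_K', E_mul_Kinv, E_mul_Kinv',
        mul_smul_comm, smul_mul_assoc, smul_neg, Kinv_mul_K, K_mul_Kinv, Kinv_mul_K', K_mul_Kinv', smul_smul,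
        mul_one, one_mul, mul_add, mul_sub, smul_add, smul_sub]

theorem casimir_mul_Kinv : casimir * Kinv = Kinv * casimir := by
  have h := congrArg (fun z => Kinv * z * Kinv) casimir_mul_K
  simp only [mul_assoc, K_mul_Kinv, Kinv_mul_K', mul_one] at h
  exact h.symm

theorem ad_E_FK : ad E (F * K) = (-(q * (q - q⁻¹)⁻¹)) • casimir
    + ((q ^ 2 + 1) * (q - q⁻¹)⁻¹) • K := by
  have hq := q_ne_zero
  have hc := q_sub_ne_zero
  have hc' := q_sq_sub_one_ne_zero
  simp only [ad_E, casimir, add_mul, mul_add, sub_mul, mul_neg, neg_mul, neg_neg, mul_assoc, K_mul_F, K_mul_F', Kinv_mul_F, Kinv_mul_F',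
        E_mul_F, E_mul_F', E_mul_K, E_mul_K', E_mul_Kinv, E_mul_Kinv',
        mul_smul_comm, smul_mul_assoc, smul_neg, Kinv_mul_K, K_mul_Kinv, Kinv_mul_K', K_mul_Kinv', smul_smul,
        mul_one, one_mul, mul_add, mul_sub, smul_add, smul_sub]
  match_scalars <;> field_simp <;> ring

theorem ad_F_E : ad F E = ((1 - q⁻¹ ^ 2) * ((q - q⁻¹) ^ 2)⁻¹) • casimir
    - ((q - q⁻¹ ^ 3) * ((q - q⁻¹) ^ 2)⁻¹) • K := by
  have hq := q_ne_zero
  have hc := q_sub_ne_zero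
  have hc' := q_sq_sub_one_ne_zero
  simp only [ad_F, casimir, add_mul, mul_add, sub_mul, mul_neg, neg_mul, neg_neg, mul_assoc, K_mul_F, K_mul_F', Kinv_mul_F, Kinv_mul_F',
        E_mul_F, E_mul_F', E_mul_K, E_mul_K', E_mul_Kinv, E_mul_Kinv',
        mul_smul_comm, smul_mul_assoc, smul_neg, Kinv_mul_K, K_mul_Kinv, Kinv_mul_K', K_mul_Kinv', smul_smul,
        mul_one, one_mul, mul_add, mul_sub, smul_add, smul_sub]
  match_scalars <;> field_simp <;> ring

theorem orbit_fg_gens {x : U} (hx : x ∈ ({E, F * K, K, casimir} : Set U)) : x ∈ lf := by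
  have hq := q_ne_zero
  set W : Submodule Cq U := Submodule.span Cq ({E, F * K, K, casimir} : Set U) with hW
  have hE : E ∈ W := Submodule.subset_span (by simp)
  have hFK : F * K ∈ W := Submodule.subset_span (by simp)
  have hK : K ∈ W := Submodule.subset_span (by simp)
  have hC : casimir ∈ W := Submodule.subset_span (by simp)
  have key : ∀ h : U, ad h E ∈ W → ad h (F * K) ∈ W → ad h K ∈ W → ad h casimir ∈ W →
      ∀ y ∈ W, ad h y ∈ W := by
    intro h h1 h2 h3 h4 y hy
    induction hy using Submodule.span_induction with
    | mem y hy => rcases hy with rfl | rfl | rfl | rfl <;> assumption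
    | zero => simp
    | add a b _ _ ha hb => rw [map_add]; exact add_mem ha hb
    | smul r a _ ha => rw [map_smul]; exact W.smul_mem r ha
  refine mem_lf.2 (orbit_fg_of_gens W (Submodule.fg_span (Set.toFinite _)) (key E ?_ ?_ ?_ ?_)
    (key F ?_ ?_ ?_ ?_) (key K ?_ ?_ ?_ ?_) (key Kinv ?_ ?_ ?_ ?_) (Submodule.subset_span hx))
  · rw [ad_E, sub_self, zero_mul]; exact W.zero_mem
  · rw [ad_E_FK]; exact add_mem (W.smul_mem _ hC) (W.smul_mem _ hK)
  · rw [ad_E, K_mul_E, sub_mul, smul_mul_assoc, mul_assoc, K_mul_Kinv, mul_one]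
    exact sub_mem hE (W.smul_mem _ hE)
  · rw [ad_E, casimir_mul_E, sub_self, zero_mul]; exact W.zero_mem
  · rw [ad_F_E]; exact sub_mem (W.smul_mem _ hC) (W.smul_mem _ hK)
  · have : ad F (F * K) = 0 := by
      simp only [ad_F, mul_assoc, K_mul_F, K_mul_F', Kinv_mul_F', Kinv_mul_K', Kinv_mul_K,
        mul_smul_comm, smul_mul_assoc, smul_smul, mul_one]
      match_scalars
      field_simp
      ring
    rw [this]; exact W.zero_mem
  · have : ad F K = (1 - q⁻¹ ^ 2) • (F * K) := by
      simp only [ad_F, mul_assoc, Kinv_mul_K', K_mul_F]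
      module
    rw [this]; exact W.smul_mem _ hFK
  · have : ad F casimir = 0 := by
      rw [ad_F, ← casimir_mul_Kinv, mul_assoc casimir, Kinv_mul_K, mul_one, casimir_mul_F, sub_self]
    rw [this]; exact W.zero_mem
  · rw [ad_K, K_mul_E, smul_mul_assoc, mul_assoc, K_mul_Kinv, mul_one]; exact W.smul_mem _ hE
  · rw [ad_K, mul_assoc, mul_assoc, K_mul_Kinv, mul_one, K_mul_F]; exact W.smul_mem _ hFK
  · rw [ad_K, mul_assoc, K_mul_Kinv, mul_one]; exact hK
  · rw [ad_K, ← casimir_mul_K, mul_assoc, K_mul_Kinv, mul_one]; exact hC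
  · have : ad Kinv E = q⁻¹ ^ 2 • E := by
      rw [ad_Kinv, mul_assoc, E_mul_K, mul_smul_comm, Kinv_mul_K']
    rw [this]; exact W.smul_mem _ hE
  · rw [ad_Kinv, ← mul_assoc, Kinv_mul_F, smul_mul_assoc, smul_mul_assoc, mul_assoc F, Kinv_mul_K,
      mul_one]
    exact W.smul_mem _ hFK
  · rw [ad_Kinv, Kinv_mul_K, one_mul]; exact hK
  · rw [ad_Kinv, ← casimir_mul_Kinv, mul_assoc, Kinv_mul_K, mul_one]; exact hC

/-- The subalgebra `I_L` of `U_q(sl₂)` generated by `E`, `FK`, `K` and `Λ`. -/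
def IL : Subalgebra Cq U := Algebra.adjoin Cq {E, F * K, K, casimir}

theorem IL_le_lf : IL ≤ lf := Algebra.adjoin_le fun _ hx => orbit_fg_gens hx

theorem E_mem_IL : E ∈ IL := Algebra.subset_adjoin (by simp)
theorem FK_mem_IL : F * K ∈ IL := Algebra.subset_adjoin (by simp)
theorem K_mem_IL : K ∈ IL := Algebra.subset_adjoin (by simp)
theorem casimir_mem_IL : casimir ∈ IL := Algebra.subset_adjoin (by simp)

/-! #### The equality `U_q(sl₂)^lf = I_L` -/

theorem conj_mem_IL {z : U} (hz : z ∈ IL) : K * z * Kinv ∈ IL ∧ Kinv * z * K ∈ IL := by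
  induction hz using Algebra.adjoin_induction with
  | mem x hx =>
    rcases hx with rfl | rfl | rfl | rfl
    · constructor
      · rw [K_mul_E, smul_mul_assoc, mul_assoc, K_mul_Kinv, mul_one]
        exact IL.smul_mem E_mem_IL _
      · rw [mul_assoc, E_mul_K, mul_smul_comm, Kinv_mul_K']
        exact IL.smul_mem E_mem_IL _
    · constructor
      · rw [mul_assoc, mul_assoc, K_mul_Kinv, mul_one, K_mul_F]
        exact IL.smul_mem FK_mem_IL _
      · rw [← mul_assoc, Kinv_mul_F, smul_mul_assoc, smul_mul_assoc, mul_assoc F, Kinv_mul_K,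
          mul_one]
        exact IL.smul_mem FK_mem_IL _
    · constructor
      · rw [mul_assoc, K_mul_Kinv, mul_one]; exact K_mem_IL
      · rw [Kinv_mul_K, one_mul]; exact K_mem_IL
    · constructor
      · rw [← casimir_mul_K, mul_assoc, K_mul_Kinv, mul_one]; exact casimir_mem_IL
      · rw [← casimir_mul_Kinv, mul_assoc, Kinv_mul_K, mul_one]; exact casimir_mem_IL
  | algebraMap r =>
    constructor
    · rw [← Algebra.commutes r K, mul_assoc, K_mul_Kinv, mul_one]; exact IL.algebraMap_mem r
    · rw [← Algebra.commutes r Kinv, mul_assoc, Kinv_mul_K, mul_one]; exact IL.algebraMap_mem r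
  | add x y _ _ hx hy =>
    simp only [mul_add, add_mul]
    exact ⟨add_mem hx.1 hy.1, add_mem hx.2 hy.2⟩
  | mul x y _ _ hx hy =>
    constructor
    · have := mul_mem hx.1 hy.1
      simpa only [mul_assoc, Kinv_mul_K'] using this
    · have := mul_mem hx.2 hy.2
      simpa only [mul_assoc, K_mul_Kinv'] using this

theorem mul_Kpow_mem_swap {y : U} (hy : y ∈ IL) (n : ℕ) : ∃ y' ∈ IL, y * K ^ n = K ^ n * y' := by
  induction n with
  | zero => exact ⟨y, hy, by simp⟩
  | succ n ih =>
    obtain ⟨y', hy', h⟩ := ih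
    refine ⟨Kinv * y' * K, (conj_mem_IL hy').2, ?_⟩
    rw [pow_succ, ← mul_assoc, h]
    simp only [mul_assoc, K_mul_Kinv']

theorem exists_mul_pow_mem_IL (x : U) : ∃ n : ℕ, x * K ^ n ∈ IL := by
  have mono : ∀ {x : U} {n m : ℕ}, n ≤ m → x * K ^ n ∈ IL → x * K ^ m ∈ IL := by
    intro x n m hnm h
    obtain ⟨d, rfl⟩ := Nat.exists_eq_add_of_le hnm
    rw [pow_add, ← mul_assoc]
    exact mul_mem h (pow_mem K_mem_IL d)
  let T : Subalgebra Cq U :=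
    { carrier := {x | ∃ n : ℕ, x * K ^ n ∈ IL}
      mul_mem' := by
        rintro a b ⟨n, ha⟩ ⟨m, hb⟩
        refine ⟨m + n, ?_⟩
        obtain ⟨y', hy', h⟩ := mul_Kpow_mem_swap hb n
        have : a * b * K ^ (m + n) = a * K ^ n * y' := by
          rw [pow_add, mul_assoc a, ← mul_assoc b, h, ← mul_assoc]
        rw [this]
        exact mul_mem ha hy'
      add_mem' := by
        rintro a b ⟨n, ha⟩ ⟨m, hb⟩
        refine ⟨max n m, ?_⟩
        rw [add_mul]
        exact add_mem (mono (le_max_left _ _) ha) (mono (le_max_right _ _) hb)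
      algebraMap_mem' := fun r => ⟨0, by simp⟩ }
  exact mem_of_gens T ⟨0, by simpa using E_mem_IL⟩ ⟨1, by simpa using FK_mem_IL⟩
    ⟨0, by simpa using K_mem_IL⟩ ⟨1, by simp [Kinv_mul_K]⟩ x

/-- The subspace `I_L K`. -/
def ILK : Submodule Cq U := (Subalgebra.toSubmodule IL).map (LinearMap.mulRight Cq K)

theorem mem_ILK {x : U} : x ∈ ILK ↔ ∃ y ∈ IL, y * K = x := Iff.rfl

theorem mul_mem_ILK {z x : U} (hz : z ∈ IL) (hx : x ∈ ILK) : z * x ∈ ILK := by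
  obtain ⟨y, hy, rfl⟩ := mem_ILK.1 hx
  exact mem_ILK.2 ⟨z * y, mul_mem hz hy, mul_assoc _ _ _⟩

theorem ILK_mul_mem {z x : U} (hz : z ∈ IL) (hx : x ∈ ILK) : x * z ∈ ILK := by
  obtain ⟨y, hy, rfl⟩ := mem_ILK.1 hx
  refine mem_ILK.2 ⟨y * (K * z * Kinv), mul_mem hy (conj_mem_IL hz).1, ?_⟩
  simp only [mul_assoc, Kinv_mul_K, mul_one]

theorem commutator_mem_ILK {y : U} (hy : y ∈ IL) : E * y - y * E ∈ ILK := by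
  induction hy using Algebra.adjoin_induction with
  | mem x hx =>
    rcases hx with rfl | rfl | rfl | rfl
    · rw [sub_self]; exact ILK.zero_mem
    · have h : E * (F * K) - F * K * E = ad E (F * K) * K := by
        rw [ad_E, mul_assoc _ Kinv, Kinv_mul_K, mul_one]
      rw [h, ad_E_FK]
      exact mem_ILK.2 ⟨_, add_mem (IL.smul_mem casimir_mem_IL _) (IL.smul_mem K_mem_IL _), rfl⟩
    · rw [K_mul_E]
      exact sub_mem (mem_ILK.2 ⟨E, E_mem_IL, rfl⟩)
        (ILK.smul_mem _ (mem_ILK.2 ⟨E, E_mem_IL, rfl⟩))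
    · rw [casimir_mul_E, sub_self]; exact ILK.zero_mem
  | algebraMap r => rw [Algebra.commutes, sub_self]; exact ILK.zero_mem
  | add x y _ _ hx hy =>
    have : E * (x + y) - (x + y) * E = (E * x - x * E) + (E * y - y * E) := by noncomm_ring
    rw [this]; exact add_mem hx hy
  | mul x y hx' hy' hx hy =>
    have : E * (x * y) - (x * y) * E = (E * x - x * E) * y + x * (E * y - y * E) := by
      noncomm_ring
    rw [this]; exact add_mem (ILK_mul_mem hy' hx) (mul_mem_ILK hx' hy)

theorem mem_ILK_of_E_mul {y : U} (hy : y ∈ IL) (h : E * y ∈ ILK) : y ∈ ILK := by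
  have hq := q_ne_zero
  have h1 : y = q • (casimir * K * y) - q ^ 2 • (K * K * y)
      - (q⁻¹ * (q - q⁻¹) ^ 2) • (F * K * (E * y)) := by
    simp only [casimir, add_mul, smul_mul_assoc, mul_assoc, E_mul_K, E_mul_K', Kinv_mul_K,
      Kinv_mul_K', mul_smul_comm, smul_add, smul_smul, one_mul]
    match_scalars <;> field_simp <;> ring
  rw [h1]
  have hKK : K * K ∈ ILK := mem_ILK.2 ⟨K, K_mem_IL, rfl⟩
  have hCK : casimir * K ∈ ILK := mem_ILK.2 ⟨casimir, casimir_mem_IL, rfl⟩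
  exact sub_mem (sub_mem (ILK.smul_mem _ (ILK_mul_mem hy hCK)) (ILK.smul_mem _ (ILK_mul_mem hy hKK)))
    (ILK.smul_mem _ (mul_mem_ILK FK_mem_IL h))

theorem mul_pow_mul_E (w : U) (j : ℕ) : w * E * K ^ j = q⁻¹ ^ (2 * j) • (w * K ^ j * E) := by
  induction j with
  | zero => simp
  | succ j ih =>
    rw [pow_succ, ← mul_assoc, ih, smul_mul_assoc, mul_assoc _ E, E_mul_K, mul_smul_comm, smul_smul,
      ← mul_assoc, ← pow_add, mul_assoc w]
    congr 1

/-- The locally finite part coincides with `I_L`. -/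
theorem lf_eq_IL : lf = IL := by
  refine le_antisymm (fun x hx => ?_) IL_le_lf
  have hq := q_ne_zero
  classical
  have hex := exists_mul_pow_mem_IL x
  by_contra hxI
  set m := Nat.find hex with hm
  have hm0 : m ≠ 0 := by
    intro h0
    have := Nat.find_spec hex
    rw [← hm, h0, pow_zero, mul_one] at this
    exact hxI this
  set w : ℕ → U := fun N => ad (E ^ N) x with hw
  have hwE : ∀ N, w (N + 1) = ad E (w N) := fun N => by
    simp only [hw, pow_succ', map_mul, Module.End.mul_apply]
  have hy : ∀ N, w N * K ^ (m + N) ∈ IL ∧ w N * K ^ (m + N) ∉ ILK := by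
    intro N
    induction N with
    | zero =>
      have h0 : w 0 = x := by simp [hw]
      rw [h0, add_zero]
      refine ⟨Nat.find_spec hex, fun h => ?_⟩
      obtain ⟨y, hyI, hyx⟩ := mem_ILK.1 h
      obtain ⟨m', hm'⟩ := Nat.exists_eq_succ_of_ne_zero hm0
      have h2 : y = x * K ^ m' := by
        rw [hm', Nat.succ_eq_add_one, pow_succ, ← mul_assoc] at hyx
        have := congrArg (· * Kinv) hyx
        simpa only [mul_assoc, K_mul_Kinv, mul_one] using this
      rw [h2] at hyI
      exact Nat.find_min hex (m := m') (by omega) hyI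
    | succ N ih =>
      obtain ⟨h1, h2⟩ := ih
      set y := w N * K ^ (m + N) with hydef
      have e : w (N + 1) * K ^ (m + (N + 1)) = E * y - q⁻¹ ^ (2 * (m + N)) • (y * E) := by
        rw [hwE, ad_E, ← add_assoc, pow_succ', mul_assoc, Kinv_mul_K', sub_mul, mul_pow_mul_E,
          mul_assoc E]
      rw [e]
      refine ⟨sub_mem (mul_mem E_mem_IL h1) (IL.smul_mem (mul_mem h1 E_mem_IL) _), fun h => ?_⟩
      have h3 : (1 - q⁻¹ ^ (2 * (m + N))) • (E * y) ∈ ILK := by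
        have e2 : (1 - q⁻¹ ^ (2 * (m + N))) • (E * y)
            = (E * y - q⁻¹ ^ (2 * (m + N)) • (y * E))
              - q⁻¹ ^ (2 * (m + N)) • (E * y - y * E) := by module
        rw [e2]
        exact sub_mem h (ILK.smul_mem _ (commutator_mem_ILK h1))
      have h4 : (1 - q⁻¹ ^ (2 * (m + N))) ≠ 0 := by
        rw [sub_ne_zero, inv_pow]
        exact fun h => q_pow_ne_one (n := 2 * (m + N)) (by omega) (inv_eq_one.1 h.symm)
      exact h2 (mem_ILK_of_E_mul h1 ((ILK.smul_mem_iff h4).1 h3))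
  set f : ℕ → Submodule Cq U := fun N => Submodule.span Cq (w '' Set.Iio N) with hf
  have hfle : ∀ N, f N ≤ orbit x := fun N => by
    rw [hf, Submodule.span_le]
    rintro _ ⟨j, _, rfl⟩
    exact ⟨E ^ j, rfl⟩
  have hnot : ∀ N, w N ∉ f N := by
    intro N h
    refine (hy N).2 ?_
    have : ∀ s ∈ f N, s * K ^ (m + N) ∈ ILK := by
      intro s hs
      induction hs using Submodule.span_induction with
      | mem s hs =>
        obtain ⟨j, hj, rfl⟩ := hs
        obtain ⟨d, hd⟩ := Nat.exists_eq_add_of_lt (Set.mem_Iio.1 hj)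
        have e : w j * K ^ (m + N) = w j * K ^ (m + j) * K ^ d * K := by
          rw [hd, mul_assoc, mul_assoc, ← pow_succ, ← pow_add]
          congr 2
          omega
        rw [e]
        exact mem_ILK.2 ⟨_, mul_mem (hy j).1 (pow_mem K_mem_IL d), rfl⟩
      | zero => simp
      | add a b _ _ ha hb => rw [add_mul]; exact add_mem ha hb
      | smul r a _ ha => rw [smul_mul_assoc]; exact ILK.smul_mem r ha
    exact this _ h
  have : FiniteDimensional Cq (orbit x) := Module.Finite.iff_fg.2 (mem_lf.1 hx)
  have hfin : ∀ N, FiniteDimensional Cq (f N) := fun N =>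
    Submodule.finiteDimensional_of_le (hfle N)
  have hrank : ∀ N, N ≤ Module.finrank Cq (f N) := by
    intro N
    induction N with
    | zero => exact Nat.zero_le _
    | succ N ih =>
      have := hfin (N + 1)
      refine Nat.succ_le_of_lt (lt_of_le_of_lt ih (Submodule.finrank_lt_finrank_of_lt ?_))
      refine lt_of_le_of_ne (Submodule.span_mono (Set.image_mono fun j hj => ?_)) fun h => ?_
      · exact Set.mem_Iio.2 (lt_trans (Set.mem_Iio.1 hj) (Nat.lt_succ_self N))
      · exact hnot N (h ▸ Submodule.subset_span ⟨N, Set.mem_Iio.2 (Nat.lt_succ_self N), rfl⟩)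
  have h1 := hrank (Module.finrank Cq (orbit x) + 1)
  have h2 := Submodule.finrank_mono (hfle (Module.finrank Cq (orbit x) + 1))
  omega

/-- The inclusion of the locally finite part. -/
abbrev incl : lf →ₗ[Cq] U := lf.val.toLinearMap

theorem incl_injective : Function.Injective incl := Subtype.val_injective

/-- `E` as an element of `U_q(sl₂)^lf`. -/
def lfE : lf := ⟨E, IL_le_lf E_mem_IL⟩
/-- `FK` as an element of `U_q(sl₂)^lf`. -/
def lfFK : lf := ⟨F * K, IL_le_lf FK_mem_IL⟩
/-- `K` as an element of `U_q(sl₂)^lf`. -/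
def lfK : lf := ⟨K, IL_le_lf K_mem_IL⟩
/-- The quantum Casimir `Λ` as an element of `U_q(sl₂)^lf`. -/
def lfCasimir : lf := ⟨casimir, IL_le_lf casimir_mem_IL⟩

/-- `U_q(sl₂)^lf` is a left coideal. -/
theorem comul_mem {x : U} (hx : x ∈ lf) : comul x ∈ LinearMap.range (incl.lTensor U) := by
  let R : Subalgebra Cq (U ⊗[Cq] U) := (Algebra.TensorProduct.map (AlgHom.id Cq U) lf.val).range
  let T : Subalgebra Cq U := R.comap comul
  have hT : ∀ (a : U) (b : lf), a ⊗ₜ[Cq] (b : U) ∈ R :=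
    fun a b => ⟨a ⊗ₜ b, by simp⟩
  have hE : comul E = E ⊗ₜ K + 1 ⊗ₜ E := liftU_E
  have hF : comul F = F ⊗ₜ 1 + Kinv ⊗ₜ F := liftU_F
  have hK : comul K = K ⊗ₜ K := liftU_K
  have hK' : comul Kinv = Kinv ⊗ₜ Kinv := liftU_Kinv
  have h : IL ≤ T := by
    refine Algebra.adjoin_le ?_
    rintro _ (rfl | rfl | rfl | rfl)
    · change comul E ∈ R
      rw [hE]; exact add_mem (hT E lfK) (hT 1 lfE)
    · change comul (F * K) ∈ R
      rw [map_mul, hF, hK]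
      simp only [add_mul, Algebra.TensorProduct.tmul_mul_tmul, one_mul]
      exact add_mem (hT _ lfK) (hT _ lfFK)
    · change comul K ∈ R
      rw [hK]; exact hT K lfK
    · change comul casimir ∈ R
      have hq := q_ne_zero
      have e : comul casimir = Kinv ⊗ₜ casimir + (((q - q⁻¹) ^ 2 • (F * E) + q • K) ⊗ₜ K
          - q • (Kinv ⊗ₜ K)) + (q - q⁻¹) ^ 2 • (F ⊗ₜ E) + (q - q⁻¹) ^ 2 • ((Kinv * E) ⊗ₜ (F * K)) := by
        simp only [casimir, map_add, map_smul, map_mul, hE, hF, hK, hK', add_mul, mul_add,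
          Algebra.TensorProduct.tmul_mul_tmul, one_mul, mul_one, TensorProduct.add_tmul,
          TensorProduct.tmul_add, TensorProduct.tmul_smul, ← TensorProduct.smul_tmul', smul_add]
        module
      rw [e]
      exact add_mem (add_mem (add_mem (hT _ lfCasimir) (sub_mem (hT _ lfK)
        (Subalgebra.smul_mem _ (hT _ lfK) _))) (Subalgebra.smul_mem _ (hT _ lfE) _))
        (Subalgebra.smul_mem _ (hT _ lfFK) _)
  obtain ⟨y, hy⟩ := h (lf_eq_IL ▸ hx)
  exact ⟨y, hy⟩

theorem lTensor_incl_ker : LinearMap.ker (incl.lTensor U) = ⊥ :=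
  LinearMap.ker_eq_bot.2 (Module.Flat.lTensor_preserves_injective_linearMap _ incl_injective)

/-- The comultiplication as a map `U_q(sl₂)^lf → U_q(sl₂) ⊗ U_q(sl₂)^lf`. -/
def comulLf : lf →ₗ[Cq] U ⊗[Cq] lf :=
  (incl.lTensor U).leftInverse ∘ₗ comul.toLinearMap ∘ₗ incl

theorem lTensor_comulLf (x : lf) : incl.lTensor U (comulLf x) = comul (x : U) := by
  obtain ⟨y, hy⟩ := comul_mem x.2
  have : comulLf x = y := by
    change (incl.lTensor U).leftInverse (comul (x : U)) = y
    rw [← hy]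
    exact LinearMap.leftInverse_apply_of_inj lTensor_incl_ker y
  rw [this, hy]

/-- The defining property of the coaction `τ_L`: it is the algebra morphism with the following
values on the generators `E`, `FK`, `K`, `Λ` of `I_L = U_q(sl₂)^lf`. -/
structure IsTauL (t : lf →ₐ[Cq] U ⊗[Cq] lf) : Prop where
  map_E : t lfE = K ⊗ₜ lfE
  map_FK : t lfFK = Kinv ⊗ₜ lfFK - q • (F ⊗ₜ lfCasimir) + (q * (q + q⁻¹)) • (F ⊗ₜ lfK)
    - (q⁻¹ * (q - q⁻¹) ^ 2) • ((F ^ 2 * K) ⊗ₜ lfE)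
  map_K : t lfK = 1 ⊗ₜ lfK - (q⁻¹ * (q - q⁻¹) ^ 2) • ((F * K) ⊗ₜ lfE)
  map_casimir : t lfCasimir = 1 ⊗ₜ lfCasimir

/-- There is at most one such morphism. -/
theorem IsTauL.unique {t t' : lf →ₐ[Cq] U ⊗[Cq] lf} (h : IsTauL t) (h' : IsTauL t') : t = t' := by
  ext ⟨x, hx⟩
  have hx' : x ∈ Algebra.adjoin Cq ({E, F * K, K, casimir} : Set U) := by
    rw [lf_eq_IL] at hx; exact hx
  induction hx' using Algebra.adjoin_induction with
  | mem x hx' =>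
    rcases hx' with rfl | rfl | rfl | rfl
    · exact h.map_E.trans h'.map_E.symm
    · exact h.map_FK.trans h'.map_FK.symm
    · exact h.map_K.trans h'.map_K.symm
    · exact h.map_casimir.trans h'.map_casimir.symm
  | algebraMap r => exact (t.commutes r).trans (t'.commutes r).symm
  | add x y hx1 hy1 h1 h2 =>
    have e1 := h1 (lf_eq_IL ▸ hx1)
    have e2 := h2 (lf_eq_IL ▸ hy1)
    have e : (⟨x + y, hx⟩ : lf) = ⟨x, lf_eq_IL ▸ hx1⟩ + ⟨y, lf_eq_IL ▸ hy1⟩ := rfl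
    rw [e, map_add, map_add, e1, e2]
  | mul x y hx1 hy1 h1 h2 =>
    have e1 := h1 (lf_eq_IL ▸ hx1)
    have e2 := h2 (lf_eq_IL ▸ hy1)
    have e : (⟨x * y, hx⟩ : lf) = ⟨x, lf_eq_IL ▸ hx1⟩ * ⟨y, lf_eq_IL ▸ hy1⟩ := rfl
    rw [e, map_mul, map_mul, e1, e2]

/-! ### Graded modules with a locally nilpotent action of `E` -/

section modules

variable {M N : Type} [AddCommGroup M] [Module Cq M] [AddCommGroup N] [Module Cq N]

/-- The homogeneous elements of degree `d` of a `U_q(sl₂)`-module: `K` acts by `q ^ (2d)`. For the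
adjoint action this is the grading with `|E| = 1`, `|F| = -1`, `|K| = 0`. -/
def homog (ρ : U →ₐ[Cq] Module.End Cq M) (d : ℤ) : Submodule Cq M :=
  (ρ K).eigenspace (q ^ (2 * d))

theorem mem_homog {ρ : U →ₐ[Cq] Module.End Cq M} {d : ℤ} {m : M} :
    m ∈ homog ρ d ↔ ρ K m = q ^ (2 * d) • m := Module.End.mem_eigenspace_iff

/-- A `U_q(sl₂)`-module that is spanned by homogeneous elements and on which `E` acts locally
nilpotently. -/
structure IsAdmissible (ρ : U →ₐ[Cq] Module.End Cq M) : Prop where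
  iSup_homog : ⨆ d, homog ρ d = ⊤
  nilpotent : ∀ m, ∃ n : ℕ, (ρ E ^ n) m = 0

/-- The action on a tensor product, through the comultiplication. -/
def tensorAct (ρ : U →ₐ[Cq] Module.End Cq M) (σ : U →ₐ[Cq] Module.End Cq N) :
    U →ₐ[Cq] Module.End Cq (M ⊗[Cq] N) :=
  (Module.endTensorEndAlgHom (R := Cq) (S := Cq) (A := Cq) (M := M) (N := N)).comp
    ((Algebra.TensorProduct.map ρ σ).comp comul)

/-- The trivial action, through the counit. -/
def trivialAct (M : Type) [AddCommGroup M] [Module Cq M] : U →ₐ[Cq] Module.End Cq M :=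
  (Algebra.ofId Cq (Module.End Cq M)).comp counit

/-- Transport of an action along a linear isomorphism. -/
def conjAct (e : M ≃ₗ[Cq] N) (ρ : U →ₐ[Cq] Module.End Cq M) : U →ₐ[Cq] Module.End Cq N :=
  (e.conjAlgEquiv Cq).toAlgHom.comp ρ

theorem tensorAct_K (ρ : U →ₐ[Cq] Module.End Cq M) (σ : U →ₐ[Cq] Module.End Cq N) (m : M) (n : N) :
    tensorAct ρ σ K (m ⊗ₜ n) = ρ K m ⊗ₜ σ K n := by
  have hK : comul K = K ⊗ₜ K := liftU_K
  simp [tensorAct, hK, Module.endTensorEndAlgHom_apply]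

theorem tensorAct_E (ρ : U →ₐ[Cq] Module.End Cq M) (σ : U →ₐ[Cq] Module.End Cq N) (m : M) (n : N) :
    tensorAct ρ σ E (m ⊗ₜ n) = ρ E m ⊗ₜ σ K n + m ⊗ₜ σ E n := by
  have hE : comul E = E ⊗ₜ K + 1 ⊗ₜ E := liftU_E
  simp [tensorAct, hE, Module.endTensorEndAlgHom_apply]

theorem E_pow_mul_K (b : ℕ) : E ^ b * K = q⁻¹ ^ (2 * b) • (K * E ^ b) := by
  induction b with
  | zero => simp
  | succ b ih =>
    rw [pow_succ' E, mul_assoc, ih, mul_smul_comm, E_mul_K', smul_smul, ← pow_add]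
    congr 1

theorem act_E_pow_K (σ : U →ₐ[Cq] Module.End Cq N) (b : ℕ) {n : N} (h : (σ E ^ b) n = 0) :
    (σ E ^ b) (σ K n) = 0 := by
  have : (σ E ^ b) (σ K n) = q⁻¹ ^ (2 * b) • σ K ((σ E ^ b) n) := by
    rw [← map_pow, ← Module.End.mul_apply, ← map_mul, E_pow_mul_K, map_smul, map_mul]
    rfl
  rw [this, h, map_zero, smul_zero]

theorem nilpotent_add (ρ : U →ₐ[Cq] Module.End Cq M) {x y : M} (hx : ∃ n : ℕ, (ρ E ^ n) x = 0)
    (hy : ∃ n : ℕ, (ρ E ^ n) y = 0) : ∃ n : ℕ, (ρ E ^ n) (x + y) = 0 := by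
  obtain ⟨a, ha⟩ := hx
  obtain ⟨b, hb⟩ := hy
  refine ⟨a + b, ?_⟩
  rw [map_add]
  nth_rewrite 1 [add_comm a b]
  rw [pow_add, pow_add, Module.End.mul_apply, Module.End.mul_apply, ha, hb, map_zero, map_zero,
    add_zero]

theorem tensorAct_nilpotent (ρ : U →ₐ[Cq] Module.End Cq M) (σ : U →ₐ[Cq] Module.End Cq N) (c : ℕ) :
    ∀ (a b : ℕ) (m : M) (n : N), a + b = c → (ρ E ^ a) m = 0 → (σ E ^ b) n = 0 →
      (tensorAct ρ σ E ^ c) (m ⊗ₜ n) = 0 := by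
  induction c with
  | zero =>
    intro a b m n h hm _
    obtain rfl : a = 0 := by omega
    rw [pow_zero, Module.End.one_apply] at hm
    rw [hm, TensorProduct.zero_tmul, map_zero]
  | succ c ih =>
    intro a b m n h hm hn
    rw [pow_succ, Module.End.mul_apply, tensorAct_E, map_add]
    cases a with
    | zero =>
      rw [pow_zero, Module.End.one_apply] at hm
      simp [hm]
    | succ a =>
      rw [ih a b _ _ (by omega) (by rwa [pow_succ, Module.End.mul_apply] at hm)
        (act_E_pow_K σ b hn), zero_add]
      cases b with
      | zero =>
        rw [pow_zero, Module.End.one_apply] at hn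
        simp [hn]
      | succ b =>
        exact ih (a + 1) b _ _ (by omega) hm (by rwa [pow_succ, Module.End.mul_apply] at hn)

theorem IsAdmissible.tensor {ρ : U →ₐ[Cq] Module.End Cq M} {σ : U →ₐ[Cq] Module.End Cq N}
    (hρ : IsAdmissible ρ) (hσ : IsAdmissible σ) : IsAdmissible (tensorAct ρ σ) where
  iSup_homog := by
    rw [eq_top_iff]
    rintro z -
    induction z using TensorProduct.induction_on with
    | zero => exact zero_mem _
    | add x y hx hy => exact add_mem hx hy
    | tmul m n =>
      have hm : m ∈ ⨆ d, homog ρ d := hρ.iSup_homog ▸ Submodule.mem_top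
      have hn : n ∈ ⨆ d, homog σ d := hσ.iSup_homog ▸ Submodule.mem_top
      induction hm using Submodule.iSup_induction' with
      | zero => rw [TensorProduct.zero_tmul]; exact zero_mem _
      | add x y _ _ hx hy => rw [TensorProduct.add_tmul]; exact add_mem hx hy
      | mem d x hx =>
        induction hn using Submodule.iSup_induction' with
        | zero => rw [TensorProduct.tmul_zero]; exact zero_mem _
        | add x y _ _ hx hy => rw [TensorProduct.tmul_add]; exact add_mem hx hy
        | mem e y hy =>
          refine Submodule.mem_iSup_of_mem (d + e) (mem_homog.2 ?_)
          rw [tensorAct_K, mem_homog.1 hx, mem_homog.1 hy, TensorProduct.tmul_smul,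
            ← TensorProduct.smul_tmul', smul_smul, ← zpow_add₀ q_ne_zero]
          congr 2
          ring
  nilpotent z := by
    induction z using TensorProduct.induction_on with
    | zero => exact ⟨0, map_zero _⟩
    | add x y hx hy => exact nilpotent_add _ hx hy
    | tmul m n =>
      obtain ⟨a, ha⟩ := hρ.nilpotent m
      obtain ⟨b, hb⟩ := hσ.nilpotent n
      exact ⟨a + b, tensorAct_nilpotent ρ σ (a + b) a b m n rfl ha hb⟩

theorem isAdmissible_trivial (M : Type) [AddCommGroup M] [Module Cq M] :
    IsAdmissible (trivialAct M) where
  iSup_homog := by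
    rw [eq_top_iff]
    rintro m -
    have hK : counit K = 1 := liftU_K
    exact Submodule.mem_iSup_of_mem 0 (mem_homog.2 (by simp [trivialAct, hK]))
  nilpotent m := by
    have hE : counit E = 0 := liftU_E
    exact ⟨1, by simp [trivialAct, hE]⟩

theorem IsAdmissible.conj {ρ : U →ₐ[Cq] Module.End Cq M} (hρ : IsAdmissible ρ) (e : M ≃ₗ[Cq] N) :
    IsAdmissible (conjAct e ρ) := by
  have key : ∀ (h : U) (m : M), conjAct e ρ h (e m) = e (ρ h m) := by
    intro h m
    simp [conjAct]
  constructor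
  · rw [eq_top_iff]
    rintro n -
    obtain ⟨m, rfl⟩ := e.surjective n
    have hm : m ∈ ⨆ d, homog ρ d := hρ.iSup_homog ▸ Submodule.mem_top
    induction hm using Submodule.iSup_induction' with
    | zero => rw [map_zero]; exact zero_mem _
    | add x y _ _ hx hy => rw [map_add]; exact add_mem hx hy
    | mem d x hx =>
      refine Submodule.mem_iSup_of_mem d (mem_homog.2 ?_)
      rw [key, mem_homog.1 hx, map_smul]
  · intro n
    obtain ⟨m, rfl⟩ := e.surjective n
    obtain ⟨a, ha⟩ := hρ.nilpotent m
    refine ⟨a, ?_⟩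
    rw [← map_pow] at ha ⊢
    rw [key, ha, map_zero]

theorem isAdmissible_adlf : IsAdmissible adlf := by
  have hmul : ∀ x y : lf, ∀ a b : ℕ, (adlf E ^ a) x = 0 → (adlf E ^ b) y = 0 →
      (adlf E ^ (a + b)) (x * y) = 0 := by
    intro x y a b hx hy
    have h : ∀ z : lf ⊗[Cq] lf, LinearMap.mul' Cq lf (tensorAct adlf adlf E z)
        = adlf E (LinearMap.mul' Cq lf z) := by
      intro z
      induction z using TensorProduct.induction_on with
      | zero => simp
      | add x y hx hy => simp only [map_add, hx, hy]
      | tmul x y =>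
        rw [tensorAct_E, map_add]
        simp only [LinearMap.mul'_apply]
        exact Subtype.ext (ad_E_mul x y).symm
    have h' : ∀ (c : ℕ) (z : lf ⊗[Cq] lf), LinearMap.mul' Cq lf ((tensorAct adlf adlf E ^ c) z)
        = (adlf E ^ c) (LinearMap.mul' Cq lf z) := by
      intro c
      induction c with
      | zero => intro z; rfl
      | succ c ih => intro z; rw [pow_succ, pow_succ, Module.End.mul_apply, ih, h]; rfl
    have := h' (a + b) (x ⊗ₜ y)
    rw [tensorAct_nilpotent adlf adlf (a + b) a b x y rfl hx hy, map_zero] at this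
    exact this.symm
  have main : ∀ (x : U) (hx : x ∈ IL) (hx' : x ∈ lf), (⟨x, hx'⟩ : lf) ∈ ⨆ d, homog adlf d ∧
      ∃ n : ℕ, (adlf E ^ n) ⟨x, hx'⟩ = 0 := by
    intro x hx
    induction hx using Algebra.adjoin_induction with
    | mem x hx =>
      intro hx'
      have hE0 : ad E E = 0 := by rw [ad_E, sub_self, zero_mul]
      have hC0 : ad E casimir = 0 := by rw [ad_E, casimir_mul_E, sub_self, zero_mul]
      have hK0 : ad E (ad E K) = 0 := by
        have : ad E K = (1 - q ^ 2) • E := by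
          rw [ad_E, K_mul_E, sub_mul, smul_mul_assoc, mul_assoc, K_mul_Kinv, mul_one]
          module
        rw [this, map_smul, hE0, smul_zero]
      rcases hx with rfl | rfl | rfl | rfl
      · refine ⟨Submodule.mem_iSup_of_mem 1 (mem_homog.2 (Subtype.ext ?_)), 1, Subtype.ext ?_⟩
        · change ad K E = q ^ (2 * (1 : ℤ)) • E
          rw [ad_K, K_mul_E, smul_mul_assoc, mul_assoc, K_mul_Kinv, mul_one]
          norm_cast
        · exact hE0
      · refine ⟨Submodule.mem_iSup_of_mem (-1) (mem_homog.2 (Subtype.ext ?_)), 3, Subtype.ext ?_⟩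
        · change ad K (F * K) = q ^ (2 * (-1 : ℤ)) • (F * K)
          rw [ad_K, mul_assoc, mul_assoc, K_mul_Kinv, mul_one, K_mul_F]
          congr 1
          rw [inv_pow, mul_neg, mul_one, zpow_neg]
          norm_cast
        · change ad E (ad E (ad E (F * K))) = 0
          rw [ad_E_FK]
          simp only [map_add, map_smul, hC0, hK0, smul_zero, add_zero, map_zero]
      · refine ⟨Submodule.mem_iSup_of_mem 0 (mem_homog.2 (Subtype.ext ?_)), 2, Subtype.ext ?_⟩
        · change ad K K = q ^ (2 * (0 : ℤ)) • K
          rw [ad_K, mul_assoc, K_mul_Kinv, mul_one, mul_zero, zpow_zero, one_smul]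
        · exact hK0
      · refine ⟨Submodule.mem_iSup_of_mem 0 (mem_homog.2 (Subtype.ext ?_)), 1, Subtype.ext ?_⟩
        · change ad K casimir = q ^ (2 * (0 : ℤ)) • casimir
          rw [ad_K, ← casimir_mul_K, mul_assoc, K_mul_Kinv, mul_one, mul_zero, zpow_zero, one_smul]
        · exact hC0
    | algebraMap r =>
      intro hx'
      refine ⟨Submodule.mem_iSup_of_mem 0 (mem_homog.2 (Subtype.ext ?_)), 1, Subtype.ext ?_⟩
      · change ad K (algebraMap Cq U r) = q ^ (2 * (0 : ℤ)) • algebraMap Cq U r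
        rw [ad_K, ← Algebra.commutes, mul_assoc, K_mul_Kinv, mul_one, mul_zero, zpow_zero, one_smul]
      · change ad E (algebraMap Cq U r) = 0
        rw [ad_E, Algebra.commutes, sub_self, zero_mul]
    | add x y hx hy h1 h2 =>
      intro hx'
      obtain ⟨a1, a2⟩ := h1 (IL_le_lf hx)
      obtain ⟨b1, b2⟩ := h2 (IL_le_lf hy)
      exact ⟨add_mem a1 b1, nilpotent_add adlf a2 b2⟩
    | mul x y hx hy h1 h2 =>
      intro hx'
      obtain ⟨a1, a, ha⟩ := h1 (IL_le_lf hx)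
      obtain ⟨b1, b, hb⟩ := h2 (IL_le_lf hy)
      refine ⟨?_, a + b, hmul _ _ a b ha hb⟩
      have hgr : ∀ u ∈ ⨆ d, homog adlf d, ∀ v ∈ ⨆ d, homog adlf d, u * v ∈ ⨆ d, homog adlf d := by
        intro u hu v hv
        induction hu using Submodule.iSup_induction' with
        | zero => rw [zero_mul]; exact zero_mem _
        | add x y _ _ hx hy => rw [add_mul]; exact add_mem hx hy
        | mem d x hx =>
          induction hv using Submodule.iSup_induction' with
          | zero => rw [mul_zero]; exact zero_mem _
          | add x y _ _ hx hy => rw [mul_add]; exact add_mem hx hy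
          | mem e y hy =>
            refine Submodule.mem_iSup_of_mem (d + e) (mem_homog.2 ?_)
            have e1 : adlf K (x * y) = adlf K x * adlf K y := Subtype.ext (ad_K_mul x y)
            rw [e1, mem_homog.1 hx, mem_homog.1 hy, smul_mul_smul_comm, ← zpow_add₀ q_ne_zero]
            congr 2
            ring
      exact hgr _ a1 _ b1
  constructor
  · rw [eq_top_iff]
    rintro ⟨x, hx⟩ -
    exact (main x (lf_eq_IL ▸ hx) hx).1
  · rintro ⟨x, hx⟩
    exact (main x (lf_eq_IL ▸ hx) hx).2

/-! ### Linear maps given by formulas on homogeneous elements -/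

theorem isInternal_homog {ρ : U →ₐ[Cq] Module.End Cq M} (hρ : IsAdmissible ρ) :
    Function.Bijective (DirectSum.coeLinearMap (homog ρ)) := by
  refine DirectSum.isInternal_submodule_of_iSupIndep_of_iSup_eq_top ?_ hρ.iSup_homog
  refine (Module.End.eigenspaces_iSupIndep (ρ K)).comp (f := fun d : ℤ => q ^ (2 * d)) ?_
  intro a b hab
  by_contra hne
  refine q_zpow_ne_one (n := 2 * a - 2 * b) (by omega) ?_
  rw [zpow_sub₀ q_ne_zero]
  exact div_eq_one_iff_eq (zpow_ne_zero _ q_ne_zero) |>.2 hab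

/-- The linear map that is `f d` on the homogeneous elements of degree `d`. -/
def byDegree {ρ : U →ₐ[Cq] Module.End Cq M} (hρ : IsAdmissible ρ) (f : ℤ → M →ₗ[Cq] N) :
    M →ₗ[Cq] N :=
  DirectSum.toModule Cq ℤ N (fun d => f d ∘ₗ (homog ρ d).subtype) ∘ₗ
    (LinearEquiv.ofBijective (DirectSum.coeLinearMap (homog ρ))
      (isInternal_homog hρ)).symm.toLinearMap

theorem byDegree_apply {ρ : U →ₐ[Cq] Module.End Cq M} (hρ : IsAdmissible ρ) (f : ℤ → M →ₗ[Cq] N)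
    {d : ℤ} {m : M} (hm : m ∈ homog ρ d) : byDegree hρ f m = f d m := by
  have h : (LinearEquiv.ofBijective (DirectSum.coeLinearMap (homog ρ))
      (isInternal_homog hρ)).symm m = DirectSum.lof Cq ℤ (fun d => homog ρ d) d ⟨m, hm⟩ := by
    rw [LinearEquiv.symm_apply_eq]
    simp
  simp [byDegree, h]

/-- The sum of a pointwise finite sequence of linear maps. -/
def locSum (f : ℕ → M →ₗ[Cq] N) (hf : ∀ m, ∃ n, ∀ i, n ≤ i → f i m = 0) : M →ₗ[Cq] N where
  toFun m := ∑ᶠ i, f i m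
  map_add' x y := by
    have hfin : ∀ m, (Function.support fun i => f i m).Finite := fun m => by
      obtain ⟨n, hn⟩ := hf m
      refine (Set.finite_lt_nat n).subset fun i hi => ?_
      by_contra h
      exact hi (hn i (not_lt.1 h))
    simp only [map_add]
    exact finsum_add_distrib (hfin x) (hfin y)
  map_smul' r x := by
    simp only [map_smul, RingHom.id_apply]
    exact (smul_finsum r _).symm

end modules

/-! ### The quasi-`R`-matrix, the braiding and the unbraiding operators -/

/-- The quantum integer `[i]`. -/
def qInt (i : ℕ) : Cq := (q ^ i - q⁻¹ ^ i) / (q - q⁻¹)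

/-- The quantum factorial `[i]!`. -/
def qFactorial (i : ℕ) : Cq := ∏ j ∈ Finset.range i, qInt (j + 1)

/-- The first leg `u_i` of the component `Θ_i = u_i ⊗ v_i` of the quasi-`R`-matrix, where
`u_i ⊗ v_i = q ^ (i (i - 1) / 2) (q - q⁻¹) ^ i / [i]! • E ^ i ⊗ F ^ i`. -/
def u (i : ℕ) : U := (q ^ (i * (i - 1) / 2) * (q - q⁻¹) ^ i / qFactorial i) • E ^ i

/-- The second leg `v_i` of the component `Θ_i = u_i ⊗ v_i` of the quasi-`R`-matrix. -/
def v (i : ℕ) : U := F ^ i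

section modules

variable {M N : Type} [AddCommGroup M] [Module Cq M] [AddCommGroup N] [Module Cq N]

theorem act_u_eq_zero {ρ : U →ₐ[Cq] Module.End Cq M} (hρ : IsAdmissible ρ) (m : M) :
    ∃ n, ∀ i, n ≤ i → ρ (u i) m = 0 := by
  obtain ⟨n, hn⟩ := hρ.nilpotent m
  refine ⟨n, fun i hi => ?_⟩
  obtain ⟨d, rfl⟩ := Nat.exists_eq_add_of_le' hi
  rw [u, map_smul, map_pow, pow_add (ρ E), LinearMap.smul_apply, Module.End.mul_apply, hn, map_zero,
    smul_zero]

/-- The linear map `a ⊗ b ↦ ∑ i, a * c |b| i ⊗ (u_i ▷ b)` (for homogeneous `b`). -/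
def twist {ρ : U →ₐ[Cq] Module.End Cq M} (hρ : IsAdmissible ρ) (c : ℤ → ℕ → U) :
    U ⊗[Cq] M →ₗ[Cq] U ⊗[Cq] M :=
  (LinearMap.mul' Cq U).rTensor M ∘ₗ (TensorProduct.assoc Cq U U M).symm.toLinearMap ∘ₗ
    LinearMap.lTensor U (byDegree hρ fun d =>
      locSum (fun i => TensorProduct.mk Cq U M (c d i) ∘ₗ ρ (u i)) fun m => by
        obtain ⟨n, hn⟩ := act_u_eq_zero hρ m
        exact ⟨n, fun i hi => by simp [hn i hi]⟩)

/-- The defining formula of `twist`. -/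
theorem twist_tmul {ρ : U →ₐ[Cq] Module.End Cq M} (hρ : IsAdmissible ρ) (c : ℤ → ℕ → U) (a : U)
    {d : ℤ} {b : M} (hb : b ∈ homog ρ d) :
    twist hρ c (a ⊗ₜ b) = ∑ᶠ i, (a * c d i) ⊗ₜ[Cq] ρ (u i) b := by
  obtain ⟨n, hn⟩ := act_u_eq_zero hρ b
  have hs : ∀ (g : ℕ → U), (Function.support fun i => g i ⊗ₜ[Cq] ρ (u i) b) ⊆
      ((Finset.range n : Finset ℕ) : Set ℕ) := by
    intro g i hi
    by_contra h
    exact hi (by simp [hn i (by simpa using h)])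
  simp only [twist, LinearMap.comp_apply, LinearMap.lTensor_tmul, byDegree_apply hρ _ hb]
  simp only [locSum, LinearMap.coe_mk, AddHom.coe_mk, LinearMap.comp_apply, TensorProduct.mk_apply]
  rw [finsum_eq_sum_of_support_subset _ (hs _), finsum_eq_sum_of_support_subset _ (hs _)]
  simp [TensorProduct.tmul_sum]

/-- The braiding `m ⊗ n ↦ ∑ i, q ^ (2 (|m| + i) (|n| - i)) (v_i ▷ n) ⊗ (u_i ▷ m)` (for homogeneous
`m` and `n`). -/
def braiding {ρ : U →ₐ[Cq] Module.End Cq M} {σ : U →ₐ[Cq] Module.End Cq N} (hρ : IsAdmissible ρ)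
    (hσ : IsAdmissible σ) : M ⊗[Cq] N →ₗ[Cq] N ⊗[Cq] M :=
  TensorProduct.lift (byDegree hρ fun d =>
    locSum (fun i => (TensorProduct.mk Cq N M).flip.compl₁₂ (ρ (u i))
      (byDegree hσ fun e => q ^ (2 * (d + i) * (e - i)) • σ (v i))) fun m => by
        obtain ⟨n, hn⟩ := act_u_eq_zero hρ m
        exact ⟨n, fun i hi => by ext; simp [hn i hi]⟩)

/-- The defining formula of the braiding. -/
theorem braiding_tmul {ρ : U →ₐ[Cq] Module.End Cq M} {σ : U →ₐ[Cq] Module.End Cq N}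
    (hρ : IsAdmissible ρ) (hσ : IsAdmissible σ) {d e : ℤ} {m : M} {n : N} (hm : m ∈ homog ρ d)
    (hn : n ∈ homog σ e) : braiding hρ hσ (m ⊗ₜ n) =
      ∑ᶠ i : ℕ, q ^ (2 * (d + i) * (e - i)) • (σ (v i) n ⊗ₜ[Cq] ρ (u i) m) := by
  obtain ⟨k, hk⟩ := act_u_eq_zero hρ m
  have hs : (Function.support fun i : ℕ =>
      q ^ (2 * (d + i) * (e - i)) • (σ (v i) n ⊗ₜ[Cq] ρ (u i) m)) ⊆
      ((Finset.range k : Finset ℕ) : Set ℕ) := by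
    intro i hi
    by_contra h
    exact hi (by simp [hk i (by simpa using h)])
  rw [braiding, TensorProduct.lift.tmul, byDegree_apply hρ _ hm,
    finsum_eq_sum_of_support_subset _ hs]
  simp only [locSum, LinearMap.coe_mk, AddHom.coe_mk]
  rw [finsum_eq_sum_of_support_subset (s := Finset.range k), LinearMap.sum_apply]
  · refine Finset.sum_congr rfl fun i _ => ?_
    simp [byDegree_apply hσ _ hn, TensorProduct.smul_tmul']
  · intro i hi
    by_contra h
    exact hi (by ext; simp [hk i (by simpa using h)])

/-- The braided tensor product of two modules with multiplications `μ` and `ν`: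
`(g ⊗ h) · (x ⊗ y) = ∑ i, q ^ (2 (|h| + i) (|x| - i)) g (v_i ▷ x) ⊗ (u_i ▷ h) y`. -/
def braidedProduct {ρ : U →ₐ[Cq] Module.End Cq M} {σ : U →ₐ[Cq] Module.End Cq N}
    (hρ : IsAdmissible ρ) (hσ : IsAdmissible σ) (μ : M ⊗[Cq] M →ₗ[Cq] M)
    (ν : N ⊗[Cq] N →ₗ[Cq] N) : (M ⊗[Cq] N) ⊗[Cq] (M ⊗[Cq] N) →ₗ[Cq] M ⊗[Cq] N :=
  TensorProduct.map μ ν ∘ₗ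
    (TensorProduct.assoc Cq M M (N ⊗[Cq] N)).symm.toLinearMap ∘ₗ
    LinearMap.lTensor M ((TensorProduct.assoc Cq M N N).toLinearMap ∘ₗ
      LinearMap.rTensor N (braiding hσ hρ) ∘ₗ (TensorProduct.assoc Cq N M N).symm.toLinearMap) ∘ₗ
    (TensorProduct.assoc Cq M N (M ⊗[Cq] N)).toLinearMap

/-! ### Tensor powers -/

/-- The isomorphism `M ⊗ M^{⊗ n} ≃ M^{⊗ (n + 1)}`. -/
def consEquiv (M : Type) [AddCommGroup M] [Module Cq M] (n : ℕ) :
    M ⊗[Cq] (⨂[Cq]^n M) ≃ₗ[Cq] ⨂[Cq]^(n + 1) M :=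
  (TensorProduct.congr (PiTensorProduct.subsingletonEquiv (R := Cq) (s := fun _ : Unit => M) ()).symm
      (LinearEquiv.refl Cq _)) ≪≫ₗ
    PiTensorProduct.tmulEquiv Cq M ≪≫ₗ
    PiTensorProduct.reindex Cq (fun _ => M)
      ((Equiv.sumComm Unit (Fin n)).trans
        ((Equiv.optionEquivSumPUnit (Fin n)).symm.trans (finSuccEquiv n).symm))

theorem consEquiv_tmul (n : ℕ) (a : M) (x : Fin n → M) :
    consEquiv M n (a ⊗ₜ PiTensorProduct.tprod Cq x) =
      PiTensorProduct.tprod Cq (Fin.cons a x : Fin (n + 1) → M) := by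
  simp only [consEquiv, LinearEquiv.trans_apply, TensorProduct.congr_tmul, LinearEquiv.refl_apply,
    PiTensorProduct.subsingletonEquiv_symm_apply', PiTensorProduct.tmulEquiv_apply]
  erw [PiTensorProduct.reindex_tprod]
  congr 1
  funext i
  refine Fin.cases ?_ (fun j => ?_) i <;> simp

end modules

/-- The action of `U_q(sl₂)` on the `n`-th tensor power of `U_q(sl₂)^lf`. -/
def powAct : (n : ℕ) → U →ₐ[Cq] Module.End Cq (⨂[Cq]^n lf)
  | 0 => trivialAct _
  | n + 1 => conjAct (consEquiv lf n) (tensorAct adlf (powAct n))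

theorem isAdmissible_powAct : (n : ℕ) → IsAdmissible (powAct n)
  | 0 => isAdmissible_trivial _
  | n + 1 => (isAdmissible_adlf.tensor (isAdmissible_powAct n)).conj (consEquiv lf n)

/-- The multiplication of the braided tensor power of `U_q(sl₂)^lf`, defined
inductively, starting from `ℂ(q)` for `n = 0`. -/
def braidedMul : (n : ℕ) → (⨂[Cq]^n lf) ⊗[Cq] (⨂[Cq]^n lf) →ₗ[Cq] ⨂[Cq]^n lf
  | 0 => TensorProduct.lift (LinearMap.lsmul Cq (⨂[Cq]^0 lf) ∘ₗ
      (PiTensorProduct.isEmptyEquiv (Fin 0)).toLinearMap)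
  | n + 1 => (consEquiv lf n).toLinearMap ∘ₗ
      braidedProduct isAdmissible_adlf (isAdmissible_powAct n) (LinearMap.mul' Cq lf)
        (braidedMul n) ∘ₗ
      TensorProduct.map (consEquiv lf n).symm.toLinearMap (consEquiv lf n).symm.toLinearMap

/-- The one-step unbraiding map
`φ (a ⊗ b) = ∑ i, a K ^ (i + |b|) v_i ⊗ (u_i ▷ b)`. -/
def unbraidStep (n : ℕ) : lf ⊗[Cq] (⨂[Cq]^n lf) →ₗ[Cq] U ⊗[Cq] (⨂[Cq]^n lf) :=
  twist (isAdmissible_powAct n) (fun d i => Kpow (i + d) * v i) ∘ₗ incl.rTensor _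

/-- The unbraiding map `γ_n`, with `γ_{n + 1} = (id ⊗ γ_n) ∘ φ_{n + 1}`. -/
def unbraid : (n : ℕ) → (⨂[Cq]^n lf) →ₗ[Cq] ⨂[Cq]^n U
  | 0 => PiTensorProduct.map fun _ => incl
  | n + 1 => (consEquiv U n).toLinearMap ∘ₗ (unbraid n).lTensor U ∘ₗ unbraidStep n ∘ₗ
      (consEquiv lf n).symm.toLinearMap

/-! ### The braided comultiplication -/

/-- The formula `∑ i, x₍₁₎ S(K ^ (i + |x₍₂₎|) v_i) ⊗ (u_i ▷ x₍₂₎)`, with values in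
`U_q(sl₂) ⊗ U_q(sl₂)^lf`. -/
def braidedComulFormula : lf →ₗ[Cq] U ⊗[Cq] lf :=
  twist isAdmissible_adlf (fun d i => S (Kpow (i + d) * v i)) ∘ₗ comulLf

/-- The braided comultiplication of `U_q(sl₂)^lf`: the map given by `braidedComulFormula`, with
codomain restricted to `U_q(sl₂)^lf ⊗ U_q(sl₂)^lf`. -/
def braidedComul : lf →ₗ[Cq] lf ⊗[Cq] lf :=
  (incl.rTensor lf).leftInverse ∘ₗ braidedComulFormula

/-- The iterated braided comultiplication: the `0`-th one is the identity, and the `(m + 1)`-st one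
is `id ⊗` the `m`-th one, after the braided comultiplication. -/
def braidedComulIter : (m : ℕ) → lf →ₗ[Cq] ⨂[Cq]^(m + 1) lf
  | 0 => (PiTensorProduct.subsingletonEquiv (R := Cq) (s := fun _ : Fin 1 => lf) 0).symm.toLinearMap
  | m + 1 => (consEquiv lf (m + 1)).toLinearMap ∘ₗ (braidedComulIter m).lTensor lf ∘ₗ braidedComul

theorem extend_update {k n : ℕ} (i : Fin k ↪o Fin n) [DecidableEq (Fin k)] (x : Fin k → lf)
    (j : Fin k) (a : lf) : Function.extend i (Function.update x j a) 1 =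
      Function.update (Function.extend i x 1) (i j) a := by
  funext l
  by_cases hl : ∃ j', i j' = l
  · obtain ⟨j', rfl⟩ := hl
    rw [i.injective.extend_apply]
    by_cases h : j' = j
    · subst h; simp
    · rw [Function.update_of_ne h, Function.update_of_ne (fun h' => h (i.injective h')),
        i.injective.extend_apply]
  · rw [Function.extend_apply' _ _ _ hl, Function.update_of_ne (fun h => hl ⟨j, h.symm⟩),
      Function.extend_apply' _ _ _ hl]

/-- The map `x ↦ x_i` that places the `j`-th tensor factor in position `i j`, and `1` in all the
other positions. -/
def insertUnits {k n : ℕ} (i : Fin k ↪o Fin n) : (⨂[Cq]^k lf) →ₗ[Cq] ⨂[Cq]^n lf :=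
  PiTensorProduct.lift
    { toFun := fun x => PiTensorProduct.tprod Cq (Function.extend i x 1)
      map_update_add' := fun x j a b => by
        simp only [extend_update, MultilinearMap.map_update_add]
      map_update_smul' := fun x j r a => by
        simp only [extend_update, MultilinearMap.map_update_smul] }

theorem insertUnits_tprod {k n : ℕ} (i : Fin k ↪o Fin n) (x : Fin k → lf) :
    insertUnits i (PiTensorProduct.tprod Cq x) =
      PiTensorProduct.tprod Cq (Function.extend i x 1) :=
  PiTensorProduct.lift.tprod _

/-! ### The coaction `τ_L` and the Askey--Wilson algebra -/

open Classical in
/-- The coaction `τ_L`: the algebra morphism with the prescribed values on generators (if no such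
morphism existed, it would be `x ↦ 1 ⊗ x`). -/
def tauL : lf →ₐ[Cq] U ⊗[Cq] lf :=
  if h : ∃ t, IsTauL t then h.choose else Algebra.TensorProduct.includeRight

/-- The set `A`, with `1` removed if present, and shifted down by one position. -/
def shift {n : ℕ} (A : Finset (Fin (n + 1))) : Finset (Fin n) :=
  Finset.univ.filter fun j => j.succ ∈ A

/-- For a non-empty `A = {i_1 < ⋯ < i_k} ⊆ {1, …, n}`, the map
`x ↦ ((id^{⊗ (i_k - 2)} ⊗ α_{i_k - 1}) ∘ ⋯ ∘ (id ⊗ α_2) ∘ α_1) x ⊗ 1^{⊗ (n - i_k)}`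
with `α_i = Δ` if `i ∈ A` and `α_i = τ_L` otherwise. If `A = {1}` this is `x ↦ x ⊗ 1^{⊗ (n - 1)}`;
otherwise `α_1` is applied first, and then the map of the shifted set on the last `n - 1`
factors. (For the empty set the value is irrelevant.) -/
def alphaComp : (n : ℕ) → Finset (Fin n) → lf →ₗ[Cq] ⨂[Cq]^n U
  | 0, _ => 0
  | n + 1, A =>
    if shift A = ∅ then
      (consEquiv U n).toLinearMap ∘ₗ (TensorProduct.mk Cq U (⨂[Cq]^n U)).flip 1 ∘ₗ incl
    else
      (consEquiv U n).toLinearMap ∘ₗ (alphaComp n (shift A)).lTensor U ∘ₗ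
        (if 0 ∈ A then comulLf else tauL.toLinearMap)

/-- The Casimir `Λ_A` in `U_q(sl₂)^{⊗ n}`, with `Λ_∅ = q + q⁻¹`. -/
def casimirGen (n : ℕ) (A : Finset (Fin n)) : ⨂[Cq]^n U :=
  if A = ∅ then (q + q⁻¹) • 1 else alphaComp n A lfCasimir

/-- The Askey--Wilson algebra `AW(n)`, the subalgebra of `U_q(sl₂)^{⊗ n}` generated by the `Λ_A` for
non-empty `A`. -/
def AW (n : ℕ) : Subalgebra Cq (⨂[Cq]^n U) :=
  Algebra.adjoin Cq {z | ∃ A : Finset (Fin n), A.Nonempty ∧ z = casimirGen n A}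

end AskeyWilson

end

open AskeyWilson

open scoped TensorProduct

noncomputable section

set_option linter.style.longLine false

namespace AskeyWilson

/-! ### Powers of the generators -/

/-! For a graded module `M` with locally nilpotent `E`, the formula in the unbraiding map defines a
coaction Φ(m) = ∑ K^(i+|m|) v_i ⊗ u_i m with values in `U ⊗ M` (`coact`). It is the universal
R-matrix with one leg applied to `M`, and the standard properties of an R-matrix give everything:
(a) (Δ ⊗ id)Φ = (id ⊗ Φ)Φ (`coact_coassoc`), from the `q`-binomial formula for Δ(F^k); (b) Φ on a
tensor product is the product of the two coactions (`coact_tensor`), from the formula for Δ(E^k);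
(c) Φ(h₍₁₎ m)(h₍₂₎ ⊗ 1) = Δ(h)Φ(m) (`coact_E`, `coact_F`, `coact_K`), from the commutators of `E`
with F^i and of `F` with E^i; (d) Φ is natural for equivariant maps (`IsEquivariant.coact`). One
unbraiding step is φ(a ⊗ m) = (a ⊗ 1)Φ(m). On `U ⊗ M` it is inverted by the same formula with the
antipode applied to the first leg of Φ, by (a) and the antipode axioms; hence it is injective.

Multiplicativity rests on `unbraidLf_braiding`: φ turns the braiding of `m` with `x` into Φ(m)(x ⊗
1), by (a) and (h₍₁₎ ▷ x) h₍₂₎ = hx. As Φ is itself multiplicative by (b) and (d), φ of the braided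
product of g ⊗ h and x ⊗ y is gΦ(h)xΦ(y), the product of the two images.

For the adjoint action on the locally finite part, Φ is an algebra morphism with the values on
generators prescribed for τ_L. So τ_L exists and τ_L = Φ.

The braided coproduct is, by its formula, the inverse of φ applied to Δ. It lands in `lf ⊗ lf`
because φ(lf ⊗ lf) is closed under products and contains Δ of the generators
(`exists_unbraidLf_eq_comulLf`). Thus φ sends the braided coproduct to Δ (`unbraidLf_braidedComul`).
The braided coproduct is moreover equivariant (`isEquivariant_braidedComul`), and hence so are its
iterates followed by insertion of units.

The formula for C_A now follows by induction on the number of tensor factors. Let `f` be the map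
(iterated braided coproduct, then insertion of units) attached to the remaining positions. If the
first position lies in `A`, naturality moves id ⊗ f past φ and leaves φ of the braided coproduct,
which is Δ. If not, φ(1 ⊗ f(x)) = Φ(f(x)) = (id ⊗ f)Φ(x) = (id ⊗ f)τ_L(x). The remaining factors are
covered by induction. -/

theorem comul_E : comul E = E ⊗ₜ K + 1 ⊗ₜ E := liftU_E
theorem comul_F : comul F = F ⊗ₜ 1 + Kinv ⊗ₜ F := liftU_F
theorem comul_K : comul K = K ⊗ₜ K := liftU_K
theorem comul_Kinv : comul Kinv = Kinv ⊗ₜ Kinv := liftU_Kinv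

theorem counit_E : counit E = 0 := liftU_E
theorem counit_F : counit F = 0 := liftU_F
theorem counit_K : counit K = 1 := liftU_K
theorem counit_Kinv : counit Kinv = 1 := liftU_Kinv

theorem S_mul (a b : U) : S (a * b) = S b * S a := by simp [S]
theorem S_one : S 1 = 1 := by simp [S]
theorem S_E : S E = -(E * Kinv) := by
  have h : antipode E = .op (-(E * Kinv)) := liftU_E
  simp [S, h]
theorem S_F : S F = -(K * F) := by
  have h : antipode F = .op (-(K * F)) := liftU_F
  simp [S, h]
theorem S_K : S K = Kinv := by
  have h : antipode K = .op Kinv := liftU_K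
  simp [S, h]
theorem S_Kinv : S Kinv = K := by
  have h : antipode Kinv = .op K := liftU_Kinv
  simp [S, h]

theorem Kpow_zero : Kpow 0 = 1 := by simp [Kpow]
theorem Kpow_one : Kpow 1 = K := by simp [Kpow, Ku]
theorem Kpow_neg_one : Kpow (-1) = Kinv := by simp [Kpow, Ku]
theorem Kpow_add (a b : ℤ) : Kpow (a + b) = Kpow a * Kpow b := by simp [Kpow, zpow_add]

theorem Kpow_add_one (a : ℤ) : Kpow (a + 1) = K * Kpow a := by
  rw [add_comm, Kpow_add, Kpow_one]

theorem Kpow_sub_one (a : ℤ) : Kpow (a - 1) = Kinv * Kpow a := by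
  rw [sub_eq_add_neg, add_comm, Kpow_add, Kpow_neg_one]

theorem K_mul_Kpow (a : ℤ) : K * Kpow a = Kpow a * K := by
  rw [← Kpow_one, ← Kpow_add, ← Kpow_add, add_comm]

/-- If `K x = r x K` then `K ^ a x = r ^ a x K ^ a`. -/
theorem Kpow_mul_of_K_mul {x : U} {r : Cq} (hr : r ≠ 0) (h : K * x = r • (x * K)) (a : ℤ) :
    Kpow a * x = r ^ a • (x * Kpow a) := by
  have h' : Kinv * x = r⁻¹ • (x * Kinv) := by
    have := congrArg (fun z => r⁻¹ • (Kinv * z * Kinv)) h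
    simp only [mul_smul_comm, smul_mul_assoc, smul_smul, ← mul_assoc, Kinv_mul_K, one_mul] at this
    rw [inv_mul_cancel₀ hr, one_smul, mul_assoc (Kinv * x), K_mul_Kinv, mul_one] at this
    exact this.symm
  induction a using Int.induction_on with
  | zero => simp [Kpow_zero]
  | succ i ih =>
    rw [Kpow_add_one, mul_assoc, ih, mul_smul_comm, ← mul_assoc, h, smul_mul_assoc, smul_smul,
      mul_assoc, zpow_add_one₀ hr]
  | pred i ih =>
    rw [Kpow_sub_one, mul_assoc, ih, mul_smul_comm, ← mul_assoc, h', smul_mul_assoc, smul_smul,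
      mul_assoc, zpow_sub_one₀ hr]

theorem K_mul_E_pow (i : ℕ) : K * E ^ i = q ^ (2 * i) • (E ^ i * K) := by
  rw [E_pow_mul_K, smul_smul, ← mul_pow, mul_inv_cancel₀ q_ne_zero, one_pow, one_smul]

theorem K_mul_F_pow (i : ℕ) : K * F ^ i = q⁻¹ ^ (2 * i) • (F ^ i * K) := by
  induction i with
  | zero => simp
  | succ i ih =>
    rw [pow_succ, ← mul_assoc, ih, smul_mul_assoc, mul_assoc, K_mul_F, mul_smul_comm, smul_smul,
      ← mul_assoc, ← pow_add, mul_add, mul_one]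

theorem F_pow_mul_Kpow (i : ℕ) (a : ℤ) : F ^ i * Kpow a = q ^ (2 * i * a) • (Kpow a * F ^ i) := by
  rw [Kpow_mul_of_K_mul (pow_ne_zero _ (inv_ne_zero q_ne_zero)) (K_mul_F_pow i) a, smul_smul,
    ← zpow_natCast, ← zpow_mul, inv_zpow, ← zpow_neg, ← zpow_add₀ q_ne_zero]
  simp

theorem E_mul_Kpow (a : ℤ) : E * Kpow a = q ^ (-2 * a) • (Kpow a * E) := by
  rw [Kpow_mul_of_K_mul (pow_ne_zero _ q_ne_zero) K_mul_E a, smul_smul,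
    ← zpow_natCast, ← zpow_mul, ← zpow_add₀ q_ne_zero]
  simp

theorem F_mul_Kpow (a : ℤ) : F * Kpow a = q ^ (2 * a) • (Kpow a * F) := by
  simpa using F_pow_mul_Kpow 1 a

theorem comul_Kpow (a : ℤ) : comul (Kpow a) = Kpow a ⊗ₜ Kpow a := by
  induction a using Int.induction_on with
  | zero => simp [Kpow_zero, Algebra.TensorProduct.one_def]
  | succ i ih => rw [Kpow_add_one, map_mul, ih, comul_K, Algebra.TensorProduct.tmul_mul_tmul]
  | pred i ih => rw [Kpow_sub_one, map_mul, ih, comul_Kinv, Algebra.TensorProduct.tmul_mul_tmul]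

/-! ### The coefficients of the quasi-`R`-matrix -/

/-- The coefficient of `E ^ i ⊗ F ^ i` in the quasi-`R`-matrix. -/
def thetaCoeff (i : ℕ) : Cq := q ^ (i * (i - 1) / 2) * (q - q⁻¹) ^ i / qFactorial i

theorem u_eq (i : ℕ) : u i = thetaCoeff i • E ^ i := rfl

theorem thetaCoeff_zero : thetaCoeff 0 = 1 := by simp [thetaCoeff, qFactorial]

theorem q_pow_sub_ne_zero (i : ℕ) : q ^ (i + 1) - q⁻¹ ^ (i + 1) ≠ 0 := by
  have h0 := q_ne_zero
  intro h
  refine q_pow_ne_one (n := 2 * (i + 1)) (by omega) ?_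
  have h1 : q ^ (i + 1) * q⁻¹ ^ (i + 1) = 1 := by
    rw [← mul_pow, mul_inv_cancel₀ h0, one_pow]
  rw [mul_comm 2, pow_mul]
  linear_combination q ^ (i + 1) * h + h1

/-- The triangular exponent grows by `i`, and the quantum integer [i+1] supplies the factor on the
left. All later identities for the coefficients use only this recursion and the value 1 at `i = 0`.
-/
theorem thetaCoeff_succ (i : ℕ) :
    thetaCoeff (i + 1) * (q ^ (i + 1) - q⁻¹ ^ (i + 1)) = q ^ i * (q - q⁻¹) ^ 2 * thetaCoeff i := by
  have h0 := q_sub_ne_zero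
  have h1 := q_pow_sub_ne_zero
  have hf : qFactorial i ≠ 0 :=
    Finset.prod_ne_zero_iff.2 fun j _ => div_ne_zero (h1 j) h0
  have ht : (i + 1) * (i + 1 - 1) / 2 = i * (i - 1) / 2 + i := by
    rw [← Nat.triangle_succ]
  have hq : qFactorial (i + 1) = qFactorial i * qInt (i + 1) := Finset.prod_range_succ _ _
  have h2 := h1 i
  rw [thetaCoeff, thetaCoeff, ht, hq, qInt, pow_add, pow_succ (q - q⁻¹)]
  generalize q ^ (i + 1) - q⁻¹ ^ (i + 1) = s at *
  generalize q - q⁻¹ = t at *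
  field_simp

theorem thetaCoeff_one : thetaCoeff 1 = q - q⁻¹ := by
  have h := thetaCoeff_succ 0
  simp only [zero_add, pow_one, pow_zero, one_mul, thetaCoeff_zero, mul_one, pow_two] at h
  exact mul_right_cancel₀ q_sub_ne_zero h

/-- This is `thetaCoeff_succ` divided by q^(i+1). The factor 1 - q^(-2(i+1)) is the one that splits
additively in the proof of the `q`-binomial theorem. -/
theorem thetaCoeff_succ' (i : ℕ) :
    thetaCoeff (i + 1) * (1 - q⁻¹ ^ (2 * (i + 1))) = q⁻¹ * (q - q⁻¹) ^ 2 * thetaCoeff i := by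
  have h0 := q_ne_zero
  have h := thetaCoeff_succ i
  have h1 : q ^ (i + 1) * q⁻¹ ^ (i + 1) = 1 := by
    rw [← mul_pow, mul_inv_cancel₀ h0, one_pow]
  have h2 : q ^ i * q⁻¹ ^ i = 1 := by rw [← mul_pow, mul_inv_cancel₀ h0, one_pow]
  rw [mul_comm 2, pow_mul]
  linear_combination q⁻¹ ^ (i + 1) * h - thetaCoeff (i + 1) * h1
    + q⁻¹ * (q - q⁻¹) ^ 2 * thetaCoeff i * h2

/-- The `q`-binomial theorem. -/
theorem thetaCoeff_smul_add_pow {A : Type*} [Ring A] [Algebra Cq A] {x y : A}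
    (h : x * y = q ^ 2 • (y * x)) (k : ℕ) : thetaCoeff k • (x + y) ^ k =
      ∑ p ∈ Finset.HasAntidiagonal.antidiagonal k, (thetaCoeff p.1 * thetaCoeff p.2) • (x ^ p.1 * y ^ p.2) := by
  have h0 := q_ne_zero
  have hyx : ∀ i : ℕ, y * x ^ i = q⁻¹ ^ (2 * i) • (x ^ i * y) := by
    have h1 : y * x = q⁻¹ ^ 2 • (x * y) := by
      rw [h, smul_smul, ← mul_pow, inv_mul_cancel₀ h0, one_pow, one_smul]
    intro i
    induction i with
    | zero => simp
    | succ i ih =>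
      rw [pow_succ, ← mul_assoc, ih, smul_mul_assoc, mul_assoc, h1, mul_smul_comm, smul_smul,
        ← mul_assoc, ← pow_add, mul_add, mul_one]
  induction k with
  | zero => simp [thetaCoeff_zero]
  | succ k ih =>
    have hne : 1 - q⁻¹ ^ (2 * (k + 1)) ≠ 0 := by
      rw [sub_ne_zero, inv_pow]
      exact fun h => q_pow_ne_one (n := 2 * (k + 1)) (by omega) (inv_eq_one.1 h.symm)
    -- The nonzero factor 1 - q^(-2(k+1)) can be cancelled. With it, the recursion rewrites the left
    -- side as a multiple of (x + y) times the case `k`.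
    refine smul_right_injective A hne ?_
    have e1 : (1 - q⁻¹ ^ (2 * (k + 1))) • thetaCoeff (k + 1) • (x + y) ^ (k + 1) =
        (q⁻¹ * (q - q⁻¹) ^ 2) • ((x + y) * thetaCoeff k • (x + y) ^ k) := by
      rw [smul_smul, mul_comm, thetaCoeff_succ', mul_smul_comm, smul_smul, pow_succ' (x + y)]
    simp only
    rw [e1, ih, add_mul, smul_add, Finset.mul_sum, Finset.mul_sum, Finset.smul_sum, Finset.smul_sum,
      Finset.smul_sum]
    -- The splitting is 1 - q^(-2(i+j)) = (1 - q^(-2i)) + q^(-2i)(1 - q^(-2j)). The part `f` comes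
    -- from multiplying the case `k` by `x`, and `g` from multiplying it by `y`. Their boundary
    -- terms, at i = 0 and j = 0 respectively, vanish.
    set f : ℕ × ℕ → A := fun p =>
      ((1 - q⁻¹ ^ (2 * p.1)) * thetaCoeff p.1 * thetaCoeff p.2) • (x ^ p.1 * y ^ p.2) with hf
    set g : ℕ × ℕ → A := fun p =>
      (q⁻¹ ^ (2 * p.1) * (1 - q⁻¹ ^ (2 * p.2)) * thetaCoeff p.1 * thetaCoeff p.2) •
        (x ^ p.1 * y ^ p.2) with hg
    have e2 : ∑ p ∈ Finset.HasAntidiagonal.antidiagonal k, (q⁻¹ * (q - q⁻¹) ^ 2) •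
        (x * (thetaCoeff p.1 * thetaCoeff p.2) • (x ^ p.1 * y ^ p.2)) =
        ∑ p ∈ Finset.HasAntidiagonal.antidiagonal (k + 1), f p := by
      rw [Finset.Nat.sum_antidiagonal_succ]
      simp only [hf, mul_zero, pow_zero, sub_self, zero_mul, zero_smul, zero_add]
      refine Finset.sum_congr rfl fun p _ => ?_
      rw [mul_smul_comm, smul_smul, pow_succ' x, mul_assoc x]
      congr 1
      linear_combination (-thetaCoeff p.2) * thetaCoeff_succ' p.1
    have e3 : ∑ p ∈ Finset.HasAntidiagonal.antidiagonal k, (q⁻¹ * (q - q⁻¹) ^ 2) •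
        (y * (thetaCoeff p.1 * thetaCoeff p.2) • (x ^ p.1 * y ^ p.2)) =
        ∑ p ∈ Finset.HasAntidiagonal.antidiagonal (k + 1), g p := by
      rw [Finset.Nat.sum_antidiagonal_succ']
      simp only [hg, mul_zero, pow_zero, sub_self, zero_mul, zero_smul, zero_add]
      refine Finset.sum_congr rfl fun p _ => ?_
      rw [mul_smul_comm, smul_smul, ← mul_assoc y, hyx, smul_mul_assoc, smul_smul, mul_assoc (x ^ _),
        ← pow_succ']
      congr 1
      linear_combination (-thetaCoeff p.1 * q⁻¹ ^ (2 * p.1)) * thetaCoeff_succ' p.2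
    rw [e2, e3, ← Finset.sum_add_distrib]
    refine Finset.sum_congr rfl fun p hp => ?_
    rw [← Finset.HasAntidiagonal.mem_antidiagonal.1 hp]
    simp only [hf, hg]
    rw [← add_smul, smul_smul, mul_add, pow_add]
    congr 1
    ring

/-- The two summands of Δ(F) `q`-commute, so the `q`-binomial theorem applies. With the coefficient
of the quasi-R-matrix in front, the `q`-binomial coefficients become products of such coefficients.
This is the source of the coassociativity of the coaction. -/
theorem thetaCoeff_smul_comul_F_pow (k : ℕ) : thetaCoeff k • comul (F ^ k) =
    ∑ p ∈ Finset.HasAntidiagonal.antidiagonal k,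
      (thetaCoeff p.1 * thetaCoeff p.2) • ((Kpow (-p.2) * F ^ p.1) ⊗ₜ[Cq] (F ^ p.2)) := by
  have h : (Kinv ⊗ₜ[Cq] F) * (F ⊗ₜ[Cq] 1) = q ^ 2 • ((F ⊗ₜ[Cq] 1) * (Kinv ⊗ₜ[Cq] F)) := by
    simp only [Algebra.TensorProduct.tmul_mul_tmul, mul_one, one_mul, Kinv_mul_F,
      TensorProduct.smul_tmul']
  have hK : ∀ j : ℕ, Kinv ^ j = Kpow (-j) := by
    intro j
    simp [Kpow, Ku]
  -- The relation `h` requires K⁻¹ ⊗ F to be the first summand. Swapping the antidiagonal afterwards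
  -- makes `p.1` count the factors `F` in the first leg again.
  rw [map_pow, comul_F, add_comm, thetaCoeff_smul_add_pow h, ← Finset.Nat.sum_antidiagonal_swap]
  refine Finset.sum_congr rfl fun p _ => ?_
  simp [Algebra.TensorProduct.tmul_pow, hK, mul_comm]

/-- The counterpart for `E`. It is the source of the formula for the coaction on a tensor product.
-/
theorem thetaCoeff_smul_comul_E_pow (k : ℕ) : thetaCoeff k • comul (E ^ k) =
    ∑ p ∈ Finset.HasAntidiagonal.antidiagonal k,
      (thetaCoeff p.1 * thetaCoeff p.2) • ((E ^ p.1) ⊗ₜ[Cq] (Kpow p.1 * E ^ p.2)) := by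
  have h : (E ⊗ₜ[Cq] K) * (1 ⊗ₜ[Cq] E) = q ^ 2 • ((1 ⊗ₜ[Cq] E) * (E ⊗ₜ[Cq] K)) := by
    simp only [Algebra.TensorProduct.tmul_mul_tmul, mul_one, one_mul, K_mul_E,
      TensorProduct.tmul_smul]
  have hK : ∀ j : ℕ, K ^ j = Kpow j := by
    intro j
    simp [Kpow, Ku]
  rw [map_pow, comul_E, thetaCoeff_smul_add_pow h]
  refine Finset.sum_congr rfl fun p _ => ?_
  simp [Algebra.TensorProduct.tmul_pow, hK]

/-! ### Commutators of `E` with powers of `F`, and of `F` with powers of `E` -/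

theorem q_sub_sq_smul_E_mul_F_pow (i : ℕ) :
    (q - q⁻¹) ^ 2 • (E * F ^ (i + 1) - F ^ (i + 1) * E) =
      F ^ i * ((q - q⁻¹ ^ (2 * i + 1)) • K - (q ^ (2 * i + 1) - q⁻¹) • Kinv) := by
  have h0 := q_ne_zero
  have hc := q_sub_ne_zero
  induction i with
  | zero =>
    simp only [zero_add, pow_one, E_mul_F_sub, pow_zero, one_mul, mul_zero, smul_smul]
    rw [← smul_sub]
    congr 1
    field_simp
  | succ i ih =>
    -- The commutator with `E` is a derivation. Each step adds one more [E, F], whose K^{±1} is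
    -- moved past a power of `F`.
    have e : E * F ^ (i + 1 + 1) - F ^ (i + 1 + 1) * E =
        (E * F ^ (i + 1) - F ^ (i + 1) * E) * F + F ^ (i + 1) * (E * F - F * E) := by
      rw [pow_succ F (i + 1)]
      noncomm_ring
    rw [e, smul_add, ← smul_mul_assoc, ih, E_mul_F_sub, mul_assoc, sub_mul, smul_mul_assoc,
      smul_mul_assoc, K_mul_F, Kinv_mul_F, pow_succ F i]
    simp only [mul_sub, mul_smul_comm, smul_sub, smul_smul, mul_assoc]
    match_scalars <;> (try simp only [inv_pow]) <;> field_simp <;> ring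

theorem q_sub_sq_smul_E_pow_mul_F (i : ℕ) :
    (q - q⁻¹) ^ 2 • (E ^ (i + 1) * F - F * E ^ (i + 1)) =
      ((q - q⁻¹ ^ (2 * i + 1)) • K - (q ^ (2 * i + 1) - q⁻¹) • Kinv) * E ^ i := by
  have h0 := q_ne_zero
  have hc := q_sub_ne_zero
  induction i with
  | zero =>
    simp only [zero_add, pow_one, E_mul_F_sub, pow_zero, mul_one, mul_zero, smul_smul]
    rw [← smul_sub]
    congr 1
    field_simp
  | succ i ih =>
    have e : E ^ (i + 1 + 1) * F - F * E ^ (i + 1 + 1) =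
        E * (E ^ (i + 1) * F - F * E ^ (i + 1)) + (E * F - F * E) * E ^ (i + 1) := by
      rw [pow_succ' E (i + 1)]
      noncomm_ring
    rw [e, smul_add, ← mul_smul_comm, ih, E_mul_F_sub, ← mul_assoc, mul_sub, mul_smul_comm,
      mul_smul_comm, E_mul_K, E_mul_Kinv, pow_succ' E i]
    simp only [sub_mul, smul_mul_assoc, smul_sub, smul_smul, mul_assoc]
    match_scalars <;> (try simp only [inv_pow]) <;> field_simp <;> ring

/-- The recursion is multiplied by `q` so as to match the coefficient of `K` in the commutator
formulas. The next lemma does the same for K⁻¹. -/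
theorem thetaCoeff_mul_q_sub (i : ℕ) :
    thetaCoeff (i + 1) * (q - q⁻¹ ^ (2 * i + 1)) = (q - q⁻¹) ^ 2 * thetaCoeff i := by
  have h0 := q_ne_zero
  have h := thetaCoeff_succ' i
  have h1 : q * q⁻¹ = 1 := mul_inv_cancel₀ h0
  rw [show 2 * (i + 1) = 2 * i + 1 + 1 by ring, pow_succ] at h
  linear_combination q * h + (thetaCoeff (i + 1) * q⁻¹ ^ (2 * i + 1)
    + (q - q⁻¹) ^ 2 * thetaCoeff i) * h1

theorem thetaCoeff_mul_q_sub' (i : ℕ) :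
    thetaCoeff (i + 1) * (q ^ (2 * i + 1) - q⁻¹) = (q - q⁻¹) ^ 2 * thetaCoeff i * q ^ (2 * i) := by
  have h0 := q_ne_zero
  rw [← thetaCoeff_mul_q_sub, inv_pow]
  field_simp
  ring

theorem Kinv_mul_F_pow (i : ℕ) : Kinv * F ^ i = q ^ (2 * i) • (F ^ i * Kinv) := by
  rw [← Kpow_neg_one, F_pow_mul_Kpow, smul_smul, ← zpow_natCast, ← zpow_add₀ q_ne_zero]
  simp

theorem E_pow_mul_Kinv (i : ℕ) : E ^ i * Kinv = q ^ (2 * i) • (Kinv * E ^ i) := by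
  have h := congrArg (fun z => Kinv * z * Kinv) (K_mul_E_pow i)
  simp only [mul_smul_comm, smul_mul_assoc, mul_assoc, K_mul_Kinv, mul_one, Kinv_mul_K'] at h
  exact h

/-- The coefficients of the quasi-R-matrix are exactly those for which the commutator in degree i+1
reduces to degree `i` without further scalars. This makes the sum in `coact_E` telescope. -/
theorem thetaCoeff_smul_E_mul_F_pow (i : ℕ) :
    thetaCoeff (i + 1) • (E * F ^ (i + 1) - F ^ (i + 1) * E) =
      thetaCoeff i • (F ^ i * K - Kinv * F ^ i) := by
  refine smul_right_injective U (pow_ne_zero 2 q_sub_ne_zero) ?_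
  simp only
  rw [smul_comm, q_sub_sq_smul_E_mul_F_pow, Kinv_mul_F_pow, mul_sub, mul_smul_comm, mul_smul_comm,
    smul_sub, smul_smul, smul_smul, thetaCoeff_mul_q_sub, thetaCoeff_mul_q_sub', smul_sub, smul_sub]
  simp only [smul_smul, mul_assoc]

/-- The same mechanism for `F` against the leg E^i, used in `coact_F`. -/
theorem thetaCoeff_smul_E_pow_mul_F (i : ℕ) :
    thetaCoeff (i + 1) • (E ^ (i + 1) * F - F * E ^ (i + 1)) =
      thetaCoeff i • (K * E ^ i - E ^ i * Kinv) := by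
  refine smul_right_injective U (pow_ne_zero 2 q_sub_ne_zero) ?_
  simp only
  rw [smul_comm, q_sub_sq_smul_E_pow_mul_F, E_pow_mul_Kinv, sub_mul, smul_mul_assoc, smul_mul_assoc,
    smul_sub, smul_smul, smul_smul, thetaCoeff_mul_q_sub, thetaCoeff_mul_q_sub', smul_sub, smul_sub]
  simp only [smul_smul, mul_assoc]

section modules

variable {M N P M' N' : Type} [AddCommGroup M] [Module Cq M] [AddCommGroup N] [Module Cq N]
  [AddCommGroup P] [Module Cq P] [AddCommGroup M'] [Module Cq M'] [AddCommGroup N'] [Module Cq N']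
  {ρ : U →ₐ[Cq] Module.End Cq M} {σ : U →ₐ[Cq] Module.End Cq N} {τ : U →ₐ[Cq] Module.End Cq P}
  {ρ' : U →ₐ[Cq] Module.End Cq M'} {σ' : U →ₐ[Cq] Module.End Cq N'}

/-! ### Equivariant maps -/

/-- A linear map that commutes with the actions of `U_q(sl₂)`. -/
def IsEquivariant (ρ : U →ₐ[Cq] Module.End Cq M) (σ : U →ₐ[Cq] Module.End Cq N)
    (f : M →ₗ[Cq] N) : Prop :=
  ∀ h m, f (ρ h m) = σ h (f m)

/-- The elements whose action commutes with `f` form a subalgebra. It contains K⁻¹ because commuting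
with an invertible operator implies commuting with its inverse. -/
theorem IsEquivariant.of_gens {f : M →ₗ[Cq] N} (hE : ∀ m, f (ρ E m) = σ E (f m))
    (hF : ∀ m, f (ρ F m) = σ F (f m)) (hK : ∀ m, f (ρ K m) = σ K (f m)) :
    IsEquivariant ρ σ f := by
  let T : Subalgebra Cq U :=
    { carrier := {h | ∀ m, f (ρ h m) = σ h (f m)}
      mul_mem' := fun {a b} ha hb m => by
        rw [map_mul, map_mul, Module.End.mul_apply, Module.End.mul_apply, ha, hb]
      add_mem' := fun {a b} ha hb m => by
        rw [map_add, map_add, LinearMap.add_apply, LinearMap.add_apply, map_add, ha, hb]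
      algebraMap_mem' := fun r m => by
        rw [AlgHom.commutes, AlgHom.commutes, Module.algebraMap_end_apply,
          Module.algebraMap_end_apply, map_smul] }
  refine fun h => mem_of_gens T hE hF hK (fun m => ?_) h
  have h1 : σ Kinv (f (ρ K (ρ Kinv m))) = f (ρ Kinv m) := by
    rw [hK, ← Module.End.mul_apply, ← map_mul, Kinv_mul_K, map_one, Module.End.one_apply]
  rw [← h1, ← Module.End.mul_apply, ← map_mul, K_mul_Kinv, map_one, Module.End.one_apply]

theorem IsEquivariant.comp {g : N →ₗ[Cq] P} {f : M →ₗ[Cq] N} (hg : IsEquivariant σ τ g)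
    (hf : IsEquivariant ρ σ f) : IsEquivariant ρ τ (g ∘ₗ f) := fun h m => by
  rw [LinearMap.comp_apply, hf, hg, LinearMap.comp_apply]

theorem IsEquivariant.id : IsEquivariant ρ ρ LinearMap.id := fun _ _ => rfl

theorem IsEquivariant.symm {e : M ≃ₗ[Cq] N} (he : IsEquivariant ρ σ e.toLinearMap) :
    IsEquivariant σ ρ e.symm.toLinearMap := fun h n => by
  have := he h (e.symm n)
  simp only [LinearEquiv.coe_coe, LinearEquiv.apply_symm_apply] at this
  rw [LinearEquiv.coe_coe, ← this, LinearEquiv.symm_apply_apply]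

theorem isEquivariant_conj (e : M ≃ₗ[Cq] N) : IsEquivariant ρ (conjAct e ρ) e.toLinearMap :=
  fun h m => by simp [conjAct]

theorem tensorAct_F (ρ : U →ₐ[Cq] Module.End Cq M) (σ : U →ₐ[Cq] Module.End Cq N) (m : M) (n : N) :
    tensorAct ρ σ F (m ⊗ₜ n) = ρ F m ⊗ₜ n + ρ Kinv m ⊗ₜ σ F n := by
  simp [tensorAct, comul_F, Module.endTensorEndAlgHom_apply]

theorem tensorAct_apply (ρ : U →ₐ[Cq] Module.End Cq M) (σ : U →ₐ[Cq] Module.End Cq N) (h : U)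
    (z : M ⊗[Cq] N) : tensorAct ρ σ h z =
      Module.endTensorEndAlgHom (R := Cq) (S := Cq) (A := Cq) (M := M) (N := N)
        (Algebra.TensorProduct.map ρ σ (comul h)) z := rfl

theorem tensorAct_Kinv (ρ : U →ₐ[Cq] Module.End Cq M) (σ : U →ₐ[Cq] Module.End Cq N) (m : M)
    (n : N) : tensorAct ρ σ Kinv (m ⊗ₜ n) = ρ Kinv m ⊗ₜ σ Kinv n := by
  simp [tensorAct, comul_Kinv, Module.endTensorEndAlgHom_apply]

theorem IsEquivariant.of_gens_tensor {f : M ⊗[Cq] N →ₗ[Cq] P}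
    (hE : ∀ m n, f (ρ E m ⊗ₜ σ K n) + f (m ⊗ₜ σ E n) = τ E (f (m ⊗ₜ n)))
    (hF : ∀ m n, f (ρ F m ⊗ₜ n) + f (ρ Kinv m ⊗ₜ σ F n) = τ F (f (m ⊗ₜ n)))
    (hK : ∀ m n, f (ρ K m ⊗ₜ σ K n) = τ K (f (m ⊗ₜ n))) :
    IsEquivariant (tensorAct ρ σ) τ f := by
  refine .of_gens (fun z => ?_) (fun z => ?_) (fun z => ?_) <;>
  induction z using TensorProduct.induction_on with
  | zero => simp only [map_zero]
  | add x y hx hy => simp only [map_add, hx, hy]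
  | tmul m n =>
    first
    | rw [tensorAct_E, map_add, hE]
    | rw [tensorAct_F, map_add, hF]
    | rw [tensorAct_K, hK]

theorem IsEquivariant.map {f : M →ₗ[Cq] M'} {g : N →ₗ[Cq] N'} (hf : IsEquivariant ρ ρ' f)
    (hg : IsEquivariant σ σ' g) :
    IsEquivariant (tensorAct ρ σ) (tensorAct ρ' σ') (TensorProduct.map f g) := by
  refine .of_gens_tensor (fun m n => ?_) (fun m n => ?_) (fun m n => ?_) <;>
  simp only [TensorProduct.map_tmul, tensorAct_E, tensorAct_F, tensorAct_K, hf _ _, hg _ _]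

theorem IsEquivariant.lTensor {g : N →ₗ[Cq] N'} (hg : IsEquivariant σ σ' g) :
    IsEquivariant (tensorAct ρ σ) (tensorAct ρ σ') (g.lTensor M) := IsEquivariant.map .id hg

theorem IsEquivariant.rTensor {f : M →ₗ[Cq] M'} (hf : IsEquivariant ρ ρ' f) :
    IsEquivariant (tensorAct ρ σ) (tensorAct ρ' σ) (f.rTensor N) := IsEquivariant.map hf .id

/-- This is coassociativity of Δ, checked on the generators. -/
theorem isEquivariant_assoc : IsEquivariant (tensorAct (tensorAct ρ σ) τ)
    (tensorAct ρ (tensorAct σ τ)) (TensorProduct.assoc Cq M N P).toLinearMap := by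
  refine .of_gens_tensor (fun z p => ?_) (fun z p => ?_) (fun z p => ?_) <;>
  induction z using TensorProduct.induction_on with
  | zero => simp only [map_zero, TensorProduct.zero_tmul, add_zero]
  | add x y hx hy =>
    simp only [map_add, TensorProduct.add_tmul, ← hx, ← hy]
    try abel
  | tmul m n =>
    simp only [tensorAct_E, tensorAct_F, tensorAct_K, tensorAct_Kinv, TensorProduct.add_tmul,
      TensorProduct.tmul_add, map_add, LinearEquiv.coe_coe, TensorProduct.assoc_tmul]
    try abel

/-- The action of `U_q(sl₂)` on itself by left multiplication. -/
def leftAct : U →ₐ[Cq] Module.End Cq U := Algebra.lmul Cq U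

theorem leftAct_apply (h x : U) : leftAct h x = h * x := rfl

/-- `(h₍₁₎ ▷ x) h₍₂₎ y = h x y`. -/
theorem isEquivariant_mul_ad_left :
    IsEquivariant (tensorAct ad leftAct) leftAct (LinearMap.mul' Cq U) := by
  refine .of_gens_tensor (fun x y => ?_) (fun x y => ?_) (fun x y => ?_)
  · simp only [LinearMap.mul'_apply, leftAct_apply, ad_E, sub_mul, mul_assoc, Kinv_mul_K']
    abel
  · simp only [LinearMap.mul'_apply, leftAct_apply, ad_F, ad_Kinv, sub_mul, mul_assoc]
    abel
  · simp only [LinearMap.mul'_apply, leftAct_apply, ad_K, mul_assoc, Kinv_mul_K']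

theorem isEquivariant_mul_lf :
    IsEquivariant (tensorAct adlf adlf) adlf (LinearMap.mul' Cq lf) :=
  .of_gens_tensor (fun x y => Subtype.ext (ad_E_mul x y).symm)
    (fun x y => Subtype.ext (ad_F_mul x y).symm) (fun x y => Subtype.ext (ad_K_mul x y).symm)

theorem isEquivariant_incl : IsEquivariant adlf ad incl := fun _ _ => rfl

/-- If `A (f x ⊗ y)` is equivariant and `A` is equivariant and injective on the vectors `z ⊗ 1`, then
`f` is equivariant. -/
theorem IsEquivariant.of_tensor_left {f : M →ₗ[Cq] N} {A : N ⊗[Cq] U →ₗ[Cq] P}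
    (hA : IsEquivariant (tensorAct σ leftAct) τ A)
    (hf : IsEquivariant (tensorAct ρ leftAct) τ (A ∘ₗ f.rTensor U))
    (hinj : ∀ z z', A (z ⊗ₜ 1) = A (z' ⊗ₜ 1) → z = z') : IsEquivariant ρ σ f := by
  have hK : ∀ m, f (ρ K m) = σ K (f m) := by
    intro m
    -- With K⁻¹ in the second factor the action of `K` produces K K⁻¹ = 1 there, so that the
    -- injectivity on vectors z ⊗ 1 applies.
    have h1 := hf K (m ⊗ₜ Kinv)
    have h2 := hA K (f m ⊗ₜ Kinv)
    simp only [tensorAct_K, leftAct_apply, K_mul_Kinv, LinearMap.comp_apply,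
      LinearMap.rTensor_tmul] at h1 h2
    exact hinj _ _ (h1.trans h2.symm)
  have hK' : ∀ m, f (ρ Kinv m) = σ Kinv (f m) := by
    intro m
    have h1 : σ Kinv (f (ρ K (ρ Kinv m))) = f (ρ Kinv m) := by
      rw [hK, ← Module.End.mul_apply, ← map_mul, Kinv_mul_K, map_one, Module.End.one_apply]
    rw [← h1, ← Module.End.mul_apply, ← map_mul, K_mul_Kinv, map_one, Module.End.one_apply]
  refine .of_gens (fun m => ?_) (fun m => ?_) hK
  · have h1 := hf E (m ⊗ₜ Kinv)
    have h2 := hA E (f m ⊗ₜ Kinv)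
    simp only [tensorAct_E, leftAct_apply, K_mul_Kinv, LinearMap.comp_apply,
      LinearMap.rTensor_tmul, map_add] at h1 h2
    exact hinj _ _ (add_right_cancel (h1.trans h2.symm))
  · have h1 := hf F (m ⊗ₜ 1)
    have h2 := hA F (f m ⊗ₜ 1)
    simp only [tensorAct_F, leftAct_apply, LinearMap.comp_apply,
      LinearMap.rTensor_tmul, map_add, hK'] at h1 h2
    exact hinj _ _ (add_right_cancel (h1.trans h2.symm))

end modules

/-! ### The antipode -/

theorem ad_apply_one (h : U) : ad h 1 = counit h • 1 := by
  have := IsEquivariant.of_gens (ρ := trivialAct Cq) (σ := ad)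
    (f := LinearMap.toSpanSingleton Cq U 1)
    (fun r => by simp [trivialAct, counit_E, ad_E])
    (fun r => by simp [trivialAct, counit_F, ad_F, Kinv_mul_K])
    (fun r => by simp [trivialAct, counit_K, ad_K, K_mul_Kinv]) h 1
  simpa [trivialAct, Algebra.ofId_apply] using this.symm

theorem ad_apply (h x : U) : ad h x = LinearMap.mul' Cq U
    (TensorProduct.map (LinearMap.mulRight Cq x) S (comul h)) := by
  simp only [ad, AlgHom.comp_apply]
  induction comul h using TensorProduct.induction_on with
  | zero => simp
  | add x y hx hy => simp only [map_add, LinearMap.add_apply, hx, hy]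
  | tmul a b => simp [AlgHom.mulLeftRight_apply, S]

/-- The left side is h ▷ 1 by the definition of the adjoint action, and 1 spans a trivial module. -/
theorem mul_antipode_right (h : U) :
    LinearMap.mul' Cq U (S.lTensor U (comul h)) = counit h • 1 := by
  rw [← ad_apply_one, ad_apply]
  congr 2
  ext
  simp

/-- As S(a₍₁₎ x) a₍₂₎ y = S(x) S(a₍₁₎) a₍₂₎ y, the axiom is strengthened to a statement with an
arbitrary tensor `z` multiplied on the right. In this form it is closed under products in `a`, so it
suffices to check generators. -/
theorem mul_antipode_left (h : U) :
    LinearMap.mul' Cq U (S.rTensor U (comul h)) = counit h • 1 := by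
  let f : U ⊗[Cq] U →ₗ[Cq] U := LinearMap.mul' Cq U ∘ₗ S.rTensor U
  let T : Subalgebra Cq U :=
    { carrier := {a | ∀ z, f (comul a * z) = counit a • f z}
      mul_mem' := fun {a b} ha hb z => by
        rw [map_mul comul, mul_assoc, ha, hb, smul_smul, map_mul]
      add_mem' := fun {a b} ha hb z => by
        rw [map_add, add_mul, map_add, ha, hb, map_add, add_smul]
      algebraMap_mem' := fun r z => by
        rw [AlgHom.commutes, AlgHom.commutes, ← Algebra.smul_def, map_smul]; rfl }
  have key : ∀ a : U, (∀ x y, f (comul a * x ⊗ₜ y) = counit a • f (x ⊗ₜ y)) → a ∈ T := by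
    intro a ha z
    induction z using TensorProduct.induction_on with
    | zero => simp
    | add x y hx hy => simp only [mul_add, map_add, hx, hy, smul_add]
    | tmul x y => exact ha x y
  have h1 := mem_of_gens T
    (key _ fun x y => by
      simp [f, comul_E, counit_E, add_mul, S_mul, S_E, mul_assoc, Kinv_mul_K'])
    (key _ fun x y => by
      simp [f, comul_F, counit_F, add_mul, S_mul, S_F, S_Kinv, mul_assoc])
    (key _ fun x y => by simp [f, comul_K, counit_K, S_mul, S_K, mul_assoc, Kinv_mul_K'])
    (key _ fun x y => by simp [f, comul_Kinv, counit_Kinv, S_mul, S_Kinv, mul_assoc, K_mul_Kinv'])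
    h 1
  rw [mul_one] at h1
  simpa [f, Algebra.TensorProduct.one_def, S_one] using h1

section modules

variable {M N P : Type} [AddCommGroup M] [Module Cq M] [AddCommGroup N] [Module Cq N]
  [AddCommGroup P] [Module Cq P]
  {ρ : U →ₐ[Cq] Module.End Cq M} {σ : U →ₐ[Cq] Module.End Cq N}

/-! ### Homogeneous elements -/

theorem IsAdmissible.hom_ext (hρ : IsAdmissible ρ) {f g : M →ₗ[Cq] P}
    (h : ∀ d, ∀ m ∈ homog ρ d, f m = g m) : f = g := by
  refine LinearMap.ext fun m => ?_
  have hm : m ∈ ⨆ d, homog ρ d := hρ.iSup_homog ▸ Submodule.mem_top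
  induction hm using Submodule.iSup_induction' with
  | zero => simp
  | add x y _ _ hx hy => simp only [map_add, hx, hy]
  | mem d x hx => exact h d x hx

theorem act_Kpow {d : ℤ} {m : M} (hm : m ∈ homog ρ d) (a : ℤ) :
    ρ (Kpow a) m = q ^ (2 * d * a) • m := by
  have hK := mem_homog.1 hm
  have hK' : ρ Kinv m = (q ^ (2 * d))⁻¹ • m := by
    have h := congrArg (fun x => (q ^ (2 * d))⁻¹ • ρ Kinv x) hK
    simp only [map_smul, smul_smul] at h
    rw [inv_mul_cancel₀ (zpow_ne_zero _ q_ne_zero), one_smul, ← Module.End.mul_apply, ← map_mul,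
      Kinv_mul_K, map_one, Module.End.one_apply] at h
    exact h.symm
  induction a using Int.induction_on with
  | zero => simp [Kpow_zero]
  | succ i ih =>
    rw [Kpow_add_one, map_mul, Module.End.mul_apply, ih, map_smul, hK, smul_smul, mul_add, mul_one,
      zpow_add₀ q_ne_zero]
  | pred i ih =>
    rw [Kpow_sub_one, map_mul, Module.End.mul_apply, ih, map_smul, hK', smul_smul, mul_sub, mul_one,
      zpow_sub₀ q_ne_zero, div_eq_mul_inv]

theorem act_Kinv {d : ℤ} {m : M} (hm : m ∈ homog ρ d) : ρ Kinv m = q ^ (-2 * d) • m := by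
  rw [← Kpow_neg_one, act_Kpow hm]
  congr 2
  ring

theorem act_E_pow_mem_homog {d : ℤ} {m : M} (hm : m ∈ homog ρ d) (i : ℕ) :
    (ρ E ^ i) m ∈ homog ρ (d + i) := by
  rw [mem_homog, ← map_pow, ← Module.End.mul_apply, ← map_mul, K_mul_E_pow, map_smul, map_mul,
    LinearMap.smul_apply, Module.End.mul_apply, mem_homog.1 hm, map_smul, smul_smul,
    ← zpow_natCast, ← zpow_add₀ q_ne_zero]
  congr 2
  push_cast
  ring

theorem act_F_pow_mem_homog {d : ℤ} {m : M} (hm : m ∈ homog ρ d) (i : ℕ) :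
    ρ (F ^ i) m ∈ homog ρ (d - i) := by
  rw [mem_homog, ← Module.End.mul_apply, ← map_mul, K_mul_F_pow, map_smul, map_mul,
    LinearMap.smul_apply, Module.End.mul_apply, mem_homog.1 hm, map_smul, smul_smul,
    inv_pow, ← zpow_natCast, ← zpow_neg, ← zpow_add₀ q_ne_zero]
  congr 2
  push_cast
  ring

theorem tmul_mem_homog {d e : ℤ} {m : M} {n : N} (hm : m ∈ homog ρ d) (hn : n ∈ homog σ e) :
    m ⊗ₜ n ∈ homog (tensorAct ρ σ) (d + e) := by
  rw [mem_homog, tensorAct_K, mem_homog.1 hm, mem_homog.1 hn, TensorProduct.tmul_smul,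
    ← TensorProduct.smul_tmul', smul_smul, ← zpow_add₀ q_ne_zero]
  congr 2
  ring

theorem pow_apply_eq_zero_of_le {f : Module.End Cq M} {m : M} {n k : ℕ} (h : (f ^ n) m = 0)
    (hk : n ≤ k) : (f ^ k) m = 0 := by
  obtain ⟨d, rfl⟩ := Nat.exists_eq_add_of_le' hk
  rw [pow_add, Module.End.mul_apply, h, map_zero]

theorem pow_apply_pow_comm (f : Module.End Cq M) (m : M) (i j : ℕ) :
    (f ^ i) ((f ^ j) m) = (f ^ (i + j)) m := by
  rw [pow_add, Module.End.mul_apply]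

/-! ### The coaction defined by the quasi-`R`-matrix -/

/-- The linear map `b ↦ ∑ i, c |b| i ⊗ (u_i ▷ b)` (for homogeneous `b`). -/
def coactWith (hρ : IsAdmissible ρ) (c : ℤ → ℕ → U) : M →ₗ[Cq] U ⊗[Cq] M :=
  byDegree hρ fun d => locSum (fun i => TensorProduct.mk Cq U M (c d i) ∘ₗ ρ (u i)) fun m => by
    obtain ⟨n, hn⟩ := act_u_eq_zero hρ m
    exact ⟨n, fun i hi => by simp [hn i hi]⟩

/-- Any bound `k` with E^k m = 0 may be used. This freedom lets sums attached to different vectors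
be brought to the same range. -/
theorem coactWith_apply (hρ : IsAdmissible ρ) (c : ℤ → ℕ → U) {d : ℤ} {m : M}
    (hm : m ∈ homog ρ d) {k : ℕ} (hk : (ρ E ^ k) m = 0) : coactWith hρ c m =
      ∑ i ∈ Finset.range k, thetaCoeff i • (c d i ⊗ₜ[Cq] (ρ E ^ i) m) := by
  rw [coactWith, byDegree_apply hρ _ hm]
  simp only [locSum, LinearMap.coe_mk, AddHom.coe_mk, LinearMap.comp_apply, TensorProduct.mk_apply,
    u_eq, map_smul, map_pow, LinearMap.smul_apply]
  refine finsum_eq_sum_of_support_subset _ fun i hi => ?_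
  by_contra h
  refine hi ?_
  simp only
  rw [pow_apply_eq_zero_of_le hk (by simpa using h), TensorProduct.tmul_zero, smul_zero]

theorem twist_tmul_eq (hρ : IsAdmissible ρ) (c : ℤ → ℕ → U) (a : U) (b : M) :
    twist hρ c (a ⊗ₜ b) = (LinearMap.mulLeft Cq a).rTensor M (coactWith hρ c b) := by
  change (LinearMap.mul' Cq U).rTensor M ((TensorProduct.assoc Cq U U M).symm
    ((coactWith hρ c).lTensor U (a ⊗ₜ b))) = _
  rw [LinearMap.lTensor_tmul]
  induction coactWith hρ c b using TensorProduct.induction_on with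
  | zero => simp
  | add x y hx hy => simp only [TensorProduct.tmul_add, map_add, hx, hy]
  | tmul x y => simp

/-- The left coaction `b ↦ ∑ i, K ^ (i + |b|) v_i ⊗ (u_i ▷ b)`. -/
def coact (hρ : IsAdmissible ρ) : M →ₗ[Cq] U ⊗[Cq] M :=
  coactWith hρ fun d i => Kpow (i + d) * v i

theorem coact_apply (hρ : IsAdmissible ρ) {d : ℤ} {m : M} (hm : m ∈ homog ρ d) {k : ℕ}
    (hk : (ρ E ^ k) m = 0) : coact hρ m =
      ∑ i ∈ Finset.range k, thetaCoeff i • ((Kpow (i + d) * F ^ i) ⊗ₜ[Cq] (ρ E ^ i) m) :=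
  coactWith_apply hρ _ hm hk

theorem coactWith_S (hρ : IsAdmissible ρ) (m : M) :
    coactWith hρ (fun d i => S (Kpow (i + d) * v i)) m = S.rTensor M (coact hρ m) := by
  rw [← LinearMap.comp_apply]
  congr 1
  refine hρ.hom_ext fun d m hm => ?_
  obtain ⟨k, hk⟩ := hρ.nilpotent m
  rw [LinearMap.comp_apply, coactWith_apply hρ _ hm hk, coact_apply hρ hm hk, map_sum]
  simp [v]

/-- Naturality: an equivariant map preserves degrees and commutes with every E^i, and the first leg
depends only on the degree and on `i`. -/
theorem IsEquivariant.coact {hρ : IsAdmissible ρ} {hσ : IsAdmissible σ} {f : M →ₗ[Cq] N}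
    (hf : IsEquivariant ρ σ f) (m : M) :
    AskeyWilson.coact hσ (f m) = f.lTensor U (AskeyWilson.coact hρ m) := by
  rw [← LinearMap.comp_apply, ← LinearMap.comp_apply]
  congr 1
  refine hρ.hom_ext fun d m hm => ?_
  have hpow : ∀ i : ℕ, (σ E ^ i) (f m) = f ((ρ E ^ i) m) := fun i => by
    rw [← map_pow, ← map_pow, hf]
  obtain ⟨k, hk⟩ := hρ.nilpotent m
  rw [LinearMap.comp_apply, LinearMap.comp_apply, coact_apply hρ hm hk,
    coact_apply hσ (d := d) (k := k) (by rw [mem_homog, ← hf, mem_homog.1 hm, map_smul])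
      (by rw [hpow, hk, map_zero]), map_sum]
  simp [hpow]

theorem coact_of_trivial (hρ : IsAdmissible ρ) {m : M} (hE : ρ E m = 0) (hK : ρ K m = m) :
    coact hρ m = 1 ⊗ₜ m := by
  rw [coact_apply hρ (d := 0) (k := 1) (by simp [mem_homog, hK]) (by simpa using hE)]
  simp [thetaCoeff_zero, Kpow_zero]

/-! ### Comodule axioms and the coaction on tensor products -/

theorem sum_range_sum_antidiagonal {A : Type*} [AddCommMonoid A] (n : ℕ) (f : ℕ → ℕ → A)
    (hf : ∀ i j, n ≤ i + j → f i j = 0) :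
    ∑ k ∈ Finset.range n, ∑ p ∈ Finset.HasAntidiagonal.antidiagonal k, f p.1 p.2 =
      ∑ i ∈ Finset.range n, ∑ j ∈ Finset.range n, f i j := by
  rw [Finset.sum_sigma', ← Finset.sum_product']
  -- Only nonzero terms have to be matched, so the corner i + j ≥ n of the square plays no role.
  refine Finset.sum_bij_ne_zero (fun x _ _ => x.2) (fun x hx _ => ?_) ?_ ?_ ?_
  · obtain ⟨h1, h2⟩ := Finset.mem_sigma.1 hx
    have h1 := Finset.mem_range.1 h1
    have h2 := Finset.HasAntidiagonal.mem_antidiagonal.1 h2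
    rw [Finset.mem_product, Finset.mem_range, Finset.mem_range]
    omega
  · rintro ⟨a, p⟩ hx _ ⟨b, p'⟩ hy _ h
    have h1 := Finset.HasAntidiagonal.mem_antidiagonal.1 (Finset.mem_sigma.1 hx).2
    have h2 := Finset.HasAntidiagonal.mem_antidiagonal.1 (Finset.mem_sigma.1 hy).2
    simp only at h h1 h2
    subst h
    rw [← h1, ← h2]
  · rintro ⟨i, j⟩ _ hne
    refine ⟨⟨i + j, (i, j)⟩, ?_, hne, rfl⟩
    rw [Finset.mem_sigma, Finset.mem_range]
    refine ⟨?_, Finset.HasAntidiagonal.mem_antidiagonal.2 rfl⟩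
    by_contra h
    exact hne (hf i j (not_lt.1 h))
  · intros
    rfl

/-- The factor K^(p.1 + p.2 + d) absorbs K^(-p.2) in the first leg. In the second leg the exponent
is `p.2` plus the degree d + p.1 of E^(p.1) m. The summands are therefore those of the coaction
applied twice. -/
theorem thetaCoeff_smul_comul_Kpow_mul_F_pow (d : ℤ) (k : ℕ) :
    thetaCoeff k • comul (Kpow (k + d) * F ^ k) =
      ∑ p ∈ Finset.HasAntidiagonal.antidiagonal k, (thetaCoeff p.1 * thetaCoeff p.2) •
        ((Kpow (p.1 + d) * F ^ p.1) ⊗ₜ[Cq] (Kpow (p.2 + (d + p.1)) * F ^ p.2)) := by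
  rw [map_mul, ← mul_smul_comm, thetaCoeff_smul_comul_F_pow, comul_Kpow, Finset.mul_sum]
  refine Finset.sum_congr rfl fun p hp => ?_
  have hp := Finset.HasAntidiagonal.mem_antidiagonal.1 hp
  rw [mul_smul_comm, Algebra.TensorProduct.tmul_mul_tmul, ← mul_assoc, ← Kpow_add, ← hp]
  push_cast
  rw [show (p.1 + p.2 + d + -p.2 : ℤ) = p.1 + d by ring,
    show (p.1 + p.2 + d : ℤ) = p.2 + (d + p.1) by ring]

/-- One of the two hexagon identities of the R-matrix: the coproduct of F^k splits the sum over `k`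
into a sum over pairs i + j = k, with E^(i+j) m in the last leg. -/
theorem coact_coassoc (hρ : IsAdmissible ρ) (m : M) :
    TensorProduct.assoc Cq U U M (comul.toLinearMap.rTensor M (coact hρ m)) =
      (coact hρ).lTensor U (coact hρ m) := by
  have : (TensorProduct.assoc Cq U U M).toLinearMap ∘ₗ comul.toLinearMap.rTensor M ∘ₗ coact hρ =
      (coact hρ).lTensor U ∘ₗ coact hρ := by
    refine hρ.hom_ext fun d m hm => ?_
    obtain ⟨n, hn⟩ := hρ.nilpotent m
    simp only [LinearMap.comp_apply, LinearEquiv.coe_coe]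
    rw [coact_apply hρ hm hn]
    simp only [map_sum, map_smul, LinearMap.rTensor_tmul, LinearMap.lTensor_tmul,
      AlgHom.toLinearMap_apply]
    have e1 : ∀ k : ℕ, thetaCoeff k • TensorProduct.assoc Cq U U M
        (comul (Kpow (k + d) * F ^ k) ⊗ₜ (ρ E ^ k) m) =
        ∑ p ∈ Finset.HasAntidiagonal.antidiagonal k, (thetaCoeff p.1 * thetaCoeff p.2) •
          ((Kpow (p.1 + d) * F ^ p.1) ⊗ₜ[Cq] ((Kpow (p.2 + (d + p.1)) * F ^ p.2) ⊗ₜ[Cq]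
            (ρ E ^ (p.1 + p.2)) m)) := by
      intro k
      rw [← map_smul, TensorProduct.smul_tmul', thetaCoeff_smul_comul_Kpow_mul_F_pow,
        TensorProduct.sum_tmul, map_sum]
      refine Finset.sum_congr rfl fun p hp => ?_
      rw [Finset.HasAntidiagonal.mem_antidiagonal.1 hp, ← TensorProduct.smul_tmul', map_smul,
        TensorProduct.assoc_tmul]
    have e2 : ∀ i : ℕ, thetaCoeff i • ((Kpow (i + d) * F ^ i) ⊗ₜ[Cq] coact hρ ((ρ E ^ i) m)) =
        ∑ j ∈ Finset.range n, (thetaCoeff i * thetaCoeff j) •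
          ((Kpow (i + d) * F ^ i) ⊗ₜ[Cq] ((Kpow (j + (d + i)) * F ^ j) ⊗ₜ[Cq]
            (ρ E ^ (i + j)) m)) := by
      intro i
      rw [coact_apply hρ (act_E_pow_mem_homog hm i) (k := n)
        (by rw [pow_apply_pow_comm, pow_apply_eq_zero_of_le hn (by omega)]),
        TensorProduct.tmul_sum, Finset.smul_sum]
      refine Finset.sum_congr rfl fun j _ => ?_
      rw [TensorProduct.tmul_smul, smul_smul, pow_apply_pow_comm, add_comm j i]
    rw [Finset.sum_congr rfl fun k _ => e1 k, Finset.sum_congr rfl fun i _ => e2 i]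
    exact sum_range_sum_antidiagonal n (fun i j => (thetaCoeff i * thetaCoeff j) •
          ((Kpow (i + d) * F ^ i) ⊗ₜ[Cq] ((Kpow (j + (d + i)) * F ^ j) ⊗ₜ[Cq]
            (ρ E ^ (i + j)) m))) fun i j hij => by
      rw [pow_apply_eq_zero_of_le hn hij, TensorProduct.tmul_zero, TensorProduct.tmul_zero,
        smul_zero]
  exact LinearMap.congr_fun this m

theorem coact_counit (hρ : IsAdmissible ρ) (m : M) :
    TensorProduct.lid Cq M (counit.toLinearMap.rTensor M (coact hρ m)) = m := by
  have hc : ∀ a : ℤ, counit (Kpow a) = 1 := by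
    intro a
    induction a using Int.induction_on with
    | zero => rw [Kpow_zero, map_one]
    | succ i ih => rw [Kpow_add_one, map_mul, ih, counit_K, one_mul]
    | pred i ih => rw [Kpow_sub_one, map_mul, ih, counit_Kinv, one_mul]
  have : (TensorProduct.lid Cq M).toLinearMap ∘ₗ counit.toLinearMap.rTensor M ∘ₗ coact hρ =
      LinearMap.id := by
    refine hρ.hom_ext fun d m hm => ?_
    obtain ⟨n, hn⟩ := hρ.nilpotent m
    simp only [LinearMap.comp_apply, LinearEquiv.coe_coe]
    -- The bound n + 1 guarantees that the term i = 0 is present. It is the only one that survives,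
    -- as the counit kills `F`.
    rw [coact_apply hρ hm (k := n + 1) (pow_apply_eq_zero_of_le hn (by omega)),
      Finset.sum_range_succ']
    simp [counit_F, hc, thetaCoeff_zero]
  exact LinearMap.congr_fun this m

/-- The map `(a ⊗ m) ⊗ (b ⊗ n) ↦ a b ⊗ (m ⊗ n)`. -/
def mulFirst (M N : Type) [AddCommGroup M] [Module Cq M] [AddCommGroup N] [Module Cq N] :
    (U ⊗[Cq] M) ⊗[Cq] (U ⊗[Cq] N) →ₗ[Cq] U ⊗[Cq] (M ⊗[Cq] N) :=
  (LinearMap.mul' Cq U).rTensor (M ⊗[Cq] N) ∘ₗ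
    (TensorProduct.tensorTensorTensorComm Cq U M U N).toLinearMap

theorem mulFirst_tmul (a b : U) (m : M) (n : N) :
    mulFirst M N ((a ⊗ₜ m) ⊗ₜ (b ⊗ₜ n)) = (a * b) ⊗ₜ (m ⊗ₜ n) := by
  simp [mulFirst]

/-- The other hexagon identity. It rests on the coproduct of E^k, as `coact_coassoc` rests on that
of F^k. -/
theorem coact_tensor (hρ : IsAdmissible ρ) (hσ : IsAdmissible σ) (m : M) (n : N) :
    coact (hρ.tensor hσ) (m ⊗ₜ n) = mulFirst M N (coact hρ m ⊗ₜ coact hσ n) := by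
  have key : (TensorProduct.mk Cq M N).compr₂ (coact (hρ.tensor hσ)) =
      ((TensorProduct.mk Cq _ _).compl₁₂ (coact hρ) (coact hσ)).compr₂ (mulFirst M N) := by
    refine hρ.hom_ext fun d m hm => hσ.hom_ext fun e n hn => ?_
    obtain ⟨a, ha⟩ := hρ.nilpotent m
    obtain ⟨b, hb⟩ := hσ.nilpotent n
    simp only [LinearMap.compr₂_apply, TensorProduct.mk_apply, LinearMap.compl₁₂_apply]
    rw [coact_apply (hρ.tensor hσ) (tmul_mem_homog hm hn)
        (tensorAct_nilpotent ρ σ (a + b) a b m n rfl ha hb),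
      coact_apply hρ hm (pow_apply_eq_zero_of_le ha (Nat.le_add_right a b)),
      coact_apply hσ hn (pow_apply_eq_zero_of_le hb (Nat.le_add_left b a)),
      TensorProduct.sum_tmul, map_sum]
    have e1 : ∀ k : ℕ, thetaCoeff k • ((Kpow (k + (d + e)) * F ^ k) ⊗ₜ[Cq]
        (tensorAct ρ σ E ^ k) (m ⊗ₜ n)) =
        ∑ p ∈ Finset.HasAntidiagonal.antidiagonal k, (thetaCoeff p.1 * thetaCoeff p.2) •
          ((Kpow (p.1 + d) * F ^ p.1 * (Kpow (p.2 + e) * F ^ p.2)) ⊗ₜ[Cq]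
            ((ρ E ^ p.1) m ⊗ₜ[Cq] (σ E ^ p.2) n)) := by
      intro k
      rw [← TensorProduct.tmul_smul, ← map_pow, ← LinearMap.smul_apply, ← map_smul, tensorAct_apply,
        map_smul, thetaCoeff_smul_comul_E_pow]
      simp only [map_sum, map_smul, LinearMap.sum_apply, LinearMap.smul_apply,
        Algebra.TensorProduct.map_tmul, Module.endTensorEndAlgHom_apply, TensorProduct.tmul_sum]
      refine Finset.sum_congr rfl fun p hp => ?_
      have hp := Finset.HasAntidiagonal.mem_antidiagonal.1 hp
      -- The power of `q` by which K^(p.1) acts on E^(p.2) n is the same as the one in `h2`, which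
      -- comes from moving F^(p.1) past K^(p.2 + e).
      have h1 : σ (Kpow p.1 * E ^ p.2) n = q ^ (2 * p.1 * (p.2 + e)) • (σ E ^ p.2) n := by
        rw [map_mul, map_pow, Module.End.mul_apply, act_Kpow (act_E_pow_mem_homog hn p.2)]
        congr 2
        ring
      have h2 : Kpow (p.1 + d) * F ^ p.1 * (Kpow (p.2 + e) * F ^ p.2) =
          q ^ (2 * p.1 * (p.2 + e)) • (Kpow (k + (d + e)) * F ^ k) := by
        rw [← mul_assoc, mul_assoc _ (F ^ p.1), F_pow_mul_Kpow, mul_smul_comm, smul_mul_assoc,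
          ← mul_assoc, ← Kpow_add, mul_assoc (Kpow _), ← pow_add, hp, ← hp]
        congr 3
        push_cast
        ring
      rw [TensorProduct.AlgebraTensorModule.map_tmul, h1, h2, map_pow]
      simp only [TensorProduct.tmul_smul, ← TensorProduct.smul_tmul']
    have e2 : ∀ i : ℕ, mulFirst M N ((thetaCoeff i • ((Kpow (i + d) * F ^ i) ⊗ₜ[Cq] (ρ E ^ i) m)) ⊗ₜ
        ∑ j ∈ Finset.range (a + b), thetaCoeff j • ((Kpow (j + e) * F ^ j) ⊗ₜ[Cq] (σ E ^ j) n)) =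
        ∑ j ∈ Finset.range (a + b), (thetaCoeff i * thetaCoeff j) •
          ((Kpow (i + d) * F ^ i * (Kpow (j + e) * F ^ j)) ⊗ₜ[Cq]
            ((ρ E ^ i) m ⊗ₜ[Cq] (σ E ^ j) n)) := by
      intro i
      rw [TensorProduct.tmul_sum, map_sum]
      refine Finset.sum_congr rfl fun j _ => ?_
      rw [TensorProduct.tmul_smul, ← TensorProduct.smul_tmul', map_smul, map_smul, mulFirst_tmul,
        smul_smul, mul_comm]
    rw [Finset.sum_congr rfl fun k _ => e1 k, Finset.sum_congr rfl fun i _ => e2 i]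
    refine sum_range_sum_antidiagonal (a + b) (fun i j => (thetaCoeff i * thetaCoeff j) •
          ((Kpow (i + d) * F ^ i * (Kpow (j + e) * F ^ j)) ⊗ₜ[Cq]
            ((ρ E ^ i) m ⊗ₜ[Cq] (σ E ^ j) n))) fun i j hij => ?_
    -- If i + j ≥ a + b then i ≥ a or j ≥ b, so one of the two vectors vanishes.
    rcases le_or_gt a i with h | h
    · rw [pow_apply_eq_zero_of_le ha h, TensorProduct.zero_tmul, TensorProduct.tmul_zero, smul_zero]
    · rw [pow_apply_eq_zero_of_le hb (by omega), TensorProduct.tmul_zero, TensorProduct.tmul_zero,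
        smul_zero]
  exact LinearMap.congr_fun₂ key m n

/-! ### The braiding -/

/-- On F^i n, of degree e - i, the factor K^(i+d) acts by q^(2(d+i)(e-i)), the scalar in the
definition of the braiding. So the braiding is the coaction followed by letting the first leg act.
-/
theorem braiding_eq (hρ : IsAdmissible ρ) (hσ : IsAdmissible σ) (m : M) (n : N) :
    braiding hρ hσ (m ⊗ₜ n) = (σ.toLinearMap.flip n).rTensor M (coact hρ m) := by
  have key : (TensorProduct.mk Cq M N).compr₂ (braiding hρ hσ) =
      ((LinearMap.rTensorHom M).flip ∘ₗ coact hρ).compl₂ σ.toLinearMap.flip := by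
    refine hρ.hom_ext fun d m hm => hσ.hom_ext fun e n hn => ?_
    obtain ⟨k, hk⟩ := hρ.nilpotent m
    simp only [LinearMap.compr₂_apply, TensorProduct.mk_apply, LinearMap.compl₂_apply,
      LinearMap.comp_apply, LinearMap.flip_apply, LinearMap.coe_rTensorHom]
    rw [braiding_tmul hρ hσ hm hn, coact_apply hρ hm hk, map_sum,
      finsum_eq_sum_of_support_subset (s := Finset.range k)]
    · refine Finset.sum_congr rfl fun i _ => ?_
      rw [map_smul, LinearMap.rTensor_tmul, LinearMap.flip_apply, AlgHom.toLinearMap_apply, map_mul,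
        Module.End.mul_apply, act_Kpow (act_F_pow_mem_homog hn i), u_eq, map_smul,
        LinearMap.smul_apply, map_pow, TensorProduct.tmul_smul, ← TensorProduct.smul_tmul',
        smul_comm, v]
      congr 3
      ring
    · intro i hi
      by_contra h
      refine hi ?_
      simp only
      rw [u_eq, map_smul, LinearMap.smul_apply, map_pow, pow_apply_eq_zero_of_le hk (by simpa using h),
        smul_zero, TensorProduct.tmul_zero, smul_zero]
  exact LinearMap.congr_fun₂ key m n

/-- The intertwining property `Φ(E m) (K ⊗ 1) + Φ(m) (E ⊗ 1) = Δ(E) Φ(m)` of the coaction `Φ`. -/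
theorem coact_E (hρ : IsAdmissible ρ) (m : M) :
    (LinearMap.mulRight Cq K).rTensor M (coact hρ (ρ E m)) +
      (LinearMap.mulRight Cq E).rTensor M (coact hρ m) = tensorAct leftAct ρ E (coact hρ m) := by
  have key : (LinearMap.mulRight Cq K).rTensor M ∘ₗ coact hρ ∘ₗ ρ E +
      (LinearMap.mulRight Cq E).rTensor M ∘ₗ coact hρ = tensorAct leftAct ρ E ∘ₗ coact hρ := by
    refine hρ.hom_ext fun d m hm => ?_
    obtain ⟨k, hk⟩ := hρ.nilpotent m
    have hE : ρ E m ∈ homog ρ (d + 1) := by simpa using act_E_pow_mem_homog hm 1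
    have hE' : ∀ i : ℕ, (ρ E ^ i) (ρ E m) = (ρ E ^ (i + 1)) m := fun i => by
      rw [pow_succ, Module.End.mul_apply]
    have hE'' : ∀ i : ℕ, ρ E ((ρ E ^ i) m) = (ρ E ^ (i + 1)) m := fun i => by
      rw [pow_succ', Module.End.mul_apply]
    simp only [LinearMap.add_apply, LinearMap.comp_apply]
    rw [coact_apply hρ hE (k := k) (by rw [hE', pow_apply_eq_zero_of_le hk (by omega)]),
      coact_apply hρ hm (k := k + 1) (pow_apply_eq_zero_of_le hk (by omega))]
    simp only [map_sum, map_smul, LinearMap.rTensor_tmul, LinearMap.mulRight_apply, tensorAct_E,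
      leftAct_apply, smul_add, Finset.sum_add_distrib, hE', hE'']
    -- The scalar from `K` acting on E^i m cancels the one from moving `E` past K^(i+d). What
    -- remains is F^i E, matching Φ(m)(E ⊗ 1), and a commutator.
    have e1 : ∀ i : ℕ, thetaCoeff i • ((E * (Kpow (i + d) * F ^ i)) ⊗ₜ[Cq] ρ K ((ρ E ^ i) m)) =
        thetaCoeff i • ((Kpow (i + d) * F ^ i * E) ⊗ₜ[Cq] (ρ E ^ i) m) +
        (Kpow (i + d) * (thetaCoeff i • (E * F ^ i - F ^ i * E))) ⊗ₜ[Cq] (ρ E ^ i) m := by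
      intro i
      rw [mem_homog.1 (act_E_pow_mem_homog hm i), ← mul_assoc, E_mul_Kpow, smul_mul_assoc,
        TensorProduct.tmul_smul, ← TensorProduct.smul_tmul', smul_smul (q ^ _), ← zpow_add₀ q_ne_zero,
        mul_smul_comm, ← TensorProduct.smul_tmul', ← smul_add, ← TensorProduct.add_tmul]
      rw [show (2 * (d + i) + -2 * (i + d) : ℤ) = 0 by ring, zpow_zero, one_smul]
      congr 2
      noncomm_ring
    rw [Finset.sum_congr rfl fun i _ => e1 i, Finset.sum_add_distrib, add_comm, add_assoc]
    congr 1
    -- The commutator vanishes for i = 0, so that sum is shifted by one. Its terms with K⁻¹F^i then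
    -- cancel the terms from 1 ⊗ E, and those with F^i K form Φ(E m)(K ⊗ 1).
    rw [Finset.sum_range_succ', Finset.sum_range_succ,
      pow_apply_eq_zero_of_le (k := k + 1) hk (by omega),
      TensorProduct.tmul_zero, smul_zero, add_zero]
    simp only [pow_zero, mul_one, one_mul, sub_self, smul_zero, mul_zero, TensorProduct.zero_tmul,
      add_zero]
    rw [← Finset.sum_add_distrib]
    refine Finset.sum_congr rfl fun i _ => ?_
    rw [thetaCoeff_smul_E_mul_F_pow, mul_smul_comm, ← TensorProduct.smul_tmul', ← smul_add,
      ← TensorProduct.add_tmul]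
    congr 2
    have e2 : (Kpow ((i + 1 : ℕ) + d) * (Kinv * F ^ i)) = Kpow (i + d) * F ^ i := by
      rw [← mul_assoc, ← Kpow_neg_one, ← Kpow_add]
      congr 2
      push_cast
      ring
    rw [mul_sub, e2, sub_add_cancel, mul_assoc]
    congr 2
    push_cast
    ring
  exact LinearMap.congr_fun key m

/-- The intertwining property `Φ(F m) + Φ(K⁻¹ m) (F ⊗ 1) = Δ(F) Φ(m)` of the coaction `Φ`. -/
theorem coact_F (hρ : IsAdmissible ρ) (m : M) :
    coact hρ (ρ F m) + (LinearMap.mulRight Cq F).rTensor M (coact hρ (ρ Kinv m)) =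
      tensorAct leftAct ρ F (coact hρ m) := by
  have key : coact hρ ∘ₗ ρ F + (LinearMap.mulRight Cq F).rTensor M ∘ₗ coact hρ ∘ₗ ρ Kinv =
      tensorAct leftAct ρ F ∘ₗ coact hρ := by
    refine hρ.hom_ext fun d m hm => ?_
    obtain ⟨a, ha⟩ := hρ.nilpotent m
    obtain ⟨b, hb⟩ := hρ.nilpotent (ρ F m)
    set k := max a b
    have hk : (ρ E ^ k) m = 0 := pow_apply_eq_zero_of_le ha (le_max_left _ _)
    have hF : ρ F m ∈ homog ρ (d - 1) := by simpa using act_F_pow_mem_homog hm 1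
    simp only [LinearMap.add_apply, LinearMap.comp_apply]
    rw [act_Kinv hm, map_smul, coact_apply hρ hF (k := k + 1)
      (pow_apply_eq_zero_of_le hb (le_trans (le_max_right a b) (Nat.le_succ _)))]
    -- Two truncations of the same sum are kept: length `k` for the terms that will face the shifted
    -- commutator sum, and length k + 1 for those compared with it before the shift.
    have h1 : coact hρ m =
        ∑ i ∈ Finset.range k, thetaCoeff i • ((Kpow (i + d) * F ^ i) ⊗ₜ[Cq] (ρ E ^ i) m) :=
      coact_apply hρ hm hk
    have h2 : coact hρ m =
        ∑ i ∈ Finset.range (k + 1), thetaCoeff i • ((Kpow (i + d) * F ^ i) ⊗ₜ[Cq] (ρ E ^ i) m) :=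
      coact_apply hρ hm (pow_apply_eq_zero_of_le hk (by omega))
    have h3 : tensorAct leftAct ρ F (coact hρ m) =
        ∑ i ∈ Finset.range k, thetaCoeff i • ((F * (Kpow (i + d) * F ^ i)) ⊗ₜ[Cq] (ρ E ^ i) m) +
        ∑ i ∈ Finset.range (k + 1),
          thetaCoeff i • ((Kinv * (Kpow (i + d) * F ^ i)) ⊗ₜ[Cq] ρ F ((ρ E ^ i) m)) := by
      have e : ∀ z : U ⊗[Cq] M, tensorAct leftAct ρ F z = (leftAct F).rTensor M z +
          TensorProduct.map (leftAct Kinv) (ρ F) z := by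
        intro z
        induction z using TensorProduct.induction_on with
        | zero => simp
        | add x y hx hy => simp only [map_add, hx, hy]; abel
        | tmul x y => rw [tensorAct_F, LinearMap.rTensor_tmul, TensorProduct.map_tmul]
      rw [e]
      nth_rewrite 1 [h1]
      rw [h2]
      simp only [map_sum, map_smul, LinearMap.rTensor_tmul, TensorProduct.map_tmul, leftAct_apply]
    rw [h3, h1]
    simp only [map_sum, map_smul, LinearMap.rTensor_tmul, LinearMap.mulRight_apply]
    -- Since K^(i+d-1) = K⁻¹K^(i+d), moving `F` to the left of E^i gives the terms from K⁻¹ ⊗ F,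
    -- plus a commutator which again vanishes for i = 0.
    have e1 : ∀ i : ℕ, thetaCoeff i • ((Kpow (i + (d - 1)) * F ^ i) ⊗ₜ[Cq] (ρ E ^ i) (ρ F m)) =
        thetaCoeff i • ((Kinv * (Kpow (i + d) * F ^ i)) ⊗ₜ[Cq] ρ F ((ρ E ^ i) m)) +
        (Kpow (i + (d - 1)) * F ^ i) ⊗ₜ[Cq]
          ρ (thetaCoeff i • (E ^ i * F - F * E ^ i)) m := by
      intro i
      rw [map_smul, LinearMap.smul_apply, TensorProduct.tmul_smul, ← smul_add, ← mul_assoc,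
        ← Kpow_sub_one, map_sub, map_mul, map_mul, map_pow, LinearMap.sub_apply,
        Module.End.mul_apply, Module.End.mul_apply, add_sub_assoc, ← TensorProduct.tmul_add,
        add_sub_cancel]
    rw [Finset.sum_congr rfl fun i _ => e1 i, Finset.sum_add_distrib, add_comm, add_comm (∑ i ∈ _, _),
      ← add_assoc]
    congr 1
    rw [Finset.sum_range_succ']
    simp only [pow_zero, mul_one, one_mul, sub_self, smul_zero, map_zero, LinearMap.zero_apply,
      TensorProduct.tmul_zero, add_zero]
    rw [Finset.smul_sum, ← Finset.sum_add_distrib]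
    refine Finset.sum_congr rfl fun i _ => ?_
    have hi := act_E_pow_mem_homog hm i
    rw [thetaCoeff_smul_E_pow_mul_F, map_smul, LinearMap.smul_apply, map_sub, map_mul, map_mul,
      map_pow, LinearMap.sub_apply, Module.End.mul_apply, Module.End.mul_apply, mem_homog.1 hi,
      act_Kinv hm, map_smul, ← sub_smul, TensorProduct.tmul_smul, TensorProduct.tmul_smul,
      ← mul_assoc F, F_mul_Kpow, smul_mul_assoc, ← TensorProduct.smul_tmul', mul_assoc (Kpow _),
      mul_assoc (Kpow _), ← pow_succ, ← pow_succ',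
      show (((i + 1 : ℕ) : ℤ) + (d - 1)) = i + d by push_cast; ring, add_comm (i : ℤ) d]
    module
  exact LinearMap.congr_fun key m

/-- The intertwining property `Φ(K m) (K ⊗ 1) = Δ(K) Φ(m)` of the coaction `Φ`. -/
theorem coact_K (hρ : IsAdmissible ρ) (m : M) :
    (LinearMap.mulRight Cq K).rTensor M (coact hρ (ρ K m)) = tensorAct leftAct ρ K (coact hρ m) := by
  have key : (LinearMap.mulRight Cq K).rTensor M ∘ₗ coact hρ ∘ₗ ρ K =
      tensorAct leftAct ρ K ∘ₗ coact hρ := by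
    refine hρ.hom_ext fun d m hm => ?_
    obtain ⟨k, hk⟩ := hρ.nilpotent m
    simp only [LinearMap.comp_apply]
    rw [mem_homog.1 hm, map_smul, coact_apply hρ hm hk]
    simp only [map_sum, map_smul, LinearMap.rTensor_tmul, LinearMap.mulRight_apply, tensorAct_K,
      leftAct_apply, Finset.smul_sum]
    refine Finset.sum_congr rfl fun i _ => ?_
    rw [mem_homog.1 (act_E_pow_mem_homog hm i), smul_comm, ← mul_assoc, K_mul_Kpow,
      mul_assoc (Kpow _) K, K_mul_F_pow, mul_smul_comm, TensorProduct.tmul_smul,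
      ← TensorProduct.smul_tmul', smul_smul (q ^ (2 * (d + (i : ℤ)))), inv_pow, ← zpow_natCast,
      ← zpow_neg, ← zpow_add₀ q_ne_zero, mul_assoc]
    congr 3
    push_cast
    ring
  exact LinearMap.congr_fun key m

/-- The map `m ⊗ n ↦ ∑ i, (K ^ (i + |m|) v_i) n ⊗ u_i m`, for any second module. -/
def halfBraiding (hρ : IsAdmissible ρ) (σ : U →ₐ[Cq] Module.End Cq N) :
    M ⊗[Cq] N →ₗ[Cq] N ⊗[Cq] M :=
  TensorProduct.lift (((LinearMap.rTensorHom M).flip ∘ₗ coact hρ).compl₂ σ.toLinearMap.flip)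

theorem halfBraiding_tmul (hρ : IsAdmissible ρ) (m : M) (n : N) :
    halfBraiding hρ σ (m ⊗ₜ n) = (σ.toLinearMap.flip n).rTensor M (coact hρ m) := by
  simp [halfBraiding]

theorem halfBraiding_eq_braiding (hρ : IsAdmissible ρ) (hσ : IsAdmissible σ) :
    halfBraiding hρ σ = braiding hρ hσ := by
  refine TensorProduct.ext' fun m n => ?_
  rw [halfBraiding_tmul, braiding_eq]

/-- The intertwining property of Φ is applied to a vector `n` through the orbit map, which is
equivariant for left multiplication. Replacing `n` by `x n` becomes right multiplication by `x` on
the first leg. The second module need not be admissible, so `U` with left multiplication is allowed.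
-/
theorem isEquivariant_halfBraiding (hρ : IsAdmissible ρ) :
    IsEquivariant (tensorAct ρ σ) (tensorAct σ ρ) (halfBraiding hρ σ) := by
  have h1 : ∀ n : N, IsEquivariant leftAct σ (σ.toLinearMap.flip n) := fun n h x => by
    simp [leftAct_apply]
  have h2 : ∀ (n : N) (z : U ⊗[Cq] M) (x : U), (σ.toLinearMap.flip (σ x n)).rTensor M z =
      (σ.toLinearMap.flip n).rTensor M ((LinearMap.mulRight Cq x).rTensor M z) := by
    intro n z x
    rw [← LinearMap.rTensor_comp_apply]
    congr 2
    ext y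
    simp
  refine .of_gens_tensor (fun m n => ?_) (fun m n => ?_) (fun m n => ?_)
  · rw [halfBraiding_tmul, halfBraiding_tmul, halfBraiding_tmul, h2, h2, ← map_add, coact_E,
      (h1 n).rTensor]
  · rw [halfBraiding_tmul, halfBraiding_tmul, halfBraiding_tmul, h2, ← map_add, coact_F,
      (h1 n).rTensor]
  · rw [halfBraiding_tmul, halfBraiding_tmul, h2, coact_K, (h1 n).rTensor]

theorem isEquivariant_braiding (hρ : IsAdmissible ρ) (hσ : IsAdmissible σ) :
    IsEquivariant (tensorAct ρ σ) (tensorAct σ ρ) (braiding hρ hσ) :=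
  halfBraiding_eq_braiding hρ hσ ▸ isEquivariant_halfBraiding hρ

end modules

section modules

variable {M N P : Type} [AddCommGroup M] [Module Cq M] [AddCommGroup N] [Module Cq N]
  [AddCommGroup P] [Module Cq P]
  {ρ : U →ₐ[Cq] Module.End Cq M} {σ : U →ₐ[Cq] Module.End Cq N}

/-! ### Invertibility of the twist -/

/-- The map `a ⊗ (b ⊗ m) ↦ f a * g b ⊗ m`. -/
def contract (M : Type) [AddCommGroup M] [Module Cq M] (f g : U →ₗ[Cq] U) :
    U ⊗[Cq] (U ⊗[Cq] M) →ₗ[Cq] U ⊗[Cq] M :=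
  (LinearMap.mul' Cq U).rTensor M ∘ₗ (TensorProduct.assoc Cq U U M).symm.toLinearMap ∘ₗ
    TensorProduct.map f (g.rTensor M)

theorem contract_tmul (f g : U →ₗ[Cq] U) (a b : U) (m : M) :
    contract M f g (a ⊗ₜ (b ⊗ₜ m)) = (f a * g b) ⊗ₜ m := by
  simp [contract]

/-- Coassociativity replaces two successive coactions by one, with the convolution product of `f`
and `g` on the first leg. -/
theorem contract_coact (hρ : IsAdmissible ρ) (f g : U →ₗ[Cq] U) (m : M) :
    contract M f g ((coact hρ).lTensor U (coact hρ m)) =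
      (LinearMap.mul' Cq U ∘ₗ TensorProduct.map f g ∘ₗ comul.toLinearMap).rTensor M
        (coact hρ m) := by
  rw [← coact_coassoc]
  induction coact hρ m using TensorProduct.induction_on with
  | zero => simp
  | add x y hx hy => simp only [map_add, hx, hy]
  | tmul a m =>
    simp only [LinearMap.rTensor_tmul, LinearMap.comp_apply, AlgHom.toLinearMap_apply]
    induction comul a using TensorProduct.induction_on with
    | zero => simp
    | add x y hx hy => simp only [map_add, TensorProduct.add_tmul, hx, hy]
    | tmul x y => simp [contract_tmul]

/-- The map `a ⊗ b ↦ ∑ i, a K ^ (i + |b|) v_i ⊗ (u_i ▷ b)`. -/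
abbrev unbraidTwist (hρ : IsAdmissible ρ) : U ⊗[Cq] M →ₗ[Cq] U ⊗[Cq] M :=
  twist hρ fun d i => Kpow (i + d) * v i

/-- The map `a ⊗ b ↦ ∑ i, a S(K ^ (i + |b|) v_i) ⊗ (u_i ▷ b)`, the inverse of `unbraidTwist`. -/
abbrev unbraidTwistInv (hρ : IsAdmissible ρ) : U ⊗[Cq] M →ₗ[Cq] U ⊗[Cq] M :=
  twist hρ fun d i => S (Kpow (i + d) * v i)

theorem unbraidTwist_tmul (hρ : IsAdmissible ρ) (a : U) (m : M) :
    unbraidTwist hρ (a ⊗ₜ m) = (LinearMap.mulLeft Cq a).rTensor M (coact hρ m) :=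
  twist_tmul_eq hρ _ a m

theorem twist_rTensor_mulLeft (hρ : IsAdmissible ρ) (c : ℤ → ℕ → U) (a : U) (z : U ⊗[Cq] M) :
    twist hρ c ((LinearMap.mulLeft Cq a).rTensor M z) =
      (LinearMap.mulLeft Cq a).rTensor M (twist hρ c z) := by
  induction z using TensorProduct.induction_on with
  | zero => simp
  | add x y hx hy => simp only [map_add, hx, hy]
  | tmul x m =>
    rw [LinearMap.rTensor_tmul, twist_tmul_eq, twist_tmul_eq, ← LinearMap.rTensor_comp_apply,
      LinearMap.mulLeft_apply, LinearMap.mulLeft_mul]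

theorem unbraidTwist_rTensor (hρ : IsAdmissible ρ) (f : U →ₗ[Cq] U) (z : U ⊗[Cq] M) :
    unbraidTwist hρ (f.rTensor M z) = contract M f LinearMap.id ((coact hρ).lTensor U z) := by
  induction z using TensorProduct.induction_on with
  | zero => simp
  | add x y hx hy => simp only [map_add, hx, hy]
  | tmul x m =>
    rw [LinearMap.rTensor_tmul, LinearMap.lTensor_tmul, unbraidTwist_tmul]
    induction coact hρ m using TensorProduct.induction_on with
    | zero => simp
    | add x y hx hy => simp only [map_add, TensorProduct.tmul_add, hx, hy]
    | tmul b m => simp [contract_tmul]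

theorem unbraidTwistInv_eq (hρ : IsAdmissible ρ) (z : U ⊗[Cq] M) :
    unbraidTwistInv hρ z = contract M LinearMap.id S ((coact hρ).lTensor U z) := by
  induction z using TensorProduct.induction_on with
  | zero => simp
  | add x y hx hy => simp only [map_add, hx, hy]
  | tmul x m =>
    rw [twist_tmul_eq, LinearMap.lTensor_tmul, coactWith_S]
    induction coact hρ m using TensorProduct.induction_on with
    | zero => simp
    | add x y hx hy => simp only [map_add, TensorProduct.tmul_add, hx, hy]
    | tmul b m => simp [contract_tmul]

theorem rTensor_counit_coact (hρ : IsAdmissible ρ) (m : M) :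
    (Algebra.linearMap Cq U ∘ₗ counit.toLinearMap).rTensor M (coact hρ m) = 1 ⊗ₜ m := by
  conv_rhs => rw [← coact_counit hρ m]
  induction coact hρ m using TensorProduct.induction_on with
  | zero => simp
  | add x y hx hy => simp only [map_add, TensorProduct.tmul_add, hx, hy]
  | tmul a m => simp [Algebra.algebraMap_eq_smul_one, TensorProduct.smul_tmul]

/-- By `contract_coact` the first leg carries the convolution of the identity with the antipode,
which is the counit; the counit axiom of the coaction concludes. The other composite uses the
convolution in the opposite order. -/
theorem unbraidTwistInv_unbraidTwist (hρ : IsAdmissible ρ) (z : U ⊗[Cq] M) :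
    unbraidTwistInv hρ (unbraidTwist hρ z) = z := by
  induction z using TensorProduct.induction_on with
  | zero => simp
  | add x y hx hy => simp only [map_add, hx, hy]
  | tmul a m =>
    have h : LinearMap.mul' Cq U ∘ₗ TensorProduct.map LinearMap.id S ∘ₗ comul.toLinearMap =
        Algebra.linearMap Cq U ∘ₗ counit.toLinearMap :=
      LinearMap.ext fun x => (mul_antipode_right x).trans (Algebra.algebraMap_eq_smul_one _).symm
    rw [unbraidTwist_tmul, twist_rTensor_mulLeft, unbraidTwistInv_eq, contract_coact, h,
      rTensor_counit_coact, LinearMap.rTensor_tmul, LinearMap.mulLeft_apply, mul_one]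

theorem unbraidTwist_unbraidTwistInv (hρ : IsAdmissible ρ) (z : U ⊗[Cq] M) :
    unbraidTwist hρ (unbraidTwistInv hρ z) = z := by
  induction z using TensorProduct.induction_on with
  | zero => simp
  | add x y hx hy => simp only [map_add, hx, hy]
  | tmul a m =>
    have h : LinearMap.mul' Cq U ∘ₗ TensorProduct.map S LinearMap.id ∘ₗ comul.toLinearMap =
        Algebra.linearMap Cq U ∘ₗ counit.toLinearMap :=
      LinearMap.ext fun x => (mul_antipode_left x).trans (Algebra.algebraMap_eq_smul_one _).symm
    rw [twist_tmul_eq, twist_rTensor_mulLeft, coactWith_S, unbraidTwist_rTensor, contract_coact, h,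
      rTensor_counit_coact, LinearMap.rTensor_tmul, LinearMap.mulLeft_apply, mul_one]

/-! ### Multiplicativity of the unbraiding map -/

/-- The map `a ⊗ m ↦ ∑ i, a K ^ (i + |m|) v_i ⊗ (u_i ▷ m)` on `U_q(sl₂)^lf ⊗ M`. -/
def unbraidLf (hρ : IsAdmissible ρ) : lf ⊗[Cq] M →ₗ[Cq] U ⊗[Cq] M :=
  unbraidTwist hρ ∘ₗ incl.rTensor M

theorem unbraidLf_tmul (hρ : IsAdmissible ρ) (a : lf) (m : M) :
    unbraidLf hρ (a ⊗ₜ m) = (LinearMap.mulLeft Cq (a : U)).rTensor M (coact hρ m) :=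
  unbraidTwist_tmul hρ _ m

/-- The map is the invertible twist on `U ⊗ M` restricted along the inclusion, which stays injective
after tensoring by flatness. -/
theorem unbraidLf_injective (hρ : IsAdmissible ρ) : Function.Injective (unbraidLf hρ) :=
  (Function.LeftInverse.injective (unbraidTwistInv_unbraidTwist hρ)).comp
    (Module.Flat.rTensor_preserves_injective_linearMap _ incl_injective)

theorem IsEquivariant.unbraidLf_lTensor {hρ : IsAdmissible ρ} {hσ : IsAdmissible σ}
    {f : M →ₗ[Cq] N} (hf : IsEquivariant ρ σ f) (z : lf ⊗[Cq] M) :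
    unbraidLf hσ (f.lTensor lf z) = f.lTensor U (unbraidLf hρ z) := by
  induction z using TensorProduct.induction_on with
  | zero => simp
  | add x y hx hy => simp only [map_add, hx, hy]
  | tmul a m =>
    rw [LinearMap.lTensor_tmul, unbraidLf_tmul, unbraidLf_tmul, hf.coact (hρ := hρ)]
    exact LinearMap.congr_fun ((LinearMap.rTensor_comp_lTensor _ _ _).trans
      (LinearMap.lTensor_comp_rTensor _ _ _).symm) _

/-- The multiplication `(a ⊗ m) (b ⊗ n) = a b ⊗ μ (m ⊗ n)` of `U_q(sl₂) ⊗ M`. -/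
def tensorMul (μ : M ⊗[Cq] M →ₗ[Cq] M) : (U ⊗[Cq] M) ⊗[Cq] (U ⊗[Cq] M) →ₗ[Cq] U ⊗[Cq] M :=
  μ.lTensor U ∘ₗ mulFirst M M

theorem tensorMul_tmul (μ : M ⊗[Cq] M →ₗ[Cq] M) (a b : U) (m n : M) :
    tensorMul μ ((a ⊗ₜ m) ⊗ₜ (b ⊗ₜ n)) = (a * b) ⊗ₜ μ (m ⊗ₜ n) := by
  simp [tensorMul, mulFirst_tmul]

theorem tensorMul_mulLeft (μ : M ⊗[Cq] M →ₗ[Cq] M) (a : U) (x y : U ⊗[Cq] M) :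
    tensorMul μ ((LinearMap.mulLeft Cq a).rTensor M x ⊗ₜ y) =
      (LinearMap.mulLeft Cq a).rTensor M (tensorMul μ (x ⊗ₜ y)) := by
  induction x using TensorProduct.induction_on with
  | zero => simp
  | add x x' hx hy => simp only [map_add, TensorProduct.add_tmul, hx, hy]
  | tmul b m =>
    induction y using TensorProduct.induction_on with
    | zero => simp
    | add x y hx hy => simp only [map_add, TensorProduct.tmul_add, hx, hy]
    | tmul c n => simp [tensorMul_tmul, mul_assoc]

theorem tensorMul_mulRight (μ : M ⊗[Cq] M →ₗ[Cq] M) (a : U) (x y : U ⊗[Cq] M) :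
    tensorMul μ ((LinearMap.mulRight Cq a).rTensor M x ⊗ₜ y) =
      tensorMul μ (x ⊗ₜ (LinearMap.mulLeft Cq a).rTensor M y) := by
  induction x using TensorProduct.induction_on with
  | zero => simp
  | add x x' hx hy => simp only [map_add, TensorProduct.add_tmul, hx, hy]
  | tmul b m =>
    induction y using TensorProduct.induction_on with
    | zero => simp
    | add x y hx hy => simp only [map_add, TensorProduct.tmul_add, hx, hy]
    | tmul c n => simp [tensorMul_tmul, mul_assoc]

/-- Naturality for the equivariant multiplication reduces this to the coaction on a tensor product.
-/
theorem coact_mul (hρ : IsAdmissible ρ) {μ : M ⊗[Cq] M →ₗ[Cq] M}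
    (hμ : IsEquivariant (tensorAct ρ ρ) ρ μ) (m n : M) :
    coact hρ (μ (m ⊗ₜ n)) = tensorMul μ (coact hρ m ⊗ₜ coact hρ n) := by
  rw [hμ.coact (hρ := hρ.tensor hρ), coact_tensor]
  rfl

theorem mul_ad_comul (h x : U) :
    LinearMap.mul' Cq U (TensorProduct.map (ad.toLinearMap.flip x) LinearMap.id (comul h)) =
      h * x := by
  have h1 := isEquivariant_mul_ad_left h (x ⊗ₜ 1)
  rw [leftAct_apply, LinearMap.mul'_apply, mul_one] at h1
  rw [← h1, tensorAct_apply]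
  congr 1
  induction comul h using TensorProduct.induction_on with
  | zero => simp
  | add x y hx hy => simp only [map_add, LinearMap.add_apply, hx, hy]
  | tmul a b => simp [Module.endTensorEndAlgHom_apply, leftAct_apply]

/-- The braiding is (m₍₋₁₎ ▷ x) ⊗ m₍₀₎ for Φ(m) = m₍₋₁₎ ⊗ m₍₀₎. Applying φ produces a second
coaction; coassociativity turns the first leg into (h₍₁₎ ▷ x) h₍₂₎ with h = m₍₋₁₎, and this is h x
by `mul_ad_comul`. -/
theorem unbraidLf_braiding (hρ : IsAdmissible ρ) (m : M) (x : lf) :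
    unbraidLf hρ (braiding hρ isAdmissible_adlf (m ⊗ₜ x)) =
      (LinearMap.mulRight Cq (x : U)).rTensor M (coact hρ m) := by
  have h1 : incl ∘ₗ adlf.toLinearMap.flip x = ad.toLinearMap.flip (x : U) := rfl
  have h2 : LinearMap.mul' Cq U ∘ₗ TensorProduct.map (ad.toLinearMap.flip (x : U)) LinearMap.id ∘ₗ
      comul.toLinearMap = LinearMap.mulRight Cq (x : U) :=
    LinearMap.ext fun h => mul_ad_comul h x
  rw [unbraidLf, LinearMap.comp_apply, braiding_eq, ← LinearMap.rTensor_comp_apply, h1,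
    unbraidTwist_rTensor, contract_coact, h2]

theorem braidedProduct_tmul {τ : U →ₐ[Cq] Module.End Cq P} (hτ : IsAdmissible τ)
    (hρ : IsAdmissible ρ) (μ : P ⊗[Cq] P →ₗ[Cq] P)
    (ν : M ⊗[Cq] M →ₗ[Cq] M) (g x : P) (h y : M) :
    braidedProduct hτ hρ μ ν ((g ⊗ₜ h) ⊗ₜ (x ⊗ₜ y)) =
      TensorProduct.map (μ ∘ₗ TensorProduct.mk Cq P P g) (ν ∘ₗ (TensorProduct.mk Cq M M).flip y)
        (braiding hρ hτ (h ⊗ₜ x)) := by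
  simp only [braidedProduct, LinearMap.comp_apply, LinearEquiv.coe_coe, TensorProduct.assoc_tmul,
    LinearMap.lTensor_tmul, TensorProduct.assoc_symm_tmul, LinearMap.rTensor_tmul]
  induction braiding hρ hτ (h ⊗ₜ x) using TensorProduct.induction_on with
  | zero => simp
  | add x y hx hy => simp only [map_add, TensorProduct.add_tmul, TensorProduct.tmul_add, hx, hy]
  | tmul a b => simp

/-- Both sides are gΦ(h)xΦ(y) on pure tensors. The factor Φ(h)x is φ of the braiding, and Φ(y)
splits off because the coaction is multiplicative. -/
theorem unbraidLf_mul (hρ : IsAdmissible ρ) {μ : M ⊗[Cq] M →ₗ[Cq] M}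
    (hμ : IsEquivariant (tensorAct ρ ρ) ρ μ) (z w : lf ⊗[Cq] M) :
    unbraidLf hρ (braidedProduct isAdmissible_adlf hρ (LinearMap.mul' Cq lf) μ (z ⊗ₜ w)) =
      tensorMul μ (unbraidLf hρ z ⊗ₜ unbraidLf hρ w) := by
  induction z using TensorProduct.induction_on with
  | zero => simp
  | add x x' hx hy => simp only [map_add, TensorProduct.add_tmul, hx, hy]
  | tmul g h =>
    induction w using TensorProduct.induction_on with
    | zero => simp
    | add x y hx hy => simp only [map_add, TensorProduct.tmul_add, hx, hy]
    | tmul x y =>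
      have key : ∀ t : lf ⊗[Cq] M, unbraidLf hρ (TensorProduct.map
          (LinearMap.mul' Cq lf ∘ₗ TensorProduct.mk Cq lf lf g)
          (μ ∘ₗ (TensorProduct.mk Cq M M).flip y) t) =
          tensorMul μ ((LinearMap.mulLeft Cq (g : U)).rTensor M (unbraidLf hρ t) ⊗ₜ
            coact hρ y) := by
        intro t
        induction t using TensorProduct.induction_on with
        | zero => simp
        | add x y hx hy => simp only [map_add, TensorProduct.add_tmul, hx, hy]
        | tmul a b =>
          rw [TensorProduct.map_tmul, LinearMap.comp_apply, LinearMap.comp_apply,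
            TensorProduct.mk_apply, LinearMap.flip_apply, TensorProduct.mk_apply, unbraidLf_tmul,
            unbraidLf_tmul, coact_mul hρ hμ, tensorMul_mulLeft, tensorMul_mulLeft,
            ← LinearMap.rTensor_comp_apply, ← LinearMap.mulLeft_mul]
          rfl
      rw [braidedProduct_tmul, key, unbraidLf_braiding, unbraidLf_tmul, unbraidLf_tmul,
        tensorMul_mulLeft, tensorMul_mulRight, ← tensorMul_mulLeft]

/-- The product is a composition of equivariant maps, the braiding among them. This feeds the
induction on tensor powers, where `unbraidLf_mul` asks for an equivariant multiplication on the
second factor. -/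
theorem isEquivariant_braidedProduct {τ : U →ₐ[Cq] Module.End Cq P} (hτ : IsAdmissible τ)
    (hρ : IsAdmissible ρ) {μ : P ⊗[Cq] P →ₗ[Cq] P} {ν : M ⊗[Cq] M →ₗ[Cq] M}
    (hμ : IsEquivariant (tensorAct τ τ) τ μ) (hν : IsEquivariant (tensorAct ρ ρ) ρ ν) :
    IsEquivariant (tensorAct (tensorAct τ ρ) (tensorAct τ ρ)) (tensorAct τ ρ)
      (braidedProduct hτ hρ μ ν) :=
  (hμ.map hν).comp (isEquivariant_assoc.symm.comp ((IsEquivariant.lTensor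
    (isEquivariant_assoc.comp ((isEquivariant_braiding hρ hτ).rTensor.comp
      isEquivariant_assoc.symm))).comp isEquivariant_assoc))

/-- The map `z ⊗ y ↦ φ z (y ⊗ 1)`, where `φ` is `unbraidLf`. -/
def unbraidLfMul (hρ : IsAdmissible ρ) : (lf ⊗[Cq] M) ⊗[Cq] U →ₗ[Cq] U ⊗[Cq] M :=
  (LinearMap.mul' Cq U).rTensor M ∘ₗ (TensorProduct.assoc Cq U U M).symm.toLinearMap ∘ₗ
    TensorProduct.map incl (halfBraiding hρ leftAct) ∘ₗ (TensorProduct.assoc Cq lf M U).toLinearMap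

/-- The additional factor `y` exhibits φ as a half braiding with `U` under left multiplication,
followed by the equivariant map `x ⊗ y ↦ x y` of `isEquivariant_mul_ad_left`. -/
theorem isEquivariant_unbraidLfMul (hρ : IsAdmissible ρ) :
    IsEquivariant (tensorAct (tensorAct adlf ρ) leftAct) (tensorAct leftAct ρ)
      (unbraidLfMul hρ) :=
  isEquivariant_mul_ad_left.rTensor.comp (isEquivariant_assoc.symm.comp
    ((isEquivariant_incl.map (isEquivariant_halfBraiding hρ)).comp isEquivariant_assoc))

theorem unbraidLfMul_tmul (hρ : IsAdmissible ρ) (z : lf ⊗[Cq] M) (y : U) :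
    unbraidLfMul hρ (z ⊗ₜ y) = (LinearMap.mulRight Cq y).rTensor M (unbraidLf hρ z) := by
  induction z using TensorProduct.induction_on with
  | zero => simp
  | add x y hx hy => simp only [map_add, TensorProduct.add_tmul, hx, hy]
  | tmul a m =>
    simp only [unbraidLfMul, LinearMap.comp_apply, LinearEquiv.coe_coe, TensorProduct.assoc_tmul,
      TensorProduct.map_tmul, halfBraiding_tmul, unbraidLf_tmul]
    induction coact hρ m using TensorProduct.induction_on with
    | zero => simp
    | add x y hx hy => simp only [map_add, TensorProduct.tmul_add, hx, hy]
    | tmul b m => simp [leftAct_apply, mul_assoc]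

end modules

/-! ### The coaction `τ_L` -/

theorem adlf_one (h : U) : adlf h 1 = counit h • 1 := Subtype.ext (ad_apply_one h)

theorem tensorMul_mul' (x y : U ⊗[Cq] lf) :
    tensorMul (LinearMap.mul' Cq lf) (x ⊗ₜ y) = x * y := by
  induction x using TensorProduct.induction_on with
  | zero => simp
  | add x x' hx hy => simp only [map_add, TensorProduct.add_tmul, add_mul, hx, hy]
  | tmul b m =>
    induction y using TensorProduct.induction_on with
    | zero => simp
    | add x y hx hy => simp only [map_add, TensorProduct.tmul_add, mul_add, hx, hy]
    | tmul c n => simp [tensorMul_tmul]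

/-- The coaction on `U_q(sl₂)^lf`, as an algebra morphism. -/
def coactLf : lf →ₐ[Cq] U ⊗[Cq] lf :=
  AlgHom.ofLinearMap (coact isAdmissible_adlf)
    (coact_of_trivial _ (by rw [adlf_one, counit_E, zero_smul])
      (by rw [adlf_one, counit_K, one_smul]))
    fun x y => by
      rw [← tensorMul_mul', ← coact_mul _ isEquivariant_mul_lf, LinearMap.mul'_apply]

theorem coactLf_apply (x : lf) : coactLf x = coact isAdmissible_adlf x := rfl

theorem adlf_E_lfE : adlf E lfE = 0 :=
  Subtype.ext (show ad E E = 0 by rw [ad_E, sub_self, zero_mul])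

theorem adlf_E_lfK : adlf E lfK = (1 - q ^ 2) • lfE := by
  refine Subtype.ext (show ad E K = (1 - q ^ 2) • E from ?_)
  rw [ad_E, K_mul_E, sub_mul, smul_mul_assoc, mul_assoc, K_mul_Kinv, mul_one]
  module

theorem adlf_E_lfCasimir : adlf E lfCasimir = 0 :=
  Subtype.ext (show ad E casimir = 0 by rw [ad_E, casimir_mul_E, sub_self, zero_mul])

theorem adlf_K_lfCasimir : adlf K lfCasimir = lfCasimir :=
  Subtype.ext (show ad K casimir = casimir by
    rw [ad_K, ← casimir_mul_K, mul_assoc, K_mul_Kinv, mul_one])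

theorem adlf_E_lfFK : adlf E lfFK = (-(q * (q - q⁻¹)⁻¹)) • lfCasimir
    + ((q ^ 2 + 1) * (q - q⁻¹)⁻¹) • lfK := Subtype.ext ad_E_FK

theorem lfE_mem_homog : lfE ∈ homog adlf 1 := by
  refine mem_homog.2 (Subtype.ext (show ad K E = q ^ (2 * (1 : ℤ)) • E from ?_))
  rw [ad_K, K_mul_E, smul_mul_assoc, mul_assoc, K_mul_Kinv, mul_one]
  norm_cast

theorem lfK_mem_homog : lfK ∈ homog adlf 0 := by
  refine mem_homog.2 (Subtype.ext (show ad K K = q ^ (2 * (0 : ℤ)) • K from ?_))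
  rw [ad_K, mul_assoc, K_mul_Kinv, mul_one, mul_zero, zpow_zero, one_smul]

theorem lfFK_mem_homog : lfFK ∈ homog adlf (-1) := by
  refine mem_homog.2 (Subtype.ext (show ad K (F * K) = q ^ (2 * (-1 : ℤ)) • (F * K) from ?_))
  rw [ad_K, mul_assoc, mul_assoc, K_mul_Kinv, mul_one, K_mul_F]
  congr 1
  rw [inv_pow, mul_neg, mul_one, zpow_neg]
  norm_cast

theorem thetaCoeff_two : thetaCoeff 2 * (q ^ 2 + 1) = q ^ 2 * (q - q⁻¹) ^ 2 := by
  have h0 := q_ne_zero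
  have hc := q_sub_ne_zero
  have h := thetaCoeff_mul_q_sub 1
  rw [thetaCoeff_one] at h
  refine mul_right_cancel₀ hc ?_
  have e : q ^ 2 * (q - q⁻¹ ^ (2 * 1 + 1)) = (q ^ 2 + 1) * (q - q⁻¹) := by
    rw [inv_pow]
    field_simp
    ring
  linear_combination q ^ 2 * h - thetaCoeff 2 * e

/-- The sums are short: the adjoint action of `E` kills `E` and Λ at once, `K` after two steps and
`FK` after three. -/
theorem isTauL_coactLf : IsTauL coactLf where
  map_E := by
    rw [coactLf_apply, coact_apply _ lfE_mem_homog (k := 1) (by simpa using adlf_E_lfE)]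
    simp [thetaCoeff_zero, Kpow_one]
  map_K := by
    have h0 := q_ne_zero
    have h2 : (adlf E ^ 2) lfK = 0 := by
      rw [pow_two, Module.End.mul_apply, adlf_E_lfK, map_smul, adlf_E_lfE, smul_zero]
    rw [coactLf_apply, coact_apply _ lfK_mem_homog h2, Finset.sum_range_succ, Finset.sum_range_one]
    simp only [pow_zero, pow_one, Module.End.one_apply, adlf_E_lfK, thetaCoeff_zero, thetaCoeff_one,
      Nat.cast_zero, Nat.cast_one, add_zero, Kpow_zero, Kpow_one, mul_one, one_smul,
      TensorProduct.tmul_smul, K_mul_F, ← TensorProduct.smul_tmul', smul_smul]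
    match_scalars
    · ring
    · field_simp
      ring
  map_casimir := coact_of_trivial isAdmissible_adlf adlf_E_lfCasimir adlf_K_lfCasimir
  map_FK := by
    have h0 := q_ne_zero
    have hc := q_sub_ne_zero
    have h2 : adlf E (adlf E lfFK) = ((q ^ 2 + 1) * (q - q⁻¹)⁻¹ * (1 - q ^ 2)) • lfE := by
      rw [adlf_E_lfFK, map_add, map_smul, map_smul, adlf_E_lfCasimir, adlf_E_lfK, smul_zero,
        zero_add, smul_smul]
    have h3 : (adlf E ^ 3) lfFK = 0 := by
      rw [pow_succ', pow_two, Module.End.mul_apply, Module.End.mul_apply, h2, map_smul, adlf_E_lfE,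
        smul_zero]
    have hKF : K * F ^ 2 = q⁻¹ ^ 4 • (F ^ 2 * K) := K_mul_F_pow 2
    rw [coactLf_apply, coact_apply _ lfFK_mem_homog h3, Finset.sum_range_succ,
      Finset.sum_range_succ, Finset.sum_range_one]
    have e : ((2 : ℕ) : ℤ) + -1 = 1 := by norm_num
    have e' : ((1 : ℕ) : ℤ) + -1 = 0 := by norm_num
    rw [pow_two (adlf E), Module.End.mul_apply, h2, pow_one (adlf E), adlf_E_lfFK, e, e']
    simp only [pow_zero, pow_one, Module.End.one_apply, thetaCoeff_zero, thetaCoeff_one,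
      Nat.cast_zero, zero_add, Kpow_zero, Kpow_one, Kpow_neg_one, mul_one, one_mul,
      one_smul, TensorProduct.tmul_smul, TensorProduct.tmul_add, hKF, ← TensorProduct.smul_tmul',
      smul_smul, smul_add]
    have hc' := q_sq_sub_one_ne_zero
    have h4 : thetaCoeff 2 * ((q ^ 2 + 1) * (q - q⁻¹)⁻¹ * (1 - q ^ 2) * q⁻¹ ^ 4) =
        -(q⁻¹ * (q - q⁻¹) ^ 2) := by
      have := thetaCoeff_two
      calc _ = thetaCoeff 2 * (q ^ 2 + 1) * ((q - q⁻¹)⁻¹ * (1 - q ^ 2) * q⁻¹ ^ 4) := by ring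
        _ = _ := by
          rw [this]
          field_simp
          ring
    rw [h4]
    have h5 : (q - q⁻¹) * -(q * (q - q⁻¹)⁻¹) = -q := by field_simp
    have h6 : (q - q⁻¹) * ((q ^ 2 + 1) * (q - q⁻¹)⁻¹) = q * (q + q⁻¹) := by
      field_simp
    rw [h5, h6]
    module

/-- The coaction proves existence, so the default branch in the definition of `tauL` does not occur.
-/
theorem isTauL_tauL : IsTauL tauL := by
  have h : ∃ t, IsTauL t := ⟨_, isTauL_coactLf⟩
  rw [tauL, dif_pos h]
  exact h.choose_spec

theorem tauL_apply (x : lf) : tauL x = coact isAdmissible_adlf x := by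
  rw [isTauL_tauL.unique isTauL_coactLf, coactLf_apply]

/-! ### The braided comultiplication -/

theorem lTensor_incl_injective : Function.Injective (incl.lTensor U) :=
  LinearMap.ker_eq_bot.1 lTensor_incl_ker

theorem lTensor_incl_mul (x y : U ⊗[Cq] lf) :
    incl.lTensor U (x * y) = incl.lTensor U x * incl.lTensor U y :=
  map_mul (Algebra.TensorProduct.map (AlgHom.id Cq U) lf.val) x y

theorem comulLf_mul (x y : lf) : comulLf (x * y) = comulLf x * comulLf y := by
  apply lTensor_incl_injective
  rw [lTensor_incl_mul, lTensor_comulLf, lTensor_comulLf, lTensor_comulLf, Subalgebra.coe_mul, map_mul]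

theorem comulLf_eq {x : lf} {z : U ⊗[Cq] lf} (h : comul (x : U) = incl.lTensor U z) :
    comulLf x = z := lTensor_incl_injective ((lTensor_comulLf x).trans h)

theorem comulLf_lfE : comulLf lfE = E ⊗ₜ lfK + 1 ⊗ₜ lfE := comulLf_eq comul_E

theorem comulLf_lfK : comulLf lfK = K ⊗ₜ lfK := comulLf_eq comul_K

theorem comulLf_lfFK : comulLf lfFK = (F * K) ⊗ₜ lfK + 1 ⊗ₜ lfFK := by
  refine comulLf_eq ?_
  change comul (F * K) = (F * K) ⊗ₜ K + 1 ⊗ₜ (F * K)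
  rw [map_mul, comul_F, comul_K, add_mul, Algebra.TensorProduct.tmul_mul_tmul,
    Algebra.TensorProduct.tmul_mul_tmul, one_mul, Kinv_mul_K]

/-- The terms are grouped so that `FE` and K⁻¹ enter the second leg only through Λ, at the cost of a
correction by a multiple of K⁻¹ ⊗ K. -/
theorem comulLf_lfCasimir : comulLf lfCasimir = Kinv ⊗ₜ lfCasimir
    + (((q - q⁻¹) ^ 2 • (F * E) + q • K) ⊗ₜ lfK - q • (Kinv ⊗ₜ lfK))
    + (q - q⁻¹) ^ 2 • (F ⊗ₜ lfE) + (q - q⁻¹) ^ 2 • ((Kinv * E) ⊗ₜ lfFK) := by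
  refine comulLf_eq ?_
  have e : comul casimir = Kinv ⊗ₜ casimir + (((q - q⁻¹) ^ 2 • (F * E) + q • K) ⊗ₜ K
      - q • (Kinv ⊗ₜ K)) + (q - q⁻¹) ^ 2 • (F ⊗ₜ E)
      + (q - q⁻¹) ^ 2 • ((Kinv * E) ⊗ₜ (F * K)) := by
    simp only [casimir, map_add, map_smul, map_mul, comul_E, comul_F, comul_K, comul_Kinv, add_mul,
      mul_add, Algebra.TensorProduct.tmul_mul_tmul, one_mul, mul_one, TensorProduct.add_tmul,
      TensorProduct.tmul_add, TensorProduct.tmul_smul, ← TensorProduct.smul_tmul', smul_add]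
    module
  refine e.trans ?_
  simp only [map_add, map_sub, map_smul, LinearMap.lTensor_tmul]
  rfl

theorem unbraidLf_tmul_lf (a x : lf) :
    unbraidLf isAdmissible_adlf (a ⊗ₜ x) = ((a : U) ⊗ₜ 1) * coactLf x := by
  rw [unbraidLf_tmul, coactLf_apply]
  induction coact isAdmissible_adlf x using TensorProduct.induction_on with
  | zero => simp
  | add x y hx hy => simp only [map_add, mul_add, hx, hy]
  | tmul b m => simp

theorem unbraidLf_tmul_lfE (a : lf) :
    unbraidLf isAdmissible_adlf (a ⊗ₜ lfE) = ((a : U) * K) ⊗ₜ lfE := by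
  rw [unbraidLf_tmul_lf, isTauL_coactLf.map_E, Algebra.TensorProduct.tmul_mul_tmul, one_mul]

theorem unbraidLf_tmul_lfK (a : lf) :
    unbraidLf isAdmissible_adlf (a ⊗ₜ lfK) = (a : U) ⊗ₜ lfK
      - (q⁻¹ * (q - q⁻¹) ^ 2) • (((a : U) * (F * K)) ⊗ₜ lfE) := by
  rw [unbraidLf_tmul_lf, isTauL_coactLf.map_K, mul_sub, mul_smul_comm,
    Algebra.TensorProduct.tmul_mul_tmul, Algebra.TensorProduct.tmul_mul_tmul, one_mul, mul_one,
    one_mul]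

theorem unbraidLf_tmul_lfCasimir (a : lf) :
    unbraidLf isAdmissible_adlf (a ⊗ₜ lfCasimir) = (a : U) ⊗ₜ lfCasimir := by
  rw [unbraidLf_tmul_lf, isTauL_coactLf.map_casimir, Algebra.TensorProduct.tmul_mul_tmul, one_mul,
    mul_one]

theorem unbraidLf_tmul_lfFK (a : lf) :
    unbraidLf isAdmissible_adlf (a ⊗ₜ lfFK) = ((a : U) * Kinv) ⊗ₜ lfFK
      - q • (((a : U) * F) ⊗ₜ lfCasimir) + (q * (q + q⁻¹)) • (((a : U) * F) ⊗ₜ lfK)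
      - (q⁻¹ * (q - q⁻¹) ^ 2) • (((a : U) * (F ^ 2 * K)) ⊗ₜ lfE) := by
  rw [unbraidLf_tmul_lf, isTauL_coactLf.map_FK]
  simp only [mul_sub, mul_add, mul_smul_comm, Algebra.TensorProduct.tmul_mul_tmul, one_mul]

/-- A linear combination of elements `a_j ⊗ x_j`, with the `x_j` among `E`, `FK`, `K`, `Λ`. -/
theorem unbraidLf_combination (a b c e : lf) : unbraidLf isAdmissible_adlf
      (a ⊗ₜ lfE + b ⊗ₜ lfFK + c ⊗ₜ lfK + e ⊗ₜ lfCasimir) =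
    ((a : U) * K - (q⁻¹ * (q - q⁻¹) ^ 2) • ((b : U) * (F ^ 2 * K) + c * (F * K))) ⊗ₜ lfE +
    ((b : U) * Kinv) ⊗ₜ lfFK + ((c : U) + (q * (q + q⁻¹)) • ((b : U) * F)) ⊗ₜ lfK +
    ((e : U) - q • ((b : U) * F)) ⊗ₜ lfCasimir := by
  simp only [map_add, unbraidLf_tmul_lfE, unbraidLf_tmul_lfFK, unbraidLf_tmul_lfK,
    unbraidLf_tmul_lfCasimir, TensorProduct.add_tmul, TensorProduct.sub_tmul,
    ← TensorProduct.smul_tmul', smul_add]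
  abel

/-- Preimages are sought in the form of `unbraidLf_combination`. The resulting system is triangular:
the coefficient of `FK` determines `b`, those of `K` and Λ then determine `c` and `e`, and that of
`E` determines `a`. The point is that all four solutions lie in the locally finite part. -/
theorem exists_unbraidLf_eq_comulLf_gens :
    (∃ z, unbraidLf isAdmissible_adlf z = comulLf lfE) ∧
    (∃ z, unbraidLf isAdmissible_adlf z = comulLf lfFK) ∧
    (∃ z, unbraidLf isAdmissible_adlf z = comulLf lfK) ∧
    (∃ z, unbraidLf isAdmissible_adlf z = comulLf lfCasimir) := by
  have h0 := q_ne_zero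
  have hc := q_sub_ne_zero
  have hc' := q_sq_sub_one_ne_zero
  have key : ∀ (a b c e : lf) (a' b' c' e' : U),
      (a : U) * K - (q⁻¹ * (q - q⁻¹) ^ 2) • ((b : U) * (F ^ 2 * K) + c * (F * K)) = a' →
      (b : U) * Kinv = b' → (c : U) + (q * (q + q⁻¹)) • ((b : U) * F) = c' →
      (e : U) - q • ((b : U) * F) = e' →
      ∃ z, unbraidLf isAdmissible_adlf z =
        a' ⊗ₜ lfE + b' ⊗ₜ lfFK + c' ⊗ₜ lfK + e' ⊗ₜ lfCasimir := by
    rintro a b c e _ _ _ _ rfl rfl rfl rfl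
    exact ⟨_, unbraidLf_combination a b c e⟩
  have cE : (lfE : U) = E := rfl
  have cK : (lfK : U) = K := rfl
  have cFK : (lfFK : U) = F * K := rfl
  have cC : (lfCasimir : U) = (q - q⁻¹) ^ 2 • (F * E) + q • K + q⁻¹ • Kinv := rfl
  refine ⟨?_, ?_, ?_, ?_⟩
  -- With b = e = 0 and c = E, solving for `a` gives K⁻¹ + q⁻¹(q - q⁻¹)² EF. This equals q⁻¹(Λ -
  -- q⁻¹K), because Λ = (q - q⁻¹)² EF + q⁻¹K + qK⁻¹.
  · obtain ⟨z, hz⟩ := key (q⁻¹ • (lfCasimir - q⁻¹ • lfK)) 0 lfE 0 1 0 E 0 (by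
      simp only [Subalgebra.coe_smul, Subalgebra.coe_sub, Subalgebra.coe_zero, cE, cK, cC, zero_mul,
        zero_add, sub_mul, add_mul, smul_mul_assoc, mul_assoc, E_mul_F', E_mul_K, Kinv_mul_K,
        smul_add, smul_sub, smul_smul, mul_smul_comm]
      match_scalars <;> field_simp <;> ring) (by simp) (by simp [cE]) (by simp)
    exact ⟨z, by rw [hz, comulLf_lfE]; simp [add_comm]⟩
  -- The requirement b K⁻¹ = 1 forces b = K, and the rest follows from KF = q⁻²FK. The two
  -- contributions to the coefficient of `E` cancel, whence a = 0.
  · obtain ⟨z, hz⟩ := key 0 lfK (-(q⁻¹ ^ 2) • lfFK) (q⁻¹ • lfFK) 0 1 (F * K) 0 (by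
      simp only [Subalgebra.coe_smul, Subalgebra.coe_zero, cFK, cK, zero_mul,
        smul_mul_assoc, mul_assoc, pow_two F, K_mul_F',
        smul_add, smul_smul, mul_smul_comm]
      match_scalars
      field_simp
      ring) (by simp [cK, K_mul_Kinv]) (by
      simp only [Subalgebra.coe_smul, cFK, cK, K_mul_F, smul_smul]
      match_scalars
      field_simp
      ring) (by
      simp only [Subalgebra.coe_smul, cFK, cK, K_mul_F, smul_smul]
      match_scalars
      field_simp
      ring)
    exact ⟨z, by rw [hz, comulLf_lfFK]; simp [add_comm]⟩
  · obtain ⟨z, hz⟩ := key ((q⁻¹ * (q - q⁻¹) ^ 2 * q⁻¹ ^ 2) • lfFK) 0 lfK 0 0 0 K 0 (by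
      simp only [Subalgebra.coe_smul, Subalgebra.coe_zero, cFK, cK, zero_mul, zero_add,
        smul_mul_assoc, mul_assoc, K_mul_F', smul_smul]
      match_scalars
      ring) (by simp) (by simp [cK]) (by simp)
    exact ⟨z, by rw [hz, comulLf_lfK]; simp⟩
  · obtain ⟨z, hz⟩ := key (((q - q⁻¹) ^ 2 * q⁻¹ ^ 4) • lfFK) (((q - q⁻¹) ^ 2 * q⁻¹ ^ 2) • lfE)
      (-(q⁻¹ ^ 2) • lfCasimir + (q⁻¹ + q⁻¹ ^ 3) • lfK) (q⁻¹ • (lfCasimir - q⁻¹ • lfK))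
      ((q - q⁻¹) ^ 2 • F) ((q - q⁻¹) ^ 2 • (Kinv * E))
      ((q - q⁻¹) ^ 2 • (F * E) + q • K - q • Kinv) Kinv (by
      simp only [Subalgebra.coe_smul, Subalgebra.coe_add, cE, cFK, cK, cC, pow_two F, add_mul,
        smul_mul_assoc, mul_assoc, K_mul_F', Kinv_mul_F', E_mul_F', E_mul_K, mul_add, mul_sub,
        Kinv_mul_K, smul_add, smul_sub, smul_smul, mul_smul_comm, mul_one]
      match_scalars <;> field_simp <;> ring) (by
      simp only [Subalgebra.coe_smul, cE, smul_mul_assoc, E_mul_Kinv, smul_smul]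
      match_scalars
      field_simp) (by
      simp only [Subalgebra.coe_smul, Subalgebra.coe_add, cE, cK, cC, E_mul_F,
        smul_mul_assoc, smul_add, smul_sub, smul_smul]
      match_scalars <;> field_simp <;> ring) (by
      simp only [Subalgebra.coe_smul, Subalgebra.coe_sub, cE, cK, cC, E_mul_F,
        smul_mul_assoc, smul_add, smul_sub, smul_smul]
      match_scalars <;> field_simp <;> ring)
    refine ⟨z, ?_⟩
    rw [hz, comulLf_lfCasimir]
    simp only [TensorProduct.add_tmul, TensorProduct.sub_tmul, ← TensorProduct.smul_tmul']
    abel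

/-- The image of φ is closed under products by `unbraidLf_mul`, and Δ is multiplicative, so the
generators suffice. -/
theorem exists_unbraidLf_eq_comulLf (x : lf) :
    ∃ z, unbraidLf isAdmissible_adlf z = comulLf x := by
  obtain ⟨hE, hFK, hK, hC⟩ := exists_unbraidLf_eq_comulLf_gens
  have key : ∀ x (_ : x ∈ IL) (hx : x ∈ lf),
      ∃ z, unbraidLf isAdmissible_adlf z = comulLf ⟨x, hx⟩ := by
    intro x hx
    induction hx using Algebra.adjoin_induction with
    | mem x hx =>
      intro hx'
      rcases hx with rfl | rfl | rfl | rfl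
      · exact hE
      · exact hFK
      · exact hK
      · exact hC
    | algebraMap r =>
      intro hx'
      refine ⟨r • (1 ⊗ₜ 1), ?_⟩
      have h1 : comulLf ⟨algebraMap Cq U r, hx'⟩ = r • (1 ⊗ₜ 1) := comulLf_eq (by
        rw [AlgHom.commutes, map_smul, Algebra.algebraMap_eq_smul_one,
          Algebra.TensorProduct.one_def]
        rfl)
      rw [h1, map_smul, unbraidLf_tmul_lf, map_one, mul_one]
      rfl
    | add x y hx hy h1 h2 =>
      intro hx'
      obtain ⟨z, hz⟩ := h1 (IL_le_lf hx)
      obtain ⟨w, hw⟩ := h2 (IL_le_lf hy)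
      exact ⟨z + w, by rw [map_add, hz, hw, ← map_add]; rfl⟩
    | mul x y hx hy h1 h2 =>
      intro hx'
      obtain ⟨z, hz⟩ := h1 (IL_le_lf hx)
      obtain ⟨w, hw⟩ := h2 (IL_le_lf hy)
      exact ⟨_, by
        rw [unbraidLf_mul _ isEquivariant_mul_lf (z := z) (w := w), tensorMul_mul', hz, hw,
          ← comulLf_mul]
        rfl⟩
  exact key x (lf_eq_IL ▸ x.2) x.2

theorem rTensor_incl_injective : Function.Injective (incl.rTensor lf) :=
  Module.Flat.rTensor_preserves_injective_linearMap _ incl_injective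

/-- Since Δ(x) = φ(z) with z in `lf ⊗ lf`, the inverse twist returns `z`. Hence the left inverse
used in the definition of `braidedComul` is applied to an element of the range. -/
theorem rTensor_braidedComul (x : lf) :
    incl.rTensor lf (braidedComul x) = braidedComulFormula x := by
  obtain ⟨z, hz⟩ := exists_unbraidLf_eq_comulLf x
  have h1 : braidedComulFormula x = incl.rTensor lf z := by
    change unbraidTwistInv isAdmissible_adlf (comulLf x) = _
    rw [← hz]
    exact unbraidTwistInv_unbraidTwist _ _
  rw [braidedComul, LinearMap.comp_apply, h1,
    LinearMap.leftInverse_apply_of_inj (LinearMap.ker_eq_bot.2 rTensor_incl_injective)]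

theorem unbraidLf_braidedComul (x : lf) :
    unbraidLf isAdmissible_adlf (braidedComul x) = comulLf x := by
  rw [unbraidLf, LinearMap.comp_apply, rTensor_braidedComul]
  exact unbraidTwist_unbraidTwistInv _ _

/-! ### Equivariance of the braided comultiplication -/

theorem rTensor_mulRight_eq (y : U) (w : U ⊗[Cq] U) :
    (LinearMap.mulRight Cq y).rTensor U w = w * (y ⊗ₜ 1) := by
  induction w using TensorProduct.induction_on with
  | zero => simp
  | add a b ha hb => simp only [map_add, add_mul, ha, hb]
  | tmul a b => simp

/-- As φ sends the braided coproduct to Δ, the map is x ⊗ y ↦ Δ(x)(y ⊗ 1). Its equivariance becomes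
an identity in U ⊗ U once the second leg is included into `U`. -/
theorem isEquivariant_comulLf_mul : IsEquivariant (tensorAct adlf leftAct) (tensorAct leftAct adlf)
    (unbraidLfMul isAdmissible_adlf ∘ₗ braidedComul.rTensor U) := by
  have h1 : ∀ x y, incl.lTensor U ((unbraidLfMul isAdmissible_adlf ∘ₗ braidedComul.rTensor U)
      (x ⊗ₜ y)) = comul (x : U) * (y ⊗ₜ 1) := by
    intro x y
    rw [LinearMap.comp_apply, LinearMap.rTensor_tmul, unbraidLfMul_tmul, unbraidLf_braidedComul,
      ← rTensor_mulRight_eq, ← lTensor_comulLf]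
    exact LinearMap.congr_fun ((LinearMap.lTensor_comp_rTensor _ _ _).trans
      (LinearMap.rTensor_comp_lTensor _ _ _).symm) _
  have h2 : IsEquivariant (tensorAct leftAct adlf) (tensorAct leftAct ad) (incl.lTensor U) :=
    isEquivariant_incl.lTensor
  refine .of_gens_tensor (fun x y => ?_) (fun x y => ?_) (fun x y => ?_) <;>
    apply lTensor_incl_injective
  · rw [map_add, h1, h1, h2, h1]
    simp only [coe_adlf, ad_E, map_mul, map_sub, comul_E, comul_Kinv, leftAct_apply]
    induction comul (x : U) using TensorProduct.induction_on with
    | zero => simp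
    | add a b ha hb =>
      simp only [add_mul, map_add, ← ha, ← hb]
      noncomm_ring
    | tmul a b =>
      simp only [Algebra.TensorProduct.tmul_mul_tmul, tensorAct_E, add_mul, mul_add, sub_mul,
        leftAct_apply, ad_E, ad_K, TensorProduct.tmul_sub, mul_assoc, mul_one, one_mul,
        Kinv_mul_K', K_mul_Kinv]
      abel
  · rw [map_add, h1, h1, h2, h1]
    simp only [coe_adlf, ad_F, ad_Kinv, map_mul, map_sub, comul_F, comul_K, comul_Kinv,
      leftAct_apply]
    induction comul (x : U) using TensorProduct.induction_on with
    | zero => simp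
    | add a b ha hb =>
      simp only [add_mul, map_add, ← ha, ← hb]
      noncomm_ring
    | tmul a b =>
      simp only [Algebra.TensorProduct.tmul_mul_tmul, tensorAct_F, add_mul, mul_add, sub_mul,
        leftAct_apply, ad_F, TensorProduct.tmul_sub, mul_assoc, mul_one, one_mul,
        K_mul_Kinv']
      abel
  · rw [h1, h2, h1]
    simp only [coe_adlf, ad_K, map_mul, comul_K, comul_Kinv, leftAct_apply]
    induction comul (x : U) using TensorProduct.induction_on with
    | zero => simp
    | add a b ha hb => simp only [add_mul, mul_add, map_add, ← ha, ← hb]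
    | tmul a b =>
      simp only [Algebra.TensorProduct.tmul_mul_tmul, tensorAct_K, leftAct_apply, ad_K, mul_assoc,
        mul_one, Kinv_mul_K']

/-- Equivariance of Δ(x)(y ⊗ 1) is transported back through φ: z ⊗ y ↦ φ(z)(y ⊗ 1) is equivariant,
and at y = 1 it is injective in `z`. -/
theorem isEquivariant_braidedComul :
    IsEquivariant adlf (tensorAct adlf adlf) braidedComul := by
  refine .of_tensor_left (isEquivariant_unbraidLfMul isAdmissible_adlf) isEquivariant_comulLf_mul
    fun z z' h => unbraidLf_injective isAdmissible_adlf ?_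
  simpa only [unbraidLfMul_tmul, LinearMap.mulRight_one, LinearMap.rTensor_id,
    LinearMap.id_apply] using h

/-! ### The braided tensor powers -/

theorem one_eq_consEquiv {A : Type} [Ring A] [Algebra Cq A] (n : ℕ) :
    (1 : ⨂[Cq]^(n + 1) A) = consEquiv A n (1 ⊗ₜ 1) := by
  rw [PiTensorProduct.one_def, PiTensorProduct.one_def, consEquiv_tmul]
  congr 1
  funext i
  refine Fin.cases rfl (fun j => rfl) i

theorem consEquiv_mul {A : Type} [Ring A] [Algebra Cq A] (n : ℕ) (a b : A) (s t : ⨂[Cq]^n A) :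
    consEquiv A n (a ⊗ₜ s) * consEquiv A n (b ⊗ₜ t) = consEquiv A n ((a * b) ⊗ₜ (s * t)) := by
  induction s using PiTensorProduct.induction_on with
  | add x y hx hy => simp only [TensorProduct.tmul_add, map_add, add_mul, hx, hy]
  | smul_tprod r f =>
    induction t using PiTensorProduct.induction_on with
    | add x y hx hy => simp only [TensorProduct.tmul_add, map_add, mul_add, hx, hy]
    | smul_tprod r' g =>
      simp only [TensorProduct.tmul_smul, map_smul, smul_mul_assoc, mul_smul_comm, consEquiv_tmul,
        PiTensorProduct.tprod_mul_tprod]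
      congr 3
      funext i
      refine Fin.cases rfl (fun j => rfl) i

theorem isEquivariant_consEquiv (n : ℕ) : IsEquivariant (tensorAct adlf (powAct n)) (powAct (n + 1))
    (consEquiv lf n).toLinearMap := isEquivariant_conj _

theorem powAct_zero_apply (h : U) (z : ⨂[Cq]^0 lf) : powAct 0 h z = counit h • z := rfl

/-- The unit of a braided tensor power spans a trivial module. -/
theorem isEquivariant_one (n : ℕ) : IsEquivariant (trivialAct Cq) (powAct n)
    (LinearMap.toSpanSingleton Cq (⨂[Cq]^n lf) 1) := by
  induction n with
  | zero => exact fun h r => LinearMap.map_smul _ (counit h) r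
  | succ n ih =>
    have e : LinearMap.toSpanSingleton Cq (⨂[Cq]^(n + 1) lf) 1 = (consEquiv lf n).toLinearMap ∘ₗ
        (LinearMap.toSpanSingleton Cq (⨂[Cq]^n lf) 1).lTensor lf ∘ₗ
        (TensorProduct.mk Cq lf Cq 1) := by
      ext
      simp [one_eq_consEquiv]
    rw [e]
    refine (isEquivariant_consEquiv n).comp (ih.lTensor.comp ?_)
    refine .of_gens (fun r => ?_) (fun r => ?_) (fun r => ?_)
    · simp [tensorAct_E, adlf_one, counit_E]
    · simp [tensorAct_F, adlf_one, counit_F, counit_Kinv]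
    · simp [tensorAct_K, adlf_one, counit_K]

theorem powAct_one (n : ℕ) (h : U) : powAct n h 1 = counit h • 1 := by
  have := isEquivariant_one n h 1
  simp only [LinearMap.toSpanSingleton_apply, one_smul] at this
  rw [← this]
  simp [trivialAct, Algebra.ofId_apply]

theorem coact_powAct_one (n : ℕ) : coact (isAdmissible_powAct n) 1 = 1 ⊗ₜ 1 :=
  coact_of_trivial _ (by rw [powAct_one, counit_E, zero_smul])
    (by rw [powAct_one, counit_K, one_smul])

theorem isEquivariant_one_tmul (n : ℕ) : IsEquivariant (powAct n) (tensorAct adlf (powAct n))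
    (TensorProduct.mk Cq lf (⨂[Cq]^n lf) 1) := by
  refine .of_gens (fun m => ?_) (fun m => ?_) (fun m => ?_)
  · simp [tensorAct_E, adlf_one, counit_E]
  · simp [tensorAct_F, adlf_one, counit_F, counit_Kinv]
  · simp [tensorAct_K, adlf_one, counit_K]

theorem isEquivariant_tmul_one (n : ℕ) : IsEquivariant adlf (tensorAct adlf (powAct n))
    ((TensorProduct.mk Cq lf (⨂[Cq]^n lf)).flip 1) := by
  refine .of_gens (fun m => ?_) (fun m => ?_) (fun m => ?_)
  · simp [tensorAct_E, powAct_one, counit_E, counit_K]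
  · simp [tensorAct_F, powAct_one, counit_F]
  · simp [tensorAct_K, powAct_one, counit_K]

/-- Needed in `unbraid_mul`, where the inductive step applies `unbraidLf_mul` to the `n`-th braided
power. -/
theorem isEquivariant_braidedMul (n : ℕ) :
    IsEquivariant (tensorAct (powAct n) (powAct n)) (powAct n) (braidedMul n) := by
  induction n with
  | zero =>
    refine .of_gens_tensor (fun x y => ?_) (fun x y => ?_) (fun x y => ?_)
    · simp [powAct_zero_apply, counit_E]
    · simp [powAct_zero_apply, counit_F]
    · simp [powAct_zero_apply, counit_K]
  | succ n ih =>
    exact (isEquivariant_consEquiv n).comp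
      ((isEquivariant_braidedProduct isAdmissible_adlf (isAdmissible_powAct n)
        isEquivariant_mul_lf ih).comp
        ((isEquivariant_consEquiv n).symm.map (isEquivariant_consEquiv n).symm))

theorem unbraid_consEquiv (n : ℕ) (z : lf ⊗[Cq] ⨂[Cq]^n lf) : unbraid (n + 1) (consEquiv lf n z) =
    consEquiv U n ((unbraid n).lTensor U (unbraidLf (isAdmissible_powAct n) z)) := by
  simp only [unbraid, LinearMap.comp_apply, LinearEquiv.coe_coe, LinearEquiv.symm_apply_apply]
  rfl

theorem unbraid_injective (n : ℕ) : Function.Injective (unbraid n) := by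
  induction n with
  | zero =>
    -- Both empty tensor powers are identified with the base field, and the map becomes the
    -- identity.
    have h : ∀ z, PiTensorProduct.isEmptyEquiv (Fin 0) (unbraid 0 z) =
        PiTensorProduct.isEmptyEquiv (R := Cq) (Fin 0) z := by
      intro z
      induction z using PiTensorProduct.induction_on with
      | add x y hx hy => simp only [map_add, hx, hy]
      | smul_tprod r f => simp [unbraid]
    intro x y hxy
    exact (PiTensorProduct.isEmptyEquiv (R := Cq) (Fin 0)).injective (by rw [← h, ← h, hxy])
  | succ n ih =>
    exact (consEquiv U n).injective.comp
      ((Module.Flat.lTensor_preserves_injective_linearMap _ ih).comp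
        ((unbraidLf_injective (isAdmissible_powAct n)).comp (consEquiv lf n).symm.injective))

theorem unbraid_one (n : ℕ) : unbraid n 1 = 1 := by
  induction n with
  | zero =>
    rw [PiTensorProduct.one_def, PiTensorProduct.one_def, unbraid, PiTensorProduct.map_tprod]
    rfl
  | succ n ih =>
    rw [one_eq_consEquiv, unbraid_consEquiv, unbraidLf_tmul, coact_powAct_one,
      LinearMap.rTensor_tmul, LinearMap.lTensor_tmul, ih, one_eq_consEquiv]
    simp

/-- The step φ is multiplicative for the ordinary product in the first factor and the braided one in
the others; the induction hypothesis handles the latter. -/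
theorem unbraid_mul (n : ℕ) (x y : ⨂[Cq]^n lf) :
    unbraid n (braidedMul n (x ⊗ₜ y)) = unbraid n x * unbraid n y := by
  induction n with
  | zero =>
    have h : ∀ z : ⨂[Cq]^0 lf, z = PiTensorProduct.isEmptyEquiv (Fin 0) z • 1 := by
      intro z
      apply (PiTensorProduct.isEmptyEquiv (R := Cq) (Fin 0)).injective
      rw [map_smul, PiTensorProduct.one_def, PiTensorProduct.isEmptyEquiv_apply_tprod, smul_eq_mul,
        mul_one]
    have h' : braidedMul 0 (x ⊗ₜ y) = PiTensorProduct.isEmptyEquiv (Fin 0) x • y := rfl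
    rw [h', map_smul]
    conv_rhs => rw [h x, map_smul, unbraid_one, smul_mul_assoc, one_mul]
  | succ n ih =>
    obtain ⟨z, rfl⟩ := (consEquiv lf n).surjective x
    obtain ⟨w, rfl⟩ := (consEquiv lf n).surjective y
    have h : braidedMul (n + 1) (consEquiv lf n z ⊗ₜ consEquiv lf n w) = consEquiv lf n
        (braidedProduct isAdmissible_adlf (isAdmissible_powAct n) (LinearMap.mul' Cq lf)
          (braidedMul n) (z ⊗ₜ w)) := by
      simp [braidedMul]
    have key : ∀ s t : U ⊗[Cq] ⨂[Cq]^n lf, consEquiv U n ((unbraid n).lTensor U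
        (tensorMul (braidedMul n) (s ⊗ₜ t))) = consEquiv U n ((unbraid n).lTensor U s) *
          consEquiv U n ((unbraid n).lTensor U t) := by
      intro s t
      induction s using TensorProduct.induction_on with
      | zero => simp
      | add x x' hx hy => simp only [map_add, TensorProduct.add_tmul, add_mul, hx, hy]
      | tmul b m =>
        induction t using TensorProduct.induction_on with
        | zero => simp
        | add x y hx hy => simp only [map_add, TensorProduct.tmul_add, mul_add, hx, hy]
        | tmul c n => simp [tensorMul_tmul, consEquiv_mul, ih]
    rw [h, unbraid_consEquiv, unbraid_consEquiv, unbraid_consEquiv,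
      unbraidLf_mul _ (isEquivariant_braidedMul n), key]

/-! ### Insertion of units -/

theorem insertUnits_one {k n : ℕ} (i : Fin k ↪o Fin n) : insertUnits i 1 = 1 := by
  rw [PiTensorProduct.one_def, PiTensorProduct.one_def, insertUnits_tprod]
  congr 1
  funext l
  by_cases hl : ∃ j, i j = l
  · obtain ⟨j, rfl⟩ := hl
    rw [i.injective.extend_apply]
    rfl
  · rw [Function.extend_apply' _ _ _ hl]

/-- With `insertUnits_of_succ`, this makes the insertion recursive in the number of factors, in step
with `unbraid` and `alphaComp`: the first position is either occupied or filled with 1. -/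
theorem insertUnits_of_zero {k n : ℕ} {i : Fin (k + 1) ↪o Fin (n + 1)} {j : Fin k ↪o Fin n}
    (h0 : i 0 = 0) (hs : ∀ l, i l.succ = (j l).succ) :
    insertUnits i ∘ₗ (consEquiv lf k).toLinearMap =
      (consEquiv lf n).toLinearMap ∘ₗ (insertUnits j).lTensor lf := by
  refine TensorProduct.ext' fun a z => ?_
  induction z using PiTensorProduct.induction_on with
  | add x y hx hy => simp only [TensorProduct.tmul_add, map_add, hx, hy]
  | smul_tprod r f =>
    simp only [TensorProduct.tmul_smul, map_smul, LinearMap.comp_apply, LinearEquiv.coe_coe,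
      LinearMap.lTensor_tmul, insertUnits_tprod, consEquiv_tmul]
    congr 2
    funext l
    refine Fin.cases ?_ (fun l => ?_) l
    · rw [← h0, i.injective.extend_apply, h0]
      rfl
    · rw [Fin.cons_succ]
      by_cases hl : ∃ l', j l' = l
      · obtain ⟨l', rfl⟩ := hl
        rw [j.injective.extend_apply, ← hs, i.injective.extend_apply, Fin.cons_succ]
      · rw [Function.extend_apply' _ _ _ hl, Function.extend_apply']
        · rfl
        · rintro ⟨l', hl'⟩
          induction l' using Fin.cases with
          | zero => exact Fin.succ_ne_zero l (hl'.symm.trans h0)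
          | succ l' => exact hl ⟨l', Fin.succ_injective _ ((hs l').symm.trans hl')⟩

theorem insertUnits_of_succ {k n : ℕ} {i : Fin k ↪o Fin (n + 1)} {j : Fin k ↪o Fin n}
    (hs : ∀ l, i l = (j l).succ) : insertUnits i =
      (consEquiv lf n).toLinearMap ∘ₗ TensorProduct.mk Cq lf (⨂[Cq]^n lf) 1 ∘ₗ insertUnits j := by
  refine LinearMap.ext fun z => ?_
  induction z using PiTensorProduct.induction_on with
  | add x y hx hy => simp only [map_add, hx, hy]
  | smul_tprod r f =>
    simp only [map_smul, LinearMap.comp_apply, LinearEquiv.coe_coe, TensorProduct.mk_apply,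
      insertUnits_tprod, consEquiv_tmul]
    congr 2
    funext l
    refine Fin.cases ?_ (fun l => ?_) l
    · rw [Fin.cons_zero, Function.extend_apply']
      · rfl
      · rintro ⟨l', hl'⟩
        exact Fin.succ_ne_zero _ ((hs l').symm.trans hl')
    · rw [Fin.cons_succ]
      by_cases hl : ∃ l', j l' = l
      · obtain ⟨l', rfl⟩ := hl
        rw [j.injective.extend_apply, ← hs, i.injective.extend_apply]
      · rw [Function.extend_apply' _ _ _ hl, Function.extend_apply']
        · rfl
        · rintro ⟨l', hl'⟩
          exact hl ⟨l', Fin.succ_injective _ ((hs l').symm.trans hl')⟩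

/-! ### Compatibility of position sets with the shift -/

theorem mem_shift {n : ℕ} {A : Finset (Fin (n + 1))} {j : Fin n} : j ∈ shift A ↔ j.succ ∈ A := by
  simp [shift]

theorem card_eq_card_shift {n : ℕ} (A : Finset (Fin (n + 1))) :
    A.card = (shift A).card + if 0 ∈ A then 1 else 0 := by
  have h := Fin.card_filter_univ_succ (n := n) fun x => x ∈ A
  rw [Finset.filter_univ_mem] at h
  rw [h, shift]
  split_ifs <;> rfl

/-- An increasing enumeration of a finite set is unique, and prepending 0 to the shifted enumeration
gives one. -/
theorem orderEmbOfFin_of_zero_mem {n k : ℕ} {A : Finset (Fin (n + 1))} (hA : A.card = k + 1)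
    (h0 : 0 ∈ A) (hs : (shift A).card = k) : A.orderEmbOfFin hA 0 = 0 ∧
      ∀ l, A.orderEmbOfFin hA l.succ = ((shift A).orderEmbOfFin hs l).succ := by
  have h := Finset.orderEmbOfFin_unique hA
    (f := Fin.cons 0 fun l => ((shift A).orderEmbOfFin hs l).succ)
    (fun l => by
      refine Fin.cases h0 (fun l => ?_) l
      exact mem_shift.1 (Finset.orderEmbOfFin_mem _ hs l))
    (by
      intro a b hab
      induction b using Fin.cases with
      | zero => exact absurd hab (Fin.not_lt_zero a)
      | succ b =>
        induction a using Fin.cases with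
        | zero => exact Fin.succ_pos _
        | succ a =>
          exact Fin.succ_lt_succ_iff.2
            (((shift A).orderEmbOfFin hs).strictMono (Fin.succ_lt_succ_iff.1 hab)))
  exact ⟨(congrFun h 0).symm, fun l => (congrFun h l.succ).symm⟩

theorem orderEmbOfFin_of_zero_notMem {n k : ℕ} {A : Finset (Fin (n + 1))} (hA : A.card = k)
    (hs : (shift A).card = k) (l : Fin k) :
    A.orderEmbOfFin hA l = ((shift A).orderEmbOfFin hs l).succ :=
  (congrFun (Finset.orderEmbOfFin_unique hA
    (f := fun l => ((shift A).orderEmbOfFin hs l).succ)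
    (fun l => mem_shift.1 (Finset.orderEmbOfFin_mem _ hs l))
    (Fin.strictMono_succ.comp (OrderEmbedding.strictMono _))) l).symm

/-- Units span trivial modules, so adding one on the left is equivariant; the recursion for the
insertion does the rest. Naturality of the coaction can then be used in the main formula. -/
theorem isEquivariant_insertUnits (n : ℕ) : ∀ {k : ℕ} {A : Finset (Fin n)} (hA : A.card = k),
    IsEquivariant (powAct k) (powAct n) (insertUnits (A.orderEmbOfFin hA)) := by
  induction n with
  | zero =>
    intro k A hA
    obtain rfl : k = 0 := by rw [← hA, Finset.eq_empty_of_isEmpty A, Finset.card_empty]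
    intro h z
    rw [powAct_zero_apply, powAct_zero_apply, map_smul]
  | succ n ih =>
    intro k A hA
    have hc := card_eq_card_shift A
    by_cases h0 : 0 ∈ A
    · rw [if_pos h0, hA] at hc
      obtain rfl : k = (shift A).card + 1 := hc
      obtain ⟨h1, h2⟩ := orderEmbOfFin_of_zero_mem hA h0 rfl
      have e := insertUnits_of_zero h1 h2
      have e' : insertUnits (A.orderEmbOfFin hA) = (consEquiv lf n).toLinearMap ∘ₗ
          (insertUnits ((shift A).orderEmbOfFin rfl)).lTensor lf ∘ₗ
          (consEquiv lf (shift A).card).symm.toLinearMap := by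
        rw [← LinearMap.comp_assoc, ← e, LinearMap.comp_assoc]
        ext
        simp
      rw [e']
      exact (isEquivariant_consEquiv n).comp ((ih rfl).lTensor.comp (isEquivariant_consEquiv _).symm)
    · rw [if_neg h0, hA, add_zero] at hc
      rw [insertUnits_of_succ (orderEmbOfFin_of_zero_notMem hA hc.symm)]
      exact (isEquivariant_consEquiv n).comp ((isEquivariant_one_tmul n).comp (ih hc.symm))

/-! ### The main formula -/

theorem braidedComulIter_zero (x : lf) : braidedComulIter 0 x = consEquiv lf 0 (x ⊗ₜ 1) := by
  rw [PiTensorProduct.one_def, consEquiv_tmul, braidedComulIter, LinearEquiv.coe_coe,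
    PiTensorProduct.subsingletonEquiv_symm_apply']
  congr 1
  funext i
  rw [Subsingleton.elim i 0]
  rfl

theorem isEquivariant_braidedComulIter (m : ℕ) :
    IsEquivariant adlf (powAct (m + 1)) (braidedComulIter m) := by
  induction m with
  | zero =>
    have e : braidedComulIter 0 = (consEquiv lf 0).toLinearMap ∘ₗ
        (TensorProduct.mk Cq lf (⨂[Cq]^0 lf)).flip 1 := LinearMap.ext braidedComulIter_zero
    rw [e]
    exact (isEquivariant_consEquiv 0).comp (isEquivariant_tmul_one 0)
  | succ m ih =>
    exact (isEquivariant_consEquiv (m + 1)).comp (ih.lTensor.comp isEquivariant_braidedComul)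

theorem unbraid_insertUnits_braidedComulIter (n : ℕ) : ∀ (k : ℕ) (A : Finset (Fin n))
    (hA : A.card = k + 1) (x : lf),
    unbraid n (insertUnits (A.orderEmbOfFin hA) (braidedComulIter k x)) = alphaComp n A x := by
  induction n with
  | zero =>
    intro k A hA
    rw [Finset.eq_empty_of_isEmpty A, Finset.card_empty] at hA
    omega
  | succ n ih =>
    intro k A hA x
    have hc := card_eq_card_shift A
    rw [hA] at hc
    by_cases hs : shift A = ∅
    · rw [hs, Finset.card_empty] at hc
      -- As `A` is non-empty and has no further element, it is the singleton of the first position.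
      -- The coaction on the unit is trivial, so φ(x ⊗ 1) = x ⊗ 1.
      have h0 : 0 ∈ A := by
        by_contra h
        rw [if_neg h] at hc
        omega
      rw [if_pos h0] at hc
      obtain rfl : k = 0 := by omega
      have hs' : (shift A).card = 0 := by rw [hs, Finset.card_empty]
      obtain ⟨h1, h2⟩ := orderEmbOfFin_of_zero_mem hA h0 hs'
      have e := LinearMap.congr_fun (insertUnits_of_zero h1 h2) (x ⊗ₜ 1)
      simp only [LinearMap.comp_apply, LinearEquiv.coe_coe, LinearMap.lTensor_tmul,
        insertUnits_one] at e
      rw [braidedComulIter_zero, e, unbraid_consEquiv, unbraidLf_tmul, coact_powAct_one,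
        LinearMap.rTensor_tmul, LinearMap.lTensor_tmul, unbraid_one, alphaComp, if_pos hs]
      simp
    · by_cases h0 : 0 ∈ A
      · rw [if_pos h0] at hc
        have hs' : (shift A).card = k := by omega
        obtain ⟨k, rfl⟩ : ∃ k', k = k' + 1 := Nat.exists_eq_succ_of_ne_zero fun h =>
          hs (Finset.card_eq_zero.1 (hs'.trans h))
        obtain ⟨h1, h2⟩ := orderEmbOfFin_of_zero_mem hA h0 hs'
        have e := LinearMap.congr_fun (insertUnits_of_zero h1 h2)
          ((braidedComulIter k).lTensor lf (braidedComul x))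
        simp only [LinearMap.comp_apply, LinearEquiv.coe_coe, ← LinearMap.lTensor_comp_apply] at e
        have e1 : (unbraid n) ∘ₗ insertUnits ((shift A).orderEmbOfFin hs') ∘ₗ braidedComulIter k =
            alphaComp n (shift A) := LinearMap.ext (ih k (shift A) hs')
        rw [alphaComp, if_neg hs, if_pos h0, braidedComulIter]
        simp only [LinearMap.comp_apply, LinearEquiv.coe_coe]
        -- The equivariant map on the last factors is moved past φ, which then meets the braided
        -- coproduct alone and gives Δ.
        rw [e, unbraid_consEquiv, ((isEquivariant_insertUnits n hs').comp
            (isEquivariant_braidedComulIter k)).unbraidLf_lTensor (hρ := isAdmissible_adlf),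
          unbraidLf_braidedComul, ← LinearMap.lTensor_comp_apply, e1]
      · rw [if_neg h0, add_zero] at hc
        have e1 : (unbraid n) ∘ₗ insertUnits ((shift A).orderEmbOfFin hc.symm) ∘ₗ
            braidedComulIter k = alphaComp n (shift A) := LinearMap.ext (ih k (shift A) hc.symm)
        rw [insertUnits_of_succ (orderEmbOfFin_of_zero_notMem hA hc.symm), alphaComp, if_neg hs,
          if_neg h0]
        simp only [LinearMap.comp_apply, LinearEquiv.coe_coe, TensorProduct.mk_apply,
          AlgHom.toLinearMap_apply]
        -- The first factor is 1, so φ is just the coaction. By naturality it may be taken before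
        -- the equivariant map, where it is τ_L.
        rw [unbraid_consEquiv, unbraidLf_tmul, ← LinearMap.comp_apply (insertUnits _),
          ((isEquivariant_insertUnits n hc.symm).comp
            (isEquivariant_braidedComulIter k)).coact (hρ := isAdmissible_adlf), tauL_apply, ← e1,
          LinearMap.lTensor_comp_apply U (unbraid n)]
        simp

/-- The generators are reached by the main formula for Λ, and the image is a subalgebra because the
unbraiding map is unital and multiplicative. -/
theorem exists_unbraid_eq_of_mem_AW (n : ℕ) {w : ⨂[Cq]^n U} (hw : w ∈ AW n) :
    ∃ z, unbraid n z = w := by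
  induction hw using Algebra.adjoin_induction with
  | mem w hw =>
    obtain ⟨A, hA, rfl⟩ := hw
    rw [casimirGen, if_neg hA.ne_empty]
    obtain ⟨k, hk⟩ := Nat.exists_eq_succ_of_ne_zero hA.card_ne_zero
    exact ⟨_, unbraid_insertUnits_braidedComulIter n k A hk lfCasimir⟩
  | algebraMap r =>
    exact ⟨r • 1, by rw [map_smul, unbraid_one, Algebra.algebraMap_eq_smul_one]⟩
  | add x y _ _ hx hy =>
    obtain ⟨a, rfl⟩ := hx
    obtain ⟨b, rfl⟩ := hy
    exact ⟨a + b, map_add _ _ _⟩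
  | mul x y _ _ hx hy =>
    obtain ⟨a, rfl⟩ := hx
    obtain ⟨b, rfl⟩ := hy
    exact ⟨_, unbraid_mul n a b⟩

end AskeyWilson

end

open AskeyWilson

theorem theorem1p2 :
    IsTauL tauL ∧
    (∀ x : lf, incl.rTensor lf (braidedComul x) = braidedComulFormula x) ∧
    ∀ n : ℕ,
      (Function.Injective (unbraid n) ∧ unbraid n 1 = 1 ∧
        ∀ x y : ⨂[Cq]^n lf, unbraid n (braidedMul n (x ⊗ₜ y)) = unbraid n x * unbraid n y) ∧
      (∀ w ∈ AW n, ∃ z, unbraid n z = w) ∧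
      (∀ (k : ℕ) (A : Finset (Fin n)) (hA : A.card = k + 1),
        (∀ x : lf, unbraid n (insertUnits (A.orderEmbOfFin hA) (braidedComulIter k x)) =
          alphaComp n A x) ∧
        (∀ z : ⨂[Cq]^n lf, unbraid n z = casimirGen n A ↔
          z = insertUnits (A.orderEmbOfFin hA) (braidedComulIter k lfCasimir))) := by
  refine ⟨isTauL_tauL, rTensor_braidedComul, fun n =>
    ⟨⟨unbraid_injective n, unbraid_one n, unbraid_mul n⟩,
      fun w hw => exists_unbraid_eq_of_mem_AW n hw, fun k A hA =>
      ⟨unbraid_insertUnits_braidedComulIter n k A hA, fun z => ?_⟩⟩⟩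
  -- This excludes the separate value of `casimirGen` at the empty set. Uniqueness is then
  -- injectivity of the unbraiding map.
  have hA' : A ≠ ∅ := by
    rintro rfl
    simp at hA
  rw [casimirGen, if_neg hA', ← unbraid_insertUnits_braidedComulIter n k A hA]
  exact (unbraid_injective n).eq_iff
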